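/- **Theorem 10 (Asymptotics of ETEL under misspecification).** Let $x_1,x_2,\dots$ be i.i.d. random elements of a standard Borel space $\mathcal X$ (for instance a Borel subset of $\mathbb R^{N_x}$), let $E$ denote expectation under their common law and $x$ a random element with this law. Let $\Theta\subset\mathbb R^{N_\theta}$ be compact and let $g:\mathcal X\times\mathbb R^{N_\theta}\to\mathbb R^{N_g}$ be jointly measurable with $E\|g(x,\theta)\|<\infty$ for all $\theta\in\Theta$. Write $G(x,\theta)=\partial g(x,\theta)/\partial\theta'$ and $S_{jl}(x,\theta)=\partial^2 g(x,\theta)/\partial\theta_j\partial\theta_l$. *Estimator.* For a sample of size $n$ and $\theta\in\Theta$, let $\hat w(\theta)$ be the minimizer of $n^{-1}\sum_i nw_i\ln(nw_i)$ over weights $w_i\ge 0$ with $\sum_i w_i g(x_i,\theta)=0$ and $\sum_i w_i=1$. An ETEL estimate $\hat\theta$ is a minimizer over $\theta\in\Theta$ of $n^{-1}\sum_i-\ln(n\hat w_i(\theta))$, which is read as $+\infty$ where $\hat w(\theta)$ does not exist or has a zero entry (and the minimum has to be finite). With $g_i=g(x_i,\hat\theta)$, an augmented ETEL estimate is $\hat\beta=(\hat\tau,\hat\kappa,\hat\lambda,\hat\theta)$,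 where $\hat\theta$ is an ETEL estimate, $\hat\lambda\in\arg\max_{\lambda\in\mathbb R^{N_g}} n^{-1}\sum_i-\exp(\lambda'g_i)$, $\hat\tau=n^{-1}\sum_i\hat\tau_i$ with $\hat\tau_i=\exp(\hat\lambda'g_i)$, and $\hat\kappa$ solves $(n^{-1}\sum_i\hat\tau_ig_ig_i')\hat\kappa+\hat\tau\,n^{-1}\sum_ig_i=0$. Let $\hat\beta_n$ be random vectors such that $\hat\beta_n$ is an augmented ETEL estimate for $x_1,\dots,x_n$ with probability tending to $1$. *Regularity conditions.* 1. For every $\theta\in\Theta$ the equation $E[\exp(\lambda'g(x,\theta))g(x,\theta)]=0$ has a unique solution $\lambda=\lambda^*(\theta)$. 2. $\ln L(\theta)=-\ln E[\exp(\lambda^*(\theta)'(g(x,\theta)-E[g(x,\theta)]))]$ is maximized over $\Theta$ at a unique point $\theta^*$, and $\theta^*\in\operatorname{int}(\Theta)$. 3. For each $\theta\in\Theta$, with probability one $g(x,\cdot)$, restricted to $\Theta$, is continuous at $\theta$. 4. There are compact sets $\Lambda(\theta)\subset\mathbb R^{N_g}$, $\theta\in\Theta$, with $\bigcup_{\theta\in\Theta}\Lambda(\theta)$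 bounded and, for some $r>0$ and all $\theta\in\Theta$, containing the closed ball of radius $r$ about $\lambda^*(\theta)$, such that $E[\sup_{\theta\in\Theta}\sup_{\lambda\in\Lambda(\theta)}\exp(\lambda'g(x,\theta))]<\infty$. 5. There is an open neighbourhood $\mathcal N\subset\Theta$ of $\theta^*$ such that, with probability one, $g(x,\cdot)$ is twice continuously differentiable on $\mathcal N$. 6. There is a measurable $b$ such that, with probability one, $\|g(x,\theta)\|$, $\|G(x,\theta)\|$ and $\|S_{jl}(x,\theta)\|$ are at most $b(x)$ for all $\theta\in\mathcal N$ and $j,l=1,\dots,N_\theta$, and $E[\sup_{\theta\in\mathcal N}\sup_{\lambda\in\Lambda(\theta)}\exp(k_1\lambda'g(x,\theta))\,b(x)^{k_2}]<\infty$ for $k_1=0,1,2$ and $k_2=0,1,2,3,4$. *Conclusion.* For $\beta=(\tau,\kappa,\lambda,\theta)$ let, with $\tau_x=\exp(\lambda'g)$, $g=g(x,\theta)$, $G=G(x,\theta)$, $$\phi(x,\beta)=\begin{bmatrix}\tau_x-\tau\\ \tau_xg\\ (\tau-\tau_x)g+\tau_xgg'\kappa\\ \tau_xG'\kappa+\tau_xG'\lambda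 g'\kappa-\tau_xG'\lambda+\tau G'\lambda\end{bmatrix},$$ and let $\beta^*=(\tau^*,\kappa^*,\lambda^*,\theta^*)$ with $\lambda^*=\lambda^*(\theta^*)$, $\tau^*=E[\exp(\lambda^{*\prime}g(x,\theta^*))]$ and $\kappa^*=-\big(E[\exp(\lambda^{*\prime}g(x,\theta^*))g(x,\theta^*)g(x,\theta^*)']\big)^{-1}\tau^*E[g(x,\theta^*)]$. Put $\Gamma=E[\partial\phi(x,\beta)/\partial\beta'|_{\beta=\beta^*}]$ and $\Phi=E[\phi(x,\beta^*)\phi(x,\beta^*)']$. If $\Gamma$ is nonsingular, then $$n^{1/2}(\hat\beta_n-\beta^*)\xrightarrow{d}N\big(0,\Gamma^{-1}\Phi(\Gamma')^{-1}\big).$$ -/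

import Mathlib

open MeasureTheory ProbabilityTheory Filter Topology
open scoped ENNReal

namespace ETEL

noncomputable section

/-- Euclidean space of dimension `n`. -/
abbrev E (n : ℕ) := EuclideanSpace ℝ (Fin n)

/-- Index set of the augmented parameter `β = (τ, κ, λ, θ)`, in this order. -/
abbrev Idx (Ng Nt : ℕ) := Unit ⊕ Fin Ng ⊕ Fin Ng ⊕ Fin Nt

/-- The space of augmented parameters `β = (τ, κ, λ, θ)`. -/
abbrev B (Ng Nt : ℕ) := EuclideanSpace ℝ (Idx Ng Nt)

section Coordinates

variable {Ng Nt : ℕ}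

/-- The augmented parameter with the given blocks. -/
def mkB (t : ℝ) (k l : E Ng) (θ : E Nt) : B Ng Nt :=
  WithLp.toLp 2 (Sum.elim (fun _ => t) (Sum.elim (fun i => k i)
    (Sum.elim (fun i => l i) (fun j => θ j))))

/-- The block `τ` of `β`. -/
def tauOf (β : B Ng Nt) : ℝ := β (Sum.inl ())

/-- The block `κ` of `β`. -/
def kapOf (β : B Ng Nt) : E Ng := WithLp.toLp 2 fun i => β (Sum.inr (Sum.inl i))

/-- The block `λ` of `β`. -/
def lamOf (β : B Ng Nt) : E Ng := WithLp.toLp 2 fun i => β (Sum.inr (Sum.inr (Sum.inl i)))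

/-- The block `θ` of `β`. -/
def thOf (β : B Ng Nt) : E Nt := WithLp.toLp 2 fun j => β (Sum.inr (Sum.inr (Sum.inr j)))

end Coordinates

variable {𝒳 : Type*} {Ng Nt : ℕ}

/-- The tilting factor `exp(λ' g(x, θ))`. -/
def tilt (g : 𝒳 → E Nt → E Ng) (x : 𝒳) (θ : E Nt) (l : E Ng) : ℝ :=
  Real.exp (inner ℝ l (g x θ))

/-! ### The estimator -/

/-- `w` solves the exponential tilting problem at `θ` for the sample `x₁, …, xₙ`: it minimizes
`n⁻¹ ∑ (n wᵢ) ln (n wᵢ)` (with `0 ln 0 = 0`) among the nonnegative weights with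
`∑ wᵢ g(xᵢ, θ) = 0` and `∑ wᵢ = 1`. -/
def IsETWeights (g : 𝒳 → E Nt → E Ng) {n : ℕ} (x : Fin n → 𝒳) (θ : E Nt) (w : Fin n → ℝ) : Prop :=
  let feasible : Set (Fin n → ℝ) :=
    {v | (∀ i, 0 ≤ v i) ∧ ∑ i, v i • g (x i) θ = 0 ∧ ∑ i, v i = 1}
  w ∈ feasible ∧
    IsMinOn (fun v : Fin n → ℝ => (n : ℝ)⁻¹ * ∑ i, (n * v i) * Real.log (n * v i)) feasible w

/-- The empirical likelihood discrepancy `n⁻¹ ∑ -ln (n wᵢ)` (meaningful for positive weights). -/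
def elDiscrepancy {n : ℕ} (w : Fin n → ℝ) : ℝ :=
  (n : ℝ)⁻¹ * ∑ i, -Real.log (n * w i)

/-- `θ` is an exponentially tilted empirical likelihood estimate for the sample `x₁, …, xₙ`:
it minimizes over `Θ` the discrepancy `n⁻¹ ∑ -ln (n ŵᵢ(θ))` of the exponential tilting
weights. The discrepancy is `+∞` at the parameters where the weights do not exist or where one
of them is zero, so `θ` is compared with the other parameters only. -/
def IsETEL (g : 𝒳 → E Nt → E Ng) (Θ : Set (E Nt)) {n : ℕ} (x : Fin n → 𝒳) (θ : E Nt) : Prop :=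
  θ ∈ Θ ∧ ∃ w : Fin n → ℝ, IsETWeights g x θ w ∧ (∀ i, 0 < w i) ∧
    ∀ θ' ∈ Θ, ∀ w' : Fin n → ℝ, IsETWeights g x θ' w' → (∀ i, 0 < w' i) →
      elDiscrepancy w ≤ elDiscrepancy w'

/-- `β = (τ, κ, λ, θ)` is an augmented ETEL estimate for the sample `x₁, …, xₙ`: `θ` is an ETEL
estimate, `λ` maximizes `n⁻¹ ∑ -exp(λ' gᵢ)` over the whole space, `τ = n⁻¹ ∑ τᵢ` with
`τᵢ = exp(λ' gᵢ)`, and `(n⁻¹ ∑ τᵢ gᵢ gᵢ') κ + τ n⁻¹ ∑ gᵢ = 0`, where `gᵢ = g(xᵢ, θ)`. -/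
structure IsAugmentedETEL (g : 𝒳 → E Nt → E Ng) (Θ : Set (E Nt)) {n : ℕ} (x : Fin n → 𝒳)
    (β : B Ng Nt) : Prop where
  theta : IsETEL g Θ x (thOf β)
  lam : IsMaxOn (fun l : E Ng => (n : ℝ)⁻¹ * ∑ i, -tilt g (x i) (thOf β) l) Set.univ (lamOf β)
  tau : tauOf β = (n : ℝ)⁻¹ * ∑ i, tilt g (x i) (thOf β) (lamOf β)
  kap : (n : ℝ)⁻¹ • ∑ i, (tilt g (x i) (thOf β) (lamOf β) *
        inner ℝ (g (x i) (thOf β)) (kapOf β)) • g (x i) (thOf β)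
      + tauOf β • ((n : ℝ)⁻¹ • ∑ i, g (x i) (thOf β)) = 0

/-! ### The moment function of the augmented parameter -/

/-- The `j`-th column `∂g(x, θ)/∂θⱼ` of the Jacobian `G(x, θ) = ∂g(x, θ)/∂θ'`. -/
def Gcol (g : 𝒳 → E Nt → E Ng) (x : 𝒳) (θ : E Nt) (j : Fin Nt) : E Ng :=
  fderiv ℝ (g x) θ (EuclideanSpace.single j 1)

/-- The second partial derivative `∂²g(x, θ)/∂θⱼ∂θₗ`. -/
def Spart (g : 𝒳 → E Nt → E Ng) (x : 𝒳) (θ : E Nt) (j l : Fin Nt) : E Ng :=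
  fderiv ℝ (fun θ' => Gcol g x θ' l) θ (EuclideanSpace.single j 1)

/-- The moment function of the augmented parameter, with `τₓ = exp(λ' g)`:
`φ(x, β) = (τₓ - τ, τₓ g, (τ - τₓ) g + τₓ g g' κ,
  τₓ G'κ + τₓ G'λ g'κ - τₓ G'λ + τ G'λ)`. -/
def phi (g : 𝒳 → E Nt → E Ng) (x : 𝒳) (β : B Ng Nt) : B Ng Nt :=
  let θ := thOf β
  let l := lamOf β
  let k := kapOf β
  let t := tauOf β
  let tx := tilt g x θ l
  mkB (tx - t)
    (tx • g x θ)
    ((t - tx) • g x θ + (tx * inner ℝ (g x θ) k) • g x θ)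
    (WithLp.toLp 2 fun j =>
      tx * inner ℝ (Gcol g x θ j) k
        + tx * inner ℝ (Gcol g x θ j) l * inner ℝ (g x θ) k
        - tx * inner ℝ (Gcol g x θ j) l
        + t * inner ℝ (Gcol g x θ j) l)

variable [MeasurableSpace 𝒳]

/-! ### Population quantities, for the law `μ` of one observation -/

/-- `λ` solves the population equation `E[exp(λ' g(x, θ)) g(x, θ)] = 0`. -/
def IsTiltSolution (μ : Measure 𝒳) (g : 𝒳 → E Nt → E Ng) (θ : E Nt) (l : E Ng) : Prop :=
  Integrable (fun x => tilt g x θ l • g x θ) μ ∧ ∫ x, tilt g x θ l • g x θ ∂μ = 0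

/-- `ln L(θ) = -ln E[exp(λ*(θ)' (g(x, θ) - E[g(x, θ)]))]`. -/
def logL (μ : Measure 𝒳) (g : 𝒳 → E Nt → E Ng) (lamS : E Nt → E Ng) (θ : E Nt) : ℝ :=
  -Real.log (∫ x, Real.exp (inner ℝ (lamS θ) (g x θ - ∫ y, g y θ ∂μ)) ∂μ)

/-- The regularity conditions under misspecification. Here `μ` is the law of one observation,
`lamS θ` is the solution `λ*(θ)`, `θs` the pseudo-true value, `Λ θ` the compact sets, `N` the
neighbourhood of `θs` and `b` the bounding function of the conditions. -/
structure Regularity (μ : Measure 𝒳) (g : 𝒳 → E Nt → E Ng) (Θ : Set (E Nt))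
    (lamS : E Nt → E Ng) (θs : E Nt) (Λ : E Nt → Set (E Ng)) (N : Set (E Nt)) (b : 𝒳 → ℝ) :
    Prop where
  measurable_g : Measurable (Function.uncurry g)
  measurable_b : Measurable b
  integrable_g : ∀ θ ∈ Θ, Integrable (fun x => g x θ) μ
  lamS_solution : ∀ θ ∈ Θ, IsTiltSolution μ g θ (lamS θ)
  lamS_unique : ∀ θ ∈ Θ, ∀ l, IsTiltSolution μ g θ l → l = lamS θ
  compact : IsCompact Θ
  interior : θs ∈ interior Θ
  maximizer : ∀ θ ∈ Θ, θ ≠ θs → logL μ g lamS θ < logL μ g lamS θs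
  continuous_g : ∀ θ ∈ Θ, ∀ᵐ x ∂μ, ContinuousWithinAt (g x) Θ θ
  compact_lam : ∀ θ ∈ Θ, IsCompact (Λ θ)
  bounded_lam : Bornology.IsBounded (⋃ θ ∈ Θ, Λ θ)
  interior_lam : ∃ r : ℝ, 0 < r ∧ ∀ θ ∈ Θ, Metric.closedBall (lamS θ) r ⊆ Λ θ
  exp_moment : ∫⁻ x, ⨆ θ ∈ Θ, ⨆ l ∈ Λ θ, ENNReal.ofReal (tilt g x θ l) ∂μ < ∞
  isOpen_N : IsOpen N
  mem_N : θs ∈ N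
  N_subset : N ⊆ Θ
  contDiff_g : ∀ᵐ x ∂μ, ContDiffOn ℝ 2 (g x) N
  bound_g : ∀ᵐ x ∂μ, ∀ θ ∈ N, ‖g x θ‖ ≤ b x
  bound_G : ∀ᵐ x ∂μ, ∀ θ ∈ N, ‖fderiv ℝ (g x) θ‖ ≤ b x
  bound_S : ∀ᵐ x ∂μ, ∀ θ ∈ N, ∀ j l : Fin Nt, ‖Spart g x θ j l‖ ≤ b x
  bound_moment : ∀ k₁ ≤ 2, ∀ k₂ ≤ 4,
    ∫⁻ x, ⨆ θ ∈ N, ⨆ l ∈ Λ θ,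
      ENNReal.ofReal (Real.exp ((k₁ : ℕ) * inner ℝ l (g x θ)) * b x ^ (k₂ : ℕ)) ∂μ < ∞

/-- `τ* = E[exp(λ*' g(x, θ*))]` with `λ* = λ*(θ*)`. -/
def tauStar (μ : Measure 𝒳) (g : 𝒳 → E Nt → E Ng) (lamS : E Nt → E Ng) (θs : E Nt) : ℝ :=
  ∫ x, tilt g x θs (lamS θs) ∂μ

/-- The tilted second moment matrix `E[exp(λ*' g) g g']` at `θ*`. -/
def omegaStar (μ : Measure 𝒳) (g : 𝒳 → E Nt → E Ng) (lamS : E Nt → E Ng) (θs : E Nt) :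
    Matrix (Fin Ng) (Fin Ng) ℝ :=
  Matrix.of fun i j => ∫ x, tilt g x θs (lamS θs) * g x θs i * g x θs j ∂μ

/-- `κ* = -(E[exp(λ*' g) g g'])⁻¹ (τ* E[g])` at `θ*`. -/
def kapStar (μ : Measure 𝒳) (g : 𝒳 → E Nt → E Ng) (lamS : E Nt → E Ng) (θs : E Nt) : E Ng :=
  WithLp.toLp 2 (-((omegaStar μ g lamS θs)⁻¹.mulVec
    fun i => tauStar μ g lamS θs * (∫ x, g x θs ∂μ) i))

/-- The pseudo-true augmented parameter `β* = (τ*, κ*, λ*, θ*)`. -/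
def betaStar (μ : Measure 𝒳) (g : 𝒳 → E Nt → E Ng) (lamS : E Nt → E Ng) (θs : E Nt) : B Ng Nt :=
  mkB (tauStar μ g lamS θs) (kapStar μ g lamS θs) (lamS θs) θs

/-- `Γ = E[∂φ(x, β)/∂β']` at `β`. -/
def Gam (μ : Measure 𝒳) (g : 𝒳 → E Nt → E Ng) (β : B Ng Nt) :
    Matrix (Idx Ng Nt) (Idx Ng Nt) ℝ :=
  Matrix.of fun i j =>
    ∫ x, (fderiv ℝ (fun β' => phi g x β') β (EuclideanSpace.single j 1)) i ∂μ

/-- `Φ = E[φ(x, β) φ(x, β)']`. -/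
def Phi (μ : Measure 𝒳) (g : 𝒳 → E Nt → E Ng) (β : B Ng Nt) :
    Matrix (Idx Ng Nt) (Idx Ng Nt) ℝ :=
  Matrix.of fun i j => ∫ x, phi g x β i * phi g x β j ∂μ

end

end ETEL

/-! With probability tending to one the estimate is a zero of the sample average of `phi`, so the
theorem reduces to the usual expansion of such a zero. Near `β*` the average of `φ(x, β)` differs
from its affine approximation with slope `Γ` by at most `ε‖β - β*‖`. Hence `avg φ(·, β*) + Γ(β̂ -
β*)` is small relative to `β̂ - β*`. Inverting `Γ` turns `√n(β̂ - β*)` into a normalized sum of the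
vectors `-Γ⁻¹φ(xᵢ, β*)`, to which the central limit theorem applies. The remainder is relative, so
it is absorbed and no rate of convergence is needed beforehand (`tendstoInDistribution_sqrt_smul`).

Convergence in probability is convergence along `prFilter`, and `SampleLLN` holds the only facts
about the sample that are used before the central limit theorem. Consistency thus becomes
deterministic analysis along a filter.

The inner problem is convex: positive tilting weights correspond to critical points of `l ↦ sampleM
g x θ l`. If this function is larger on a small sphere about `λ*(θ)` than at its centre, all
critical points lie inside, and one exists. Compactness of `Θ` makes this uniform in `θ`
(`Regularity.eventually_isCrit_near`). The outer objective equals `disc`. It is bounded below away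
from `θ*` and above at `θ*`, which localizes `θ̂` (`Regularity.eventually_isETEL_near`). In the
manner of Wald only lower bounds have to be locally uniform (`SampleLLN.eventually_lt_avg`), since
`g` itself has no integrable envelope over `Θ`. The null set in the continuity condition depends on
`θ`, so infima over countable dense sets would not suffice. Infima over uncountable sets are
measurable because projections of Borel sets are analytic, hence universally measurable.

The moment equations come from Lagrange multipliers for minimizing `disc` in `(λ, θ)` under the
tilting equation. The multiplier is proportional to `κ̂`, so `λ̂(θ)` never has to be differentiated
(`IsAugmentedETEL.avg_phi_eq_zero`).

With `v` bounding the tilting factor and `b` bounding `g` and its derivatives, `φ` is at most a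
multiple of `(1+v)(1+b)²`, with Lipschitz constant a multiple of `(1+v)(1+b)³`. The moments of order
two in `v` and four in `b` therefore give both a square integrable `φ` and an integrable Lipschitz
constant. The linearization needs only these and differentiability at the single point `β*`. -/

namespace ETEL

/-! ### Measurability of suprema over a parameter set -/

section Analytic

open Set

variable {α : Type*} [TopologicalSpace α]

/-- A continuous image of the Baire space is inner regular for compact sets. -/
theorem exists_isCompact_le_measure_range [MeasurableSpace α] {μ : Measure α} [μ.OuterRegular]
    {f : (ℕ → ℕ) → α} (hf : Continuous f) {c : ℝ≥0∞} (hc : c < μ (range f)) :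
    ∃ K ⊆ range f, IsCompact K ∧ c ≤ μ K := by
  -- Outer measure is continuous along increasing unions even of nonmeasurable sets, so one more
  -- coordinate can be bounded while the strict inequality survives.
  have step : ∀ (k : ℕ) (S : {S : Set (ℕ → ℕ) // c < μ (f '' S)}),
      ∃ m : ℕ, c < μ (f '' (S.1 ∩ {s | s k ≤ m})) := by
    rintro k ⟨S, hS⟩
    have hmono : Monotone fun m : ℕ => f '' (S ∩ {s | s k ≤ m}) := fun a b hab =>
      image_mono (inter_subset_inter_right _ fun s (hs : s k ≤ a) => hs.trans hab)
    have hU : (⋃ m : ℕ, f '' (S ∩ {s | s k ≤ m})) = f '' S := by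
      rw [← image_iUnion, ← inter_iUnion]
      congr 1
      refine inter_eq_left.2 fun s _ => mem_iUnion.2 ⟨s k, le_refl (s k)⟩
    rw [← hU, hmono.measure_iUnion, lt_iSup_iff] at hS
    exact hS
  choose m hm using step
  let S : ℕ → {S : Set (ℕ → ℕ) // c < μ (f '' S)} := fun k =>
    Nat.rec ⟨univ, by rwa [image_univ]⟩ (fun k S => ⟨S.1 ∩ {s | s k ≤ m k S}, hm k S⟩) k
  let a : ℕ → ℕ := fun k => m k (S k)
  have hS : ∀ k, (S k).1 = {s | ∀ i < k, s i ≤ a i} := by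
    intro k
    induction k with
    | zero => ext; simp [S]
    | succ k ih =>
      have : (S (k + 1)).1 = (S k).1 ∩ {s | s k ≤ a k} := rfl
      rw [this, ih]
      ext s
      simp only [mem_inter_iff, mem_ofPred_eq, Nat.lt_succ_iff_lt_or_eq]
      constructor
      · rintro ⟨h1, h2⟩ i (hi | rfl)
        exacts [h1 i hi, h2]
      · exact fun h => ⟨fun i hi => h i (Or.inl hi), h k (Or.inr rfl)⟩
  let K : Set (ℕ → ℕ) := pi univ fun k => Iic (a k)
  have hK : IsCompact K := isCompact_univ_pi fun k => (finite_Iic (a k)).isCompact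
  refine ⟨f '' K, image_subset_range _ _, hK.image hf, ?_⟩
  rw [(f '' K).measure_eq_iInf_isOpen μ]
  refine le_iInf₂ fun U hU => le_iInf fun hUo => ?_
  -- Otherwise pick points of `S k` outside the preimage. Truncating them into `K` leaves the first
  -- `k` coordinates unchanged, so a subsequence of the original points converges to a point of `K`,
  -- which the closed complement of the preimage would contain.
  obtain ⟨k, hk⟩ : ∃ k, (S k).1 ⊆ f ⁻¹' U := by
    by_contra! hcon
    have h1 : ∀ k, ∃ s ∈ (S k).1, s ∉ f ⁻¹' U := fun k => not_subset.1 (hcon k)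
    choose s hsS hsU using h1
    obtain ⟨t, htK, φ, hφ, hlim⟩ := hK.tendsto_subseq (x := fun k i => min (s k i) (a i))
      (fun k i _ => mem_Iic.2 (min_le_right _ _))
    have hlim' : Tendsto (fun k => s (φ k)) atTop (𝓝 t) := by
      rw [tendsto_pi_nhds] at hlim ⊢
      intro i
      refine (hlim i).congr' ?_
      filter_upwards [eventually_gt_atTop i] with k hk
      have := hsS (φ k)
      rw [hS] at this
      exact min_eq_left (this i (hk.trans_le (hφ.id_le k)))
    have : t ∈ (f ⁻¹' U)ᶜ := (hUo.preimage hf).isClosed_compl.mem_of_tendsto hlim'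
      (Eventually.of_forall fun k => hsU (φ k))
    exact this (hU (mem_image_of_mem f htK))
  exact ((S k).2.trans_le (measure_mono (image_subset_iff.2 hk))).le

/-- Analytic sets are universally measurable. -/
theorem nullMeasurableSet_of_analyticSet [PolishSpace α] [MeasurableSpace α] [BorelSpace α]
    (μ : Measure α) [IsFiniteMeasure μ] {s : Set α} (hs : AnalyticSet s) :
    NullMeasurableSet s μ := by
  let := TopologicalSpace.upgradeIsCompletelyMetrizable α
  rw [AnalyticSet] at hs
  rcases hs with rfl | ⟨f, hf, rfl⟩
  · exact nullMeasurableSet_empty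
  by_cases h0 : μ (range f) = 0
  · exact NullMeasurableSet.of_null h0
  obtain ⟨u, -, hu, hlim⟩ := exists_seq_strictMono_tendsto' (pos_iff_ne_zero.2 h0)
  choose K hKs hKc hK using fun n => exists_isCompact_le_measure_range (μ := μ) hf (hu n).2
  have hB : MeasurableSet (⋃ n, K n) := MeasurableSet.iUnion fun n => (hKc n).measurableSet
  have hBs : (⋃ n, K n) ⊆ range f := iUnion_subset hKs
  have hle : μ (range f) ≤ μ (⋃ n, K n) :=
    le_of_tendsto' hlim fun n => (hK n).trans (measure_mono (subset_iUnion K n))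
  -- A Borel subset and the measurable hull have the same finite measure, so the set between them
  -- agrees with both up to a null set.
  have h1 : (⋃ n, K n) =ᵐ[μ] toMeasurable μ (range f) :=
    ae_eq_of_subset_of_measure_ge (hBs.trans (subset_toMeasurable _ _))
      (by rwa [measure_toMeasurable]) hB.nullMeasurableSet (measure_ne_top _ _)
  have h2 : range f =ᵐ[μ] ⋃ n, K n :=
    ((LE.le.eventuallyLE (subset_toMeasurable μ (range f))).trans
      h1.symm.le).antisymm (LE.le.eventuallyLE hBs)
  exact hB.nullMeasurableSet.congr h2.symm

variable {X Y : Type*} [MeasurableSpace X] [StandardBorelSpace X] [MeasurableSpace Y]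
  [StandardBorelSpace Y] (μ : Measure X) [IsFiniteMeasure μ]

/-- Projections of Borel sets are universally measurable. -/
theorem nullMeasurableSet_image_fst {s : Set (X × Y)} (hs : MeasurableSet s) :
    NullMeasurableSet (Prod.fst '' s) μ := by
  let := upgradeStandardBorel X
  exact nullMeasurableSet_of_analyticSet μ (hs.analyticSet_image measurable_fst)

/-- Superlevel sets of the supremum are projections of measurable sets, hence null measurable. No
continuity in the parameter is needed. -/
theorem aemeasurable_biSup_param {h : X → Y → ℝ≥0∞} (hh : Measurable (Function.uncurry h))
    {S : Set Y} (hS : MeasurableSet S) : AEMeasurable (fun x => ⨆ y ∈ S, h x y) μ := by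
  suffices hm : @Measurable (NullMeasurableSpace X μ) _ _ _ fun x => ⨆ y ∈ S, h x y from
    NullMeasurable.aemeasurable fun s hs => hm hs
  refine measurable_of_Ioi fun a => ?_
  have heq : Prod.fst '' (Prod.snd ⁻¹' S ∩ Function.uncurry h ⁻¹' Ioi a) =
      {x : X | a < ⨆ y ∈ S, h x y} := by
    ext x
    simp [lt_iSup_iff]
  have := nullMeasurableSet_image_fst μ ((measurable_snd hS).inter (hh (measurableSet_Ioi (a := a))))
  rwa [heq] at this

theorem aemeasurable_biInf_param {h : X → Y → ℝ≥0∞} (hh : Measurable (Function.uncurry h))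
    {S : Set Y} (hS : MeasurableSet S) : AEMeasurable (fun x => ⨅ y ∈ S, h x y) μ := by
  suffices hm : @Measurable (NullMeasurableSpace X μ) _ _ _ fun x => ⨅ y ∈ S, h x y from
    NullMeasurable.aemeasurable fun s hs => hm hs
  refine measurable_of_Iio fun a => ?_
  have heq : Prod.fst '' (Prod.snd ⁻¹' S ∩ Function.uncurry h ⁻¹' Iio a) =
      {x : X | (⨅ y ∈ S, h x y) < a} := by
    ext x
    simp [iInf_lt_iff]
  have := nullMeasurableSet_image_fst μ ((measurable_snd hS).inter (hh (measurableSet_Iio (a := a))))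
  rwa [heq] at this

end Analytic

/-! ### Sample averages and the law of large numbers along a filter -/

noncomputable section Sample

/-- The sample average of `f`. -/
def avg {𝒳 F : Type*} [AddCommGroup F] [Module ℝ F] {n : ℕ} (x : Fin n → 𝒳) (f : 𝒳 → F) : F :=
  (n : ℝ)⁻¹ • ∑ i, f (x i)

section Avg

variable {𝒳 F : Type*} [NormedAddCommGroup F] [NormedSpace ℝ F] {n : ℕ} (x : Fin n → 𝒳)

theorem avg_congr {f f' : 𝒳 → F} (h : ∀ i, f (x i) = f' (x i)) : avg x f = avg x f' := by
  simp [avg, h]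

theorem avg_add (f f' : 𝒳 → F) : avg x (fun a => f a + f' a) = avg x f + avg x f' := by
  simp [avg, Finset.sum_add_distrib]

theorem avg_sub (f f' : 𝒳 → F) : avg x (fun a => f a - f' a) = avg x f - avg x f' := by
  simp [avg, Finset.sum_sub_distrib, smul_sub]

theorem avg_neg (f : 𝒳 → F) : avg x (fun a => - f a) = - avg x f := by
  simp [avg]

theorem avg_smul (c : ℝ) (f : 𝒳 → F) : avg x (fun a => c • f a) = c • avg x f := by
  simp [avg, ← Finset.smul_sum, smul_comm c]

theorem avg_mul (c : ℝ) (f : 𝒳 → ℝ) : avg x (fun a => c * f a) = c * avg x f :=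
  avg_smul x c f

theorem avg_const (hn : 0 < n) (c : F) : avg x (fun _ => c) = c := by
  have : (n : ℝ) ≠ 0 := by positivity
  simp [avg, ← Nat.cast_smul_eq_nsmul ℝ, smul_smul, this]

theorem avg_clm {G : Type*} [NormedAddCommGroup G] [NormedSpace ℝ G] (L : F →L[ℝ] G) (f : 𝒳 → F) :
    avg x (fun a => L (f a)) = L (avg x f) := by
  simp [avg]

theorem avg_inner {H : Type*} [NormedAddCommGroup H] [InnerProductSpace ℝ H] (v : H)
    (f : 𝒳 → H) : avg x (fun a => inner ℝ v (f a)) = inner ℝ v (avg x f) :=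
  avg_clm x (innerSL ℝ v) f

theorem avg_mono {f f' : 𝒳 → ℝ} (h : ∀ i, f (x i) ≤ f' (x i)) : avg x f ≤ avg x f' := by
  unfold avg
  gcongr with i
  exact h i

theorem norm_avg_le (f : 𝒳 → F) : ‖avg x f‖ ≤ avg x (fun a => ‖f a‖) := by
  unfold avg
  rw [norm_smul, smul_eq_mul]
  simp only [norm_inv, Real.norm_natCast]
  gcongr
  exact norm_sum_le _ _

end Avg

variable {𝒳 : Type*} [MeasurableSpace 𝒳]

/-- Samples `x p`, of size `n p`, which along the filter `ℓ` behave like samples of independent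
observations with law `μ`. -/
structure SampleLLN (μ : Measure 𝒳) {I : Type*} (ℓ : Filter I) {n : I → ℕ}
    (x : ∀ p, Fin (n p) → 𝒳) : Prop where
  size_pos : ∀ᶠ p in ℓ, 0 < n p
  ae : ∀ Q : 𝒳 → Prop, (∀ᵐ a ∂μ, Q a) → ∀ᶠ p in ℓ, ∀ i, Q (x p i)
  lln : ∀ f : 𝒳 → ℝ, Integrable f μ → Tendsto (fun p => avg (x p) f) ℓ (𝓝 (∫ a, f a ∂μ))

/-- The filter of the events of probability tending to one. -/
def prFilter {Ω : Type*} [MeasurableSpace Ω] (P : Measure Ω) : Filter (ℕ × Ω) where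
  sets := {S | Tendsto (fun n => P {ω | (n, ω) ∉ S}) atTop (𝓝 0)}
  univ_sets := by simp
  sets_of_superset := by
    intro S T hS hST
    exact tendsto_of_tendsto_of_tendsto_of_le_of_le tendsto_const_nhds hS (fun _ => zero_le)
      fun n => measure_mono fun ω hω h => hω (hST h)
  inter_sets := by
    intro S T hS hT
    have h := Tendsto.add hS hT
    rw [add_zero] at h
    refine tendsto_of_tendsto_of_tendsto_of_le_of_le tendsto_const_nhds h (fun _ => zero_le)
      fun n => (measure_mono fun ω hω => ?_).trans (measure_union_le _ _)
    by_contra hcon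
    simp only [Set.mem_union, not_or, Set.mem_ofPred_eq, not_not] at hcon
    exact hω hcon

theorem eventually_prFilter {Ω : Type*} [MeasurableSpace Ω] {P : Measure Ω} {Q : ℕ × Ω → Prop} :
    (∀ᶠ p in prFilter P, Q p) ↔ Tendsto (fun n => P {ω | ¬ Q (n, ω)}) atTop (𝓝 0) :=
  Iff.rfl

theorem tendsto_prFilter_of_tendstoInMeasure {Ω F : Type*} [MeasurableSpace Ω] {P : Measure Ω}
    [PseudoMetricSpace F] {f : ℕ → Ω → F} {c : F}
    (h : TendstoInMeasure P f atTop fun _ => c) :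
    Tendsto (fun p : ℕ × Ω => f p.1 p.2) (prFilter P) (𝓝 c) := by
  rw [Metric.tendsto_nhds]
  intro ε hε
  rw [eventually_prFilter]
  simpa using tendstoInMeasure_iff_dist.1 h ε hε

/-- The law of large numbers, in the form of `SampleLLN`. -/
theorem sampleLLN_prFilter {Ω : Type*} [MeasurableSpace Ω] {P : Measure Ω} [IsProbabilityMeasure P]
    {μ : Measure 𝒳} {X : ℕ → Ω → 𝒳} (hlaw : ∀ i, HasLaw (X i) μ P) (hindep : iIndepFun X P) :
    SampleLLN μ (prFilter P) (fun p : ℕ × Ω => fun i : Fin p.1 => X i p.2) where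
  size_pos := by
    rw [eventually_prFilter]
    refine tendsto_const_nhds.congr' ?_
    filter_upwards [eventually_gt_atTop 0] with n hn
    simp [hn.ne']
  ae := by
    intro Q hQ
    rw [eventually_prFilter]
    refine tendsto_const_nhds.congr fun n => ?_
    have h : ∀ᵐ ω ∂P, ∀ i, Q (X i ω) := by
      refine ae_all_iff.2 fun i => ?_
      rw [← (hlaw i).map_eq] at hQ
      exact ae_of_ae_map (hlaw i).aemeasurable hQ
    symm
    refine measure_mono_null ?_ (ae_iff.1 h)
    exact fun ω hω hall => hω fun i => hall i
  lln := by
    intro f hf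
    have hfm : ∀ i, AEMeasurable f (P.map (X i)) := fun i => by
      rw [(hlaw i).map_eq]; exact hf.1.aemeasurable
    have hae := strong_law_ae_real (μ := P) (fun i => f ∘ X i)
      (by
        rw [← (hlaw 0).map_eq] at hf
        exact hf.comp_aemeasurable (hlaw 0).aemeasurable)
      (fun i j hij => (hindep.comp₀ (fun _ => f) (fun i => (hlaw i).aemeasurable) hfm).indepFun hij)
      (fun i => IdentDistrib.comp_of_aemeasurable
        ⟨(hlaw i).aemeasurable, (hlaw 0).aemeasurable, by rw [(hlaw i).map_eq, (hlaw 0).map_eq]⟩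
        (hfm i))
    have h0 : ∫ ω, (f ∘ X 0) ω ∂P = ∫ a, f a ∂μ := (hlaw 0).integral_comp hf.1
    rw [h0] at hae
    have h1 : TendstoInMeasure P (fun (n : ℕ) ω => (∑ i ∈ Finset.range n, (f ∘ X i) ω) / n) atTop
        (fun _ => ∫ a, f a ∂μ) := by
      refine tendstoInMeasure_of_tendsto_ae (fun n => ?_) hae
      refine (AEMeasurable.div_const (Finset.aemeasurable_fun_sum _ fun i _ => ?_)
        _).aestronglyMeasurable
      exact (hfm i).comp_aemeasurable (hlaw i).aemeasurable
    refine (tendsto_prFilter_of_tendstoInMeasure h1).congr fun p => ?_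
    rw [avg, Fin.sum_univ_eq_sum_range (fun i => f (X i p.2)), smul_eq_mul]
    simp [div_eq_inv_mul]

variable {μ : Measure 𝒳} {I : Type*} {ℓ : Filter I} {n : I → ℕ} {x : ∀ p, Fin (n p) → 𝒳}

theorem SampleLLN.lln_finiteDimensional {F : Type*} [NormedAddCommGroup F] [NormedSpace ℝ F]
    [FiniteDimensional ℝ F] (hs : SampleLLN μ ℓ x) {f : 𝒳 → F} (hf : Integrable f μ) :
    Tendsto (fun p => avg (x p) f) ℓ (𝓝 (∫ a, f a ∂μ)) := by
  have : CompleteSpace F := FiniteDimensional.complete ℝ F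
  let e := (Module.finBasis ℝ F).equivFunL
  have h : Tendsto (fun p => e (avg (x p) f)) ℓ (𝓝 (e (∫ a, f a ∂μ))) := by
    rw [tendsto_pi_nhds]
    intro i
    let L : F →L[ℝ] ℝ := (ContinuousLinearMap.proj (R := ℝ) (φ := fun _ => ℝ) i).comp
      e.toContinuousLinearMap
    have h1 := hs.lln _ (L.integrable_comp hf)
    rw [ContinuousLinearMap.integral_comp_comm _ hf] at h1
    refine h1.congr fun p => ?_
    rw [avg_clm]
    rfl
  have h' := (e.symm.continuous.tendsto _).comp h
  rw [e.symm_apply_apply] at h'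
  exact h'.congr fun p => e.symm_apply_apply _

/-- A lower bound for sample averages which is uniform in the parameter near `y₀`. -/
theorem SampleLLN.eventually_lt_avg [StandardBorelSpace 𝒳] [IsFiniteMeasure μ]
    (hs : SampleLLN μ ℓ x) {Y : Type*}
    [MetricSpace Y] [MeasurableSpace Y] [BorelSpace Y] [StandardBorelSpace Y] {h : 𝒳 → Y → ℝ}
    (hh : Measurable (Function.uncurry h)) {A : Set Y} (hA : MeasurableSet A) {D : 𝒳 → ℝ}
    (hD : Integrable D μ) (hlow : ∀ᵐ a ∂μ, ∀ y ∈ A, -D a ≤ h a y) {y₀ : Y} (hy₀ : y₀ ∈ A)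
    (hcont : ∀ᵐ a ∂μ, ContinuousWithinAt (h a) A y₀) (hint : Integrable (fun a => h a y₀) μ)
    {c : ℝ} (hc : c < ∫ a, h a y₀ ∂μ) :
    ∃ V ∈ 𝓝[A] y₀, ∀ᶠ p in ℓ, ∀ y ∈ V, c < avg (x p) (fun a => h a y) := by
  -- Joint measurability of the shifted function needs a measurable version of the lower bound.
  obtain ⟨D', hD'm, hDD'⟩ := hD.1.aemeasurable
  have hD' : Integrable D' μ := hD.congr hDD'
  let S : ℕ → Set Y := fun m => A ∩ Metric.ball y₀ (1 / ((m : ℝ) + 1))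
  have hSm : ∀ m, MeasurableSet (S m) := fun m => hA.inter measurableSet_ball
  have hy₀S : ∀ m, y₀ ∈ S m := fun m => ⟨hy₀, Metric.mem_ball_self (by positivity)⟩
  let k : 𝒳 → Y → ℝ≥0∞ := fun a y => ENNReal.ofReal (h a y + D' a)
  have hk : Measurable (Function.uncurry k) :=
    ENNReal.measurable_ofReal.comp (hh.add (hD'm.comp measurable_fst))
  let K : ℕ → 𝒳 → ℝ≥0∞ := fun m a => ⨅ y ∈ S m, k a y
  have hKm : ∀ m, AEMeasurable (K m) μ := fun m => aemeasurable_biInf_param μ hk (hSm m)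
  have hKle : ∀ m a, ∀ y ∈ S m, K m a ≤ k a y := fun m a y hy => iInf₂_le y hy
  have hKtop : ∀ m a, K m a ≠ ∞ := fun m a =>
    ne_top_of_le_ne_top ENNReal.ofReal_ne_top (hKle m a y₀ (hy₀S m))
  have hlow' : ∀ᵐ a ∂μ, ∀ y ∈ A, 0 ≤ h a y + D' a := by
    filter_upwards [hlow, hDD'] with a h1 h2 y hy
    have := h1 y hy
    rw [h2] at this
    linarith
  have hFle : ∀ m, ∀ᵐ a ∂μ, ∀ y ∈ S m, (K m a).toReal ≤ h a y + D' a := by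
    intro m
    filter_upwards [hlow'] with a ha y hy
    exact ENNReal.toReal_le_of_le_ofReal (ha y hy.1) (hKle m a y hy)
  have hint' : Integrable (fun a => h a y₀ + D' a) μ := hint.add hD'
  -- Continuity at `y₀` makes the infima over shrinking neighbourhoods tend to the value at `y₀`.
  -- That value also dominates them, because `y₀` lies in every neighbourhood.
  have hlim : Tendsto (fun m => ∫ a, (K m a).toReal ∂μ) atTop (𝓝 (∫ a, (h a y₀ + D' a) ∂μ)) := by
    refine tendsto_integral_of_dominated_convergence (fun a => h a y₀ + D' a)
      (fun m => (hKm m).ennreal_toReal.aestronglyMeasurable) hint' (fun m => ?_) ?_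
    · filter_upwards [hFle m] with a ha
      rw [Real.norm_of_nonneg ENNReal.toReal_nonneg]
      exact ha y₀ (hy₀S m)
    · filter_upwards [ae_all_iff.2 hFle, hcont] with a ha hca
      rw [Metric.tendsto_atTop]
      intro ε hε
      obtain ⟨δ, hδ, hball⟩ := Metric.continuousWithinAt_iff.1 hca (ε / 2) (by positivity)
      obtain ⟨m₀, hm₀⟩ := exists_nat_one_div_lt hδ
      refine ⟨m₀, fun m hm => ?_⟩
      have h1 : h a y₀ + D' a - ε / 2 ≤ (K m a).toReal := by
        rw [← ENNReal.ofReal_le_iff_le_toReal (hKtop m a)]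
        refine le_iInf₂ fun y hy => ENNReal.ofReal_le_ofReal ?_
        have hd : dist y y₀ < δ := by
          refine (Metric.mem_ball.1 hy.2).trans (lt_of_le_of_lt ?_ hm₀)
          gcongr
        have := abs_lt.1 (hball hy.1 hd)
        linarith [this.1]
      rw [Real.dist_eq, abs_lt]
      constructor <;> linarith [ha m y₀ (hy₀S m)]
  rw [integral_add hint hD'] at hlim
  obtain ⟨m, hm⟩ := (hlim.eventually (lt_mem_nhds
    (show c + ∫ a, D' a ∂μ < (∫ a, h a y₀ ∂μ) + ∫ a, D' a ∂μ by linarith))).exists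
  have hKint : Integrable (fun a => (K m a).toReal) μ :=
    hint'.mono' (hKm m).ennreal_toReal.aestronglyMeasurable (by
      filter_upwards [hFle m] with a ha
      rw [Real.norm_of_nonneg ENNReal.toReal_nonneg]
      exact ha y₀ (hy₀S m))
  refine ⟨S m, inter_mem self_mem_nhdsWithin (mem_nhdsWithin_of_mem_nhds
    (Metric.ball_mem_nhds _ (by positivity))), ?_⟩
  have h1 := hs.lln _ (hKint.sub hD')
  simp only [Pi.sub_apply] at h1
  rw [integral_sub hKint hD'] at h1
  filter_upwards [h1.eventually (lt_mem_nhds (show c < _ by linarith)), hs.ae _ (hFle m)]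
    with p hp hp' y hy
  refine hp.trans_le (avg_mono _ fun i => ?_)
  change (K m (x p i)).toReal - D' (x p i) ≤ h (x p i) y
  linarith [hp' i y hy]

end Sample

/-! ### Exponential tilting in a finite sample -/

section Finite

variable {𝒳 : Type*} {Ng Nt : ℕ} {g : 𝒳 → E Nt → E Ng}

theorem tilt_pos (a : 𝒳) (θ : E Nt) (l : E Ng) : 0 < tilt g a θ l := Real.exp_pos _

/-- The tangent inequality `1 + t ≤ exp t`. All the convexity in `λ` that is used below comes from
it. -/
theorem tilt_add_mul_inner_le (a : 𝒳) (θ : E Nt) (l l' : E Ng) :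
    tilt g a θ l + inner ℝ (l' - l) (tilt g a θ l • g a θ) ≤ tilt g a θ l' := by
  have h := Real.add_one_le_exp (inner ℝ l' (g a θ) - inner ℝ l (g a θ))
  have h' : tilt g a θ l' =
      tilt g a θ l * Real.exp (inner ℝ l' (g a θ) - inner ℝ l (g a θ)) := by
    rw [tilt, tilt, ← Real.exp_add]; ring_nf
  rw [h', inner_smul_right, inner_sub_left]
  nlinarith [tilt_pos (g := g) a θ l]

theorem tilt_add_mul_inner_lt (a : 𝒳) (θ : E Nt) (l l' : E Ng)
    (hne : inner ℝ l' (g a θ) ≠ inner ℝ l (g a θ)) :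
    tilt g a θ l + inner ℝ (l' - l) (tilt g a θ l • g a θ) < tilt g a θ l' := by
  have h := Real.add_one_lt_exp (sub_ne_zero.2 hne)
  have h' : tilt g a θ l' =
      tilt g a θ l * Real.exp (inner ℝ l' (g a θ) - inner ℝ l (g a θ)) := by
    rw [tilt, tilt, ← Real.exp_add]; ring_nf
  rw [h', inner_smul_right, inner_sub_left]
  nlinarith [tilt_pos (g := g) a θ l]

theorem hasDerivAt_tilt_line (a : 𝒳) (θ : E Nt) (l v : E Ng) (s : ℝ) :
    HasDerivAt (fun s : ℝ => tilt g a θ (l + s • v))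
      (tilt g a θ (l + s • v) * inner ℝ v (g a θ)) s := by
  have h : HasDerivAt (fun s : ℝ => inner ℝ (l + s • v) (g a θ)) (inner ℝ v (g a θ)) s := by
    simp only [inner_add_left, inner_smul_left]
    simpa using ((hasDerivAt_id s).mul_const (inner ℝ v (g a θ))).const_add (inner ℝ l (g a θ))
  exact h.exp

variable (g) in
/-- The sample version of `E[exp(λ' g)]`. -/
noncomputable def sampleM {n : ℕ} (x : Fin n → 𝒳) (θ : E Nt) (l : E Ng) : ℝ :=
  avg x fun a => tilt g a θ l

variable (g) in
/-- The first order condition `∑ exp(λ' gᵢ) gᵢ = 0` of exponential tilting. -/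
def IsCrit {n : ℕ} (x : Fin n → 𝒳) (θ : E Nt) (l : E Ng) : Prop :=
  avg x (fun a => tilt g a θ l • g a θ) = 0

variable (g) in
/-- The empirical likelihood discrepancy of the weights proportional to `exp(λ' gᵢ)`. -/
noncomputable def disc {n : ℕ} (x : Fin n → 𝒳) (θ : E Nt) (l : E Ng) : ℝ :=
  Real.log (sampleM g x θ l) - inner ℝ l (avg x fun a => g a θ)

variable {n : ℕ} {x : Fin n → 𝒳} {θ : E Nt} {l l' : E Ng}

theorem sampleM_pos (hn : 0 < n) : 0 < sampleM g x θ l := by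
  have : Nonempty (Fin n) := ⟨⟨0, hn⟩⟩
  unfold sampleM avg
  rw [smul_eq_mul]
  have : 0 < ∑ i, tilt g (x i) θ l := Finset.sum_pos (fun i _ => tilt_pos _ _ _) (by simp)
  positivity

theorem IsCrit.sampleM_le (h : IsCrit g x θ l) (l' : E Ng) :
    sampleM g x θ l ≤ sampleM g x θ l' := by
  have h1 := avg_mono x (f := fun a => tilt g a θ l + inner ℝ (l' - l) (tilt g a θ l • g a θ))
    (f' := fun a => tilt g a θ l') fun i => tilt_add_mul_inner_le _ _ _ _
  rw [avg_add, avg_inner, h, inner_zero_right, add_zero] at h1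
  exact h1

/-- Critical points need not be unique if the `gᵢ` do not span, but strict convexity of `exp` forces
the same tilting factors at every observation. The weights and `disc` are therefore well defined. -/
theorem IsCrit.inner_eq (h : IsCrit g x θ l) (h' : IsCrit g x θ l') (i : Fin n) :
    inner ℝ l' (g (x i) θ) = inner ℝ l (g (x i) θ) := by
  have hn : 0 < n := i.pos
  by_contra hne
  have hlt : ∑ i, (tilt g (x i) θ l + inner ℝ (l' - l) (tilt g (x i) θ l • g (x i) θ)) <
      ∑ i, tilt g (x i) θ l' :=
    Finset.sum_lt_sum (fun i _ => tilt_add_mul_inner_le _ _ _ _)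
      ⟨i, Finset.mem_univ i, tilt_add_mul_inner_lt _ _ _ _ hne⟩
  have hlt' : avg x (fun a => tilt g a θ l + inner ℝ (l' - l) (tilt g a θ l • g a θ)) <
      avg x (fun a => tilt g a θ l') := by
    unfold avg
    rw [smul_eq_mul, smul_eq_mul]
    have : (0 : ℝ) < n := by exact_mod_cast hn
    gcongr
  rw [avg_add, avg_inner, h, inner_zero_right, add_zero] at hlt'
  exact absurd (h'.sampleM_le l) (not_le.2 hlt')

theorem IsCrit.disc_eq (h : IsCrit g x θ l) (h' : IsCrit g x θ l') :
    disc g x θ l' = disc g x θ l := by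
  unfold disc sampleM
  rw [← avg_inner, ← avg_inner]
  congr 1
  · congr 1
    exact avg_congr x fun i => by rw [tilt, tilt, h.inner_eq h' i]
  · exact avg_congr x fun i => h.inner_eq h' i

theorem sampleM_convex (s : ℝ) (hs : 0 ≤ s) (hs1 : s ≤ 1) (l l' : E Ng) :
    sampleM g x θ (l + s • (l' - l)) ≤ (1 - s) * sampleM g x θ l + s * sampleM g x θ l' := by
  unfold sampleM
  rw [← avg_mul, ← avg_mul, ← avg_add]
  refine avg_mono x fun i => ?_
  have h1 := tilt_add_mul_inner_le (g := g) (x i) θ (l + s • (l' - l)) l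
  have h2 := tilt_add_mul_inner_le (g := g) (x i) θ (l + s • (l' - l)) l'
  set T := tilt g (x i) θ (l + s • (l' - l)) • g (x i) θ
  have e1 : l - (l + s • (l' - l)) = (-s) • (l' - l) := by module
  have e2 : l' - (l + s • (l' - l)) = (1 - s) • (l' - l) := by module
  rw [e1, inner_smul_left] at h1
  rw [e2, inner_smul_left] at h2
  simp only [conj_trivial] at h1 h2
  nlinarith

/-- A critical point far from `l₀` forces a low value of the criterion on a sphere around `l₀`. -/
theorem IsCrit.exists_sphere (h : IsCrit g x θ l) {l₀ : E Ng} {ε : ℝ} (hε : 0 < ε)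
    (hl : ε ≤ ‖l - l₀‖) : ∃ l', ‖l' - l₀‖ = ε ∧ sampleM g x θ l' ≤ sampleM g x θ l₀ := by
  have hpos : 0 < ‖l - l₀‖ := hε.trans_le hl
  refine ⟨l₀ + (ε / ‖l - l₀‖) • (l - l₀), ?_, ?_⟩
  · rw [add_sub_cancel_left, norm_smul, Real.norm_of_nonneg (by positivity)]
    field_simp
  · have h1 := sampleM_convex (g := g) (x := x) (θ := θ) (ε / ‖l - l₀‖) (by positivity)
      ((div_le_one hpos).2 hl) l₀ l
    have h2 := h.sampleM_le l₀
    have : 0 ≤ ε / ‖l - l₀‖ := by positivity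
    nlinarith

/-- The derivative along every line through `l` vanishes. -/
theorem isCrit_of_isLocalMin (h : IsLocalMin (sampleM g x θ) l) : IsCrit g x θ l := by
  unfold IsCrit
  refine ext_inner_left ℝ fun v => ?_
  rw [inner_zero_right, ← avg_inner]
  have hd : HasDerivAt (fun s : ℝ => sampleM g x θ (l + s • v))
      (avg x fun a => tilt g a θ (l + (0 : ℝ) • v) * inner ℝ v (g a θ)) 0 := by
    unfold sampleM avg
    simp only [smul_eq_mul]
    exact (HasDerivAt.fun_sum fun i _ => hasDerivAt_tilt_line (x i) θ l v 0).const_mul _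
  have hmin : IsLocalMin (fun s : ℝ => sampleM g x θ (l + s • v)) 0 := by
    have hc : Tendsto (fun s : ℝ => l + s • v) (𝓝 0) (𝓝 l) := by
      have : Continuous fun s : ℝ => l + s • v := by fun_prop
      simpa using this.tendsto 0
    have := hc.eventually h
    simpa [IsLocalMin, IsMinFilter] using this
  have h0 := hmin.hasDerivAt_eq_zero hd
  rw [← h0]
  exact avg_congr x fun i => by simp [inner_smul_right]

theorem continuous_sampleM : Continuous (sampleM g x θ) := by
  unfold sampleM avg tilt
  fun_prop

/-- A high value of the criterion on a sphere gives a critical point inside. -/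
theorem exists_isCrit {l₀ : E Ng} {ε : ℝ} (hε : 0 < ε)
    (h : ∀ l, ‖l - l₀‖ = ε → sampleM g x θ l₀ < sampleM g x θ l) :
    ∃ l, ‖l - l₀‖ < ε ∧ IsCrit g x θ l := by
  obtain ⟨l, hl, hmin⟩ := (isCompact_closedBall l₀ ε).exists_isMinOn
    ⟨l₀, Metric.mem_closedBall_self hε.le⟩ (continuous_sampleM (g := g) (x := x)
      (θ := θ)).continuousOn
  have hl' : ‖l - l₀‖ ≤ ε := by simpa [dist_eq_norm] using hl
  have hlt : ‖l - l₀‖ < ε := by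
    refine lt_of_le_of_ne hl' fun heq => ?_
    exact absurd (hmin (Metric.mem_closedBall_self hε.le)) (not_le.2 (h l heq))
  refine ⟨l, hlt, isCrit_of_isLocalMin (hmin.isLocalMin ?_)⟩
  exact Metric.closedBall_mem_nhds_of_mem (by simpa [dist_eq_norm] using hlt)

/-- Weights proportional to `exp(λ' gᵢ)`. -/
noncomputable def tiltWeights (g : 𝒳 → E Nt → E Ng) {n : ℕ} (x : Fin n → 𝒳) (θ : E Nt) (l : E Ng)
    (i : Fin n) : ℝ :=
  (n : ℝ)⁻¹ * (tilt g (x i) θ l / sampleM g x θ l)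

theorem tiltWeights_pos (i : Fin n) : 0 < tiltWeights g x θ l i := by
  have hn : (0 : ℝ) < n := by exact_mod_cast i.pos
  have := tilt_pos (g := g) (x i) θ l
  have := sampleM_pos (g := g) (x := x) (θ := θ) (l := l) i.pos
  unfold tiltWeights
  positivity

theorem log_tiltWeights (i : Fin n) : Real.log (n * tiltWeights g x θ l i) =
    inner ℝ l (g (x i) θ) - Real.log (sampleM g x θ l) := by
  have hn : (n : ℝ) ≠ 0 := by exact_mod_cast i.pos.ne'
  rw [tiltWeights, ← mul_assoc, mul_inv_cancel₀ hn, one_mul,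
    Real.log_div (tilt_pos _ _ _).ne' (sampleM_pos i.pos).ne', tilt, Real.log_exp]

theorem elDiscrepancy_tiltWeights (hn : 0 < n) :
    elDiscrepancy (tiltWeights g x θ l) = disc g x θ l := by
  have h : avg x (fun a => Real.log (sampleM g x θ l) - inner ℝ l (g a θ)) = disc g x θ l := by
    rw [avg_sub, avg_const x hn, avg_inner, disc]
  rw [← h, elDiscrepancy, avg, smul_eq_mul]
  simp [log_tiltWeights]

theorem sum_tiltWeights (hn : 0 < n) : ∑ i, tiltWeights g x θ l i = 1 := by
  simp only [tiltWeights]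
  rw [← Finset.mul_sum, ← Finset.sum_div]
  have h := sampleM_pos (g := g) (x := x) (θ := θ) (l := l) hn
  have h' : sampleM g x θ l = (n : ℝ)⁻¹ * ∑ i, tilt g (x i) θ l := rfl
  rw [← mul_div_assoc, ← h', div_self h.ne']

/-- This is Gibbs' inequality: the logarithms of the tilted weights are affine in `gᵢ`, so every
feasible `v` gives them the same mean, and what remains is a nonnegative relative entropy. -/
theorem IsCrit.isETWeights (hn : 0 < n) (h : IsCrit g x θ l) :
    IsETWeights g x θ (tiltWeights g x θ l) := by
  have hn' : (n : ℝ) ≠ 0 := by exact_mod_cast hn.ne'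
  have hwg : ∑ i, tiltWeights g x θ l i • g (x i) θ = 0 := by
    have : ∑ i, tiltWeights g x θ l i • g (x i) θ = (sampleM g x θ l)⁻¹ •
        avg x (fun a => tilt g a θ l • g a θ) := by
      rw [avg, smul_smul, Finset.smul_sum]
      refine Finset.sum_congr rfl fun i _ => ?_
      rw [smul_smul, tiltWeights]
      congr 1
      ring
    rw [this, h, smul_zero]
  refine ⟨⟨fun i => (tiltWeights_pos i).le, hwg, sum_tiltWeights hn⟩, ?_⟩
  rintro v ⟨hv0, hvg, hv1⟩
  have key : ∀ w : Fin n → ℝ, ∑ i, w i • g (x i) θ = 0 → ∑ i, w i = 1 →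
      ∑ i, w i * Real.log (n * tiltWeights g x θ l i) = -Real.log (sampleM g x θ l) := by
    intro w hw hw1
    simp only [log_tiltWeights, mul_sub]
    rw [Finset.sum_sub_distrib, ← Finset.sum_mul, hw1, one_mul]
    have : ∑ i, w i * inner ℝ l (g (x i) θ) = inner ℝ l (∑ i, w i • g (x i) θ) := by
      rw [inner_sum]
      exact Finset.sum_congr rfl fun i _ => by rw [inner_smul_right]
    rw [this, hw, inner_zero_right, zero_sub]
  have hobj : ∀ w : Fin n → ℝ, (n : ℝ)⁻¹ * ∑ i, (n * w i) * Real.log (n * w i) =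
      ∑ i, w i * Real.log (n * w i) := by
    intro w
    rw [Finset.mul_sum]
    refine Finset.sum_congr rfl fun i _ => ?_
    field_simp
  rw [Set.mem_ofPred_eq]
  beta_reduce
  rw [hobj, hobj, key _ hwg (sum_tiltWeights hn), ← key v hvg hv1]
  -- The bound `log t ≤ t - 1` at `t = wᵢ / vᵢ`; the added differences sum to zero.
  have hterm : ∀ i, v i * Real.log (n * tiltWeights g x θ l i) + (v i - tiltWeights g x θ l i) ≤
      v i * Real.log (n * v i) := by
    intro i
    have hw := tiltWeights_pos (g := g) (x := x) (θ := θ) (l := l) i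
    rcases (hv0 i).eq_or_lt with h0 | h0
    · rw [← h0]; simp [hw.le]
    · have h1 := Real.log_le_sub_one_of_pos (div_pos hw h0)
      rw [Real.log_div hw.ne' h0.ne'] at h1
      rw [Real.log_mul hn' hw.ne', Real.log_mul hn' h0.ne']
      have h2 : v i * (tiltWeights g x θ l i / v i) = tiltWeights g x θ l i := by field_simp
      nlinarith
  have hsum := Finset.sum_le_sum fun i (_ : i ∈ Finset.univ) => hterm i
  rw [Finset.sum_add_distrib, Finset.sum_sub_distrib, hv1, sum_tiltWeights hn] at hsum
  linarith

/-- Positive exponential tilting weights are proportional to `exp(λ' gᵢ)`. -/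
theorem IsETWeights.exists_isCrit (hn : 0 < n) {w : Fin n → ℝ} (hw : IsETWeights g x θ w)
    (hpos : ∀ i, 0 < w i) : ∃ l, IsCrit g x θ l ∧ w = tiltWeights g x θ l := by
  obtain ⟨⟨-, hwg, hw1⟩, hmin⟩ := hw
  have hn' : (0 : ℝ) < n := by exact_mod_cast hn
  let T : (Fin n → ℝ) →ₗ[ℝ] ℝ × E Ng :=
    (∑ i, LinearMap.proj i).prod (∑ i, (LinearMap.proj i).smulRight (g (x i) θ))
  have hT : ∀ d, T d = (∑ i, d i, ∑ i, d i • g (x i) θ) := fun d => by simp [T]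
  let u : Module.Dual ℝ (Fin n → ℝ) := ∑ i, Real.log (n * w i) • LinearMap.proj i
  have hu : ∀ d, u d = ∑ i, d i * Real.log (n * w i) := fun d => by simp [u, mul_comm]
  -- Up to a multiple of `∑ dᵢ`, which vanishes on the kernel, `u` is the gradient of the entropy at
  -- `w`. Positive weights can be perturbed both ways along the kernel of the constraints, so `u`
  -- annihilates it and factors through `T`; the factor supplies the multiplier `l`.
  have hker : u ∈ T.ker.dualAnnihilator := by
    rw [Submodule.mem_dualAnnihilator]
    intro d hd
    rw [LinearMap.mem_ker, hT, Prod.mk_eq_zero] at hd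
    rw [hu]
    have hd1 : HasDerivAt (fun t : ℝ => (n : ℝ)⁻¹ * ∑ i, (n * (w i + t * d i)) *
        Real.log (n * (w i + t * d i)))
        ((n : ℝ)⁻¹ * ∑ i, (Real.log (n * (w i + 0 * d i)) + 1) * (n * d i)) 0 := by
      refine (HasDerivAt.fun_sum fun i _ => ?_).const_mul _
      have h1 : HasDerivAt (fun t : ℝ => n * (w i + t * d i)) (n * d i) 0 := by
        simpa using (((hasDerivAt_id (0 : ℝ)).mul_const (d i)).const_add (w i)).const_mul (n : ℝ)
      have h2 := Real.hasDerivAt_mul_log (x := n * (w i + 0 * d i))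
        (by rw [zero_mul, add_zero]; exact (mul_pos hn' (hpos i)).ne')
      exact HasDerivAt.comp (0 : ℝ) h2 h1
    have hlm : IsLocalMin (fun t : ℝ => (n : ℝ)⁻¹ * ∑ i, (n * (w i + t * d i)) *
        Real.log (n * (w i + t * d i))) 0 := by
      have hev : ∀ᶠ t : ℝ in 𝓝 0, ∀ i, 0 < w i + t * d i := by
        rw [eventually_all]
        intro i
        have : Continuous fun t : ℝ => w i + t * d i := by fun_prop
        exact (this.tendsto 0).eventually (lt_mem_nhds (by simpa using hpos i))
      filter_upwards [hev] with t ht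
      have hfeas : (fun i => w i + t * d i) ∈ {v : Fin n → ℝ | (∀ i, 0 ≤ v i) ∧
          ∑ i, v i • g (x i) θ = 0 ∧ ∑ i, v i = 1} := by
        refine ⟨fun i => (ht i).le, ?_, ?_⟩
        · simp only [add_smul, mul_smul]
          rw [Finset.sum_add_distrib, ← Finset.smul_sum, hd.2, hwg]
          simp
        · rw [Finset.sum_add_distrib, ← Finset.mul_sum, hd.1, hw1]
          simp
      simpa using hmin hfeas
    have h0 := hlm.hasDerivAt_eq_zero hd1
    have h1 : (n : ℝ)⁻¹ * ∑ i, (Real.log (n * (w i + 0 * d i)) + 1) * (n * d i) =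
        (∑ i, d i * Real.log (n * w i)) + ∑ i, d i := by
      rw [Finset.mul_sum, ← Finset.sum_add_distrib]
      refine Finset.sum_congr rfl fun i _ => ?_
      rw [zero_mul, add_zero]
      field_simp
    rw [h1, hd.1, add_zero] at h0
    exact h0
  rw [← LinearMap.range_dualMap_eq_dualAnnihilator_ker] at hker
  obtain ⟨ψ, hψ⟩ := hker
  let ψ₂ : E Ng →L[ℝ] ℝ := LinearMap.toContinuousLinearMap (ψ ∘ₗ LinearMap.inr ℝ ℝ (E Ng))
  let l : E Ng := (InnerProductSpace.toDual ℝ (E Ng)).symm ψ₂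
  have hl : ∀ v, ψ (0, v) = inner ℝ l v := fun v => by
    simp only [l, InnerProductSpace.toDual_symm_apply]; rfl
  have hlog : ∀ i, Real.log (n * w i) = ψ (1, 0) + inner ℝ l (g (x i) θ) := by
    intro i
    have h1 : u (Pi.single i 1) = ψ (T (Pi.single i 1)) := by rw [← hψ]; rfl
    rw [hu, hT] at h1
    have h2 : (1, g (x i) θ) = ((1, 0) + (0, g (x i) θ) : ℝ × E Ng) := by simp
    simp only [Pi.single_apply, ite_mul, one_mul, zero_mul, Finset.sum_ite_eq', Finset.mem_univ,
      if_true, ite_smul, one_smul, zero_smul] at h1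
    rw [h1, h2, map_add, hl]
  have hw : ∀ i, n * w i = Real.exp (ψ (1, 0)) * tilt g (x i) θ l := by
    intro i
    rw [tilt, ← Real.exp_add, ← hlog, Real.exp_log (mul_pos hn' (hpos i))]
  set e := Real.exp (ψ (1, 0))
  have he : 0 < e := Real.exp_pos _
  have hM : e * sampleM g x θ l = 1 := by
    have : ∑ i, n * w i = ∑ i, e * tilt g (x i) θ l := Finset.sum_congr rfl fun i _ => hw i
    rw [← Finset.mul_sum, ← Finset.mul_sum, hw1, mul_one] at this
    rw [sampleM, avg, smul_eq_mul, mul_left_comm, ← this, inv_mul_cancel₀ hn'.ne']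
  refine ⟨l, ?_, ?_⟩
  · have : e • avg x (fun a => tilt g a θ l • g a θ) = ∑ i, w i • g (x i) θ := by
      rw [avg, smul_comm, Finset.smul_sum, Finset.smul_sum]
      refine Finset.sum_congr rfl fun i _ => ?_
      rw [smul_smul, smul_smul, mul_assoc, ← hw, inv_mul_cancel_left₀ hn'.ne']
    rw [hwg] at this
    exact (smul_eq_zero.1 this).resolve_left he.ne'
  · ext i
    have h1 : e = (sampleM g x θ l)⁻¹ := eq_inv_of_mul_eq_one_left hM
    rw [tiltWeights, div_eq_inv_mul, ← h1, ← hw, inv_mul_cancel_left₀ hn'.ne']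

theorem IsETEL.exists_isCrit (hn : 0 < n) {Θ : Set (E Nt)} (h : IsETEL g Θ x θ) :
    ∃ l, IsCrit g x θ l := by
  obtain ⟨-, w, hw, hpos, -⟩ := h
  obtain ⟨l, hl, -⟩ := hw.exists_isCrit hn hpos
  exact ⟨l, hl⟩

/-- This replaces the weights by critical points: `θ` together with any of its critical points
minimizes `disc` over all pairs satisfying the tilting equation. -/
theorem IsETEL.disc_le (hn : 0 < n) {Θ : Set (E Nt)} (h : IsETEL g Θ x θ) (hl : IsCrit g x θ l)
    {θ' : E Nt} (hθ' : θ' ∈ Θ) (hl' : IsCrit g x θ' l') : disc g x θ l ≤ disc g x θ' l' := by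
  obtain ⟨-, w, hw, hpos, hmin⟩ := h
  obtain ⟨l₁, hl₁, rfl⟩ := hw.exists_isCrit hn hpos
  have := hmin θ' hθ' _ (hl'.isETWeights hn) fun i => tiltWeights_pos i
  rwa [elDiscrepancy_tiltWeights hn, elDiscrepancy_tiltWeights hn, ← hl₁.disc_eq hl] at this

theorem IsAugmentedETEL.isCrit {Θ : Set (E Nt)} {β : B Ng Nt} (h : IsAugmentedETEL g Θ x β) :
    IsCrit g x (thOf β) (lamOf β) := by
  refine isCrit_of_isLocalMin (IsMinOn.isLocalMin (s := Set.univ) (fun l _ => ?_) univ_mem)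
  have := h.lam (Set.mem_univ l)
  simp only [Set.mem_ofPred_eq, Finset.sum_neg_distrib, mul_neg, neg_le_neg_iff] at this
  exact this

end Finite

/-! ### Consistency -/

section Consistency

variable {𝒳 : Type*} [MeasurableSpace 𝒳] {Ng Nt : ℕ} {g : 𝒳 → E Nt → E Ng} {μ : Measure 𝒳}
  {Θ : Set (E Nt)} {lamS : E Nt → E Ng} {θs : E Nt} {Λ : E Nt → Set (E Ng)} {N : Set (E Nt)}
  {b : 𝒳 → ℝ}

omit [MeasurableSpace 𝒳] in
theorem tilt_le_of_norm_sub_le {a : 𝒳} {θ : E Nt} {l l₀ : E Ng} {r : ℝ} (h : ‖l - l₀‖ ≤ r) :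
    tilt g a θ l ≤ Real.exp (inner ℝ l₀ (g a θ) + r * ‖g a θ‖) := by
  rw [tilt, Real.exp_le_exp]
  have h1 : inner ℝ l (g a θ) = inner ℝ l₀ (g a θ) + inner ℝ (l - l₀) (g a θ) := by
    rw [inner_sub_left]; ring
  have h2 := real_inner_le_norm (l - l₀) (g a θ)
  have h3 : ‖l - l₀‖ * ‖g a θ‖ ≤ r * ‖g a θ‖ := by gcongr
  linarith

omit [MeasurableSpace 𝒳] in
-- The tilting factor is largest on a ball about `l₀` in the direction of `g`. A moment condition
-- uniform over the ball thus controls `exp(r‖g‖)` as well, and with it powers of `‖g‖`.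
theorem exists_tilt_eq (a : 𝒳) (θ : E Nt) (l₀ : E Ng) {r : ℝ} (hr : 0 ≤ r) :
    ∃ l ∈ Metric.closedBall l₀ r,
      tilt g a θ l = Real.exp (inner ℝ l₀ (g a θ) + r * ‖g a θ‖) := by
  refine ⟨l₀ + (r / ‖g a θ‖) • g a θ, ?_, ?_⟩
  · rw [mem_closedBall_iff_norm, add_sub_cancel_left, norm_smul, Real.norm_of_nonneg (by positivity)]
    rcases eq_or_ne ‖g a θ‖ 0 with h | h
    · simpa [h] using hr
    · rw [div_mul_cancel₀ _ h]
  · rw [tilt, inner_add_left, inner_smul_left, real_inner_self_eq_norm_sq]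
    congr 2
    rcases eq_or_ne ‖g a θ‖ 0 with h | h
    · simp [h]
    · simp only [conj_trivial]
      field_simp

namespace Regularity

variable (hreg : Regularity μ g Θ lamS θs Λ N b)
include hreg

theorem measurable_g_left (θ : E Nt) : Measurable fun a => g a θ :=
  hreg.measurable_g.comp (measurable_id.prodMk measurable_const)

theorem measurable_tilt :
    Measurable fun p : 𝒳 × E Nt × E Ng => tilt g p.1 p.2.1 p.2.2 := by
  have : Measurable fun p : 𝒳 × E Nt × E Ng => g p.1 p.2.1 :=
    hreg.measurable_g.comp (measurable_fst.prodMk (measurable_fst.comp measurable_snd))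
  exact Real.measurable_exp.comp ((measurable_snd.comp measurable_snd).inner this)

theorem measurable_tilt_left (θ : E Nt) (l : E Ng) : Measurable fun a => tilt g a θ l :=
  hreg.measurable_tilt.comp (measurable_id.prodMk (measurable_const (a := (θ, l))))

/-- The pseudo-true tilting parameter depends continuously on `θ`. -/
theorem continuousOn_lamS : ContinuousOn lamS Θ := by
  obtain ⟨r, hr, hball⟩ := hreg.interior_lam
  intro θ hθ
  refine tendsto_of_subseq_tendsto fun ns hns => ?_
  obtain ⟨k₀, hk₀⟩ := eventually_atTop.1 (hns.eventually self_mem_nhdsWithin)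
  have hbd : ∀ k, lamS (ns (k + k₀)) ∈ ⋃ θ ∈ Θ, Λ θ := fun k =>
    Set.mem_biUnion (hk₀ _ (Nat.le_add_left _ _))
      (hball _ (hk₀ _ (Nat.le_add_left _ _)) (Metric.mem_closedBall_self hr.le))
  obtain ⟨l₀, -, φ, hφ, hlim⟩ := tendsto_subseq_of_bounded hreg.bounded_lam hbd
  refine ⟨fun k => φ k + k₀, ?_⟩
  let u : ℕ → E Nt := fun k => ns (φ k + k₀)
  have hu : ∀ k, u k ∈ Θ := fun k => hk₀ _ (Nat.le_add_left _ _)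
  have hlimu : Tendsto u atTop (𝓝[Θ] θ) :=
    hns.comp (tendsto_atTop_mono (fun k => Nat.le_add_right _ _) hφ.tendsto_atTop)
  have hlim' : Tendsto (fun k => lamS (u k)) atTop (𝓝 l₀) := hlim
  -- By uniqueness a subsequential limit is identified once it solves the population equation, and
  -- the equation passes to the limit by dominated convergence.
  suffices h : IsTiltSolution μ g θ l₀ by
    rw [← hreg.lamS_unique θ hθ l₀ h]
    exact hlim'
  let q : ℕ → 𝒳 → ℝ := fun k a => Real.exp (inner ℝ (lamS (u k)) (g a (u k)) + r * ‖g a (u k)‖)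
  have hqm : ∀ k, Measurable (q k) := fun k => Real.measurable_exp.comp
    ((measurable_const.inner (hreg.measurable_g_left _)).add
      ((hreg.measurable_g_left _).norm.const_mul r))
  let d : 𝒳 → ℝ≥0∞ := fun a => ⨆ k, ENNReal.ofReal (q k a)
  have hdm : Measurable d := Measurable.iSup fun k => ENNReal.measurable_ofReal.comp (hqm k)
  have hdint : ∫⁻ a, d a ∂μ ≠ ∞ := by
    refine ((lintegral_mono fun a => ?_).trans_lt hreg.exp_moment).ne
    refine iSup_le fun k => ?_
    obtain ⟨l, hl, heq⟩ := exists_tilt_eq (g := g) a (u k) (lamS (u k)) hr.le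
    calc ENNReal.ofReal (q k a) = ENNReal.ofReal (tilt g a (u k) l) := by rw [heq]
      _ ≤ ⨆ θ ∈ Θ, ⨆ l ∈ Λ θ, ENNReal.ofReal (tilt g a θ l) :=
        le_iSup₂_of_le (u k) (hu k) (le_iSup₂_of_le l (hball _ (hu k) hl) le_rfl)
  have hbound : ∀ k, ∀ᵐ a ∂μ, ‖tilt g a (u k) (lamS (u k)) • g a (u k)‖ ≤ (d a).toReal / r := by
    intro k
    filter_upwards [ae_lt_top hdm hdint] with a ha
    have h1 : q k a ≤ (d a).toReal := by
      rw [← ENNReal.ofReal_le_iff_le_toReal ha.ne]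
      exact le_iSup (fun k => ENNReal.ofReal (q k a)) k
    rw [norm_smul, Real.norm_of_nonneg (tilt_pos _ _ _).le, le_div_iff₀ hr]
    refine le_trans ?_ h1
    -- The radius `r` pays for the factor `‖g‖`, since `r‖g‖ ≤ exp(r‖g‖)`.
    simp only [q, Real.exp_add, mul_assoc]
    refine mul_le_mul_of_nonneg_left ?_ (Real.exp_pos _).le
    linarith [Real.add_one_le_exp (r * ‖g a (u k)‖)]
  have hdint' : Integrable (fun a => (d a).toReal / r) μ :=
    (integrable_toReal_of_lintegral_ne_top hdm.aemeasurable hdint).div_const r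
  have hpt : ∀ᵐ a ∂μ, Tendsto (fun k => tilt g a (u k) (lamS (u k)) • g a (u k)) atTop
      (𝓝 (tilt g a θ l₀ • g a θ)) := by
    filter_upwards [hreg.continuous_g θ hθ] with a ha
    have hga : Tendsto (fun k => g a (u k)) atTop (𝓝 (g a θ)) := Tendsto.comp ha hlimu
    exact ((Real.continuous_exp.tendsto _).comp (hlim'.inner hga)).smul hga
  have hm : ∀ k, AEStronglyMeasurable (fun a => tilt g a (u k) (lamS (u k)) • g a (u k)) μ :=
    fun k => ((hreg.measurable_tilt_left _ _).smul (hreg.measurable_g_left _)).aestronglyMeasurable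
  constructor
  · refine hdint'.mono' ((hreg.measurable_tilt_left _ _).smul
      (hreg.measurable_g_left _)).aestronglyMeasurable ?_
    filter_upwards [ae_all_iff.2 hbound, hpt] with a h1 h2
    exact le_of_tendsto h2.norm (Eventually.of_forall h1)
  · have h := tendsto_integral_of_dominated_convergence _ hm hdint' hbound hpt
    simp only [(hreg.lamS_solution _ (hu _)).2] at h
    exact (tendsto_nhds_unique h tendsto_const_nhds)

/-- Continuity of `lamS` makes the tube a continuous image of a product. Compactness provides its
measurability, which the suprema and infima over it require. -/
theorem isCompact_tube (r : ℝ) :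
    IsCompact {y : E Nt × E Ng | y.1 ∈ Θ ∧ ‖y.2 - lamS y.1‖ ≤ r} := by
  have h1 : IsCompact ((fun y : E Nt × E Ng => (y.1, lamS y.1 + y.2)) ''
      (Θ ×ˢ Metric.closedBall 0 r)) := by
    refine (hreg.compact.prod (isCompact_closedBall 0 r)).image_of_continuousOn ?_
    refine continuousOn_fst.prodMk (ContinuousOn.add ?_ continuousOn_snd)
    exact hreg.continuousOn_lamS.comp continuousOn_fst fun y hy => hy.1
  convert h1
  ext ⟨θ, l⟩
  simp only [Set.mem_ofPred_eq, Set.mem_image, Set.mem_prod, mem_closedBall_zero_iff, Prod.mk.injEq,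
    Prod.exists]
  constructor
  · rintro ⟨h, hu⟩
    exact ⟨θ, l - lamS θ, ⟨h, hu⟩, rfl, by abel⟩
  · rintro ⟨θ', u, ⟨h, hu⟩, rfl, rfl⟩
    exact ⟨h, by simpa using hu⟩

/-- An integrable envelope of the tilting factors. -/
theorem exists_envelope [StandardBorelSpace 𝒳] [IsFiniteMeasure μ] :
    ∃ r > 0, (∀ θ ∈ Θ, Metric.closedBall (lamS θ) r ⊆ Λ θ) ∧ ∃ D : 𝒳 → ℝ, Integrable D μ ∧
      ∀ᵐ a ∂μ, ∀ θ ∈ Θ, ∀ l, ‖l - lamS θ‖ ≤ r → tilt g a θ l ≤ D a := by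
  obtain ⟨r, hr, hball⟩ := hreg.interior_lam
  refine ⟨r, hr, hball, ?_⟩
  let A : Set (E Nt × E Ng) := {y | y.1 ∈ Θ ∧ ‖y.2 - lamS y.1‖ ≤ r}
  let d : 𝒳 → ℝ≥0∞ := fun a => ⨆ y ∈ A, ENNReal.ofReal (tilt g a y.1 y.2)
  have hdm : AEMeasurable d μ := aemeasurable_biSup_param μ
    (h := fun a (y : E Nt × E Ng) => ENNReal.ofReal (tilt g a y.1 y.2))
    (ENNReal.measurable_ofReal.comp hreg.measurable_tilt) (hreg.isCompact_tube r).measurableSet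
  have hdint : ∫⁻ a, d a ∂μ ≠ ∞ := by
    refine ((lintegral_mono fun a => ?_).trans_lt hreg.exp_moment).ne
    refine iSup₂_le fun y hy => le_iSup₂_of_le y.1 hy.1 (le_iSup₂_of_le y.2 ?_ le_rfl)
    exact hball _ hy.1 (mem_closedBall_iff_norm.2 hy.2)
  refine ⟨fun a => (d a).toReal, integrable_toReal_of_lintegral_ne_top hdm hdint, ?_⟩
  filter_upwards [ae_lt_top' hdm hdint] with a ha θ hθ l hl
  rw [← ENNReal.ofReal_le_iff_le_toReal ha.ne]
  exact le_iSup₂ (f := fun y (_ : y ∈ A) => ENNReal.ofReal (tilt g a y.1 y.2)) (θ, l) ⟨hθ, hl⟩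

/-- The excess over the tangent at `λ*(θ)` is nonnegative with integral at most zero, so it vanishes
almost surely. Then both parameters have the same tilting factors and `l` solves the same equation.
-/
theorem ae_eq_of_integral_tilt_le {θ : E Nt} (hθ : θ ∈ Θ) {l : E Ng}
    (hl : Integrable (fun a => tilt g a θ l) μ)
    (hl₀ : Integrable (fun a => tilt g a θ (lamS θ)) μ)
    (hle : ∫ a, tilt g a θ l ∂μ ≤ ∫ a, tilt g a θ (lamS θ) ∂μ) : l = lamS θ := by
  obtain ⟨hint, hzero⟩ := hreg.lamS_solution θ hθ
  have hi := hint.const_inner (𝕜 := ℝ) (l - lamS θ)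
  let f : 𝒳 → ℝ := fun a => tilt g a θ l -
    (tilt g a θ (lamS θ) + inner ℝ (l - lamS θ) (tilt g a θ (lamS θ) • g a θ))
  have hf0 : ∀ a, 0 ≤ f a := fun a => sub_nonneg.2 (tilt_add_mul_inner_le _ _ _ _)
  have hfi : Integrable f μ := hl.sub (hl₀.add hi)
  have hfint : ∫ a, f a ∂μ = ∫ a, tilt g a θ l ∂μ - ∫ a, tilt g a θ (lamS θ) ∂μ := by
    have h1 : ∫ a, inner ℝ (l - lamS θ) (tilt g a θ (lamS θ) • g a θ) ∂μ = 0 := by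
      rw [integral_inner hint, hzero, inner_zero_right]
    have h2 : ∫ a, f a ∂μ = _ := integral_sub hl (hl₀.add hi)
    have h3 : ∫ a, (tilt g a θ (lamS θ) +
        inner ℝ (l - lamS θ) (tilt g a θ (lamS θ) • g a θ)) ∂μ = _ := integral_add hl₀ hi
    rw [h2, h3, h1, add_zero]
  have hf : f =ᵐ[μ] 0 := by
    rw [← integral_eq_zero_iff_of_nonneg hf0 hfi]
    exact le_antisymm (by rw [hfint]; linarith) (integral_nonneg hf0)
  have hinner : ∀ᵐ a ∂μ, inner ℝ l (g a θ) = inner ℝ (lamS θ) (g a θ) := by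
    filter_upwards [hf] with a ha
    by_contra hne
    exact absurd ha (sub_pos.2 (tilt_add_mul_inner_lt _ _ _ _ hne)).ne'
  have hae : (fun a => tilt g a θ (lamS θ) • g a θ) =ᵐ[μ] fun a => tilt g a θ l • g a θ := by
    filter_upwards [hinner] with a ha
    rw [tilt, tilt, ha]
  exact hreg.lamS_unique θ hθ l ⟨hint.congr hae, by rw [← integral_congr_ae hae, hzero]⟩

variable [StandardBorelSpace 𝒳] [IsFiniteMeasure μ]
  {I : Type*} {ℓ : Filter I} {n : I → ℕ} {x : ∀ p, Fin (n p) → 𝒳} (hs : SampleLLN μ ℓ x)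
include hs

/-- The population inequality is strict at each point of a compact set, and locally uniform lower
bounds for averages carry it to the sample. -/
theorem eventually_sampleM_lt {r : ℝ} {D : 𝒳 → ℝ} (hD : Integrable D μ)
    (hDle : ∀ᵐ a ∂μ, ∀ θ ∈ Θ, ∀ l, ‖l - lamS θ‖ ≤ r → tilt g a θ l ≤ D a) {ε : ℝ} (hε : 0 < ε)
    (hεr : ε ≤ r) :
    ∀ᶠ p in ℓ, ∀ θ ∈ Θ, ∀ l, ‖l - lamS θ‖ = ε →
      sampleM g (x p) θ (lamS θ) < sampleM g (x p) θ l := by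
  -- The third coordinate carries `lamS θ`, so the integrand is jointly measurable on the whole
  -- product although `lamS` is only controlled on `Θ`.
  let K : Set (E Nt × E Ng × E Ng) :=
    (fun y : E Nt × E Ng => (y.1, lamS y.1 + y.2, lamS y.1)) '' (Θ ×ˢ Metric.sphere 0 ε)
  have hK : IsCompact K := by
    have h1 : ContinuousOn (fun y : E Nt × E Ng => lamS y.1) (Θ ×ˢ Metric.sphere 0 ε) :=
      hreg.continuousOn_lamS.comp continuousOn_fst fun y hy => hy.1
    exact (hreg.compact.prod (isCompact_sphere 0 ε)).image_of_continuousOn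
      (continuousOn_fst.prodMk ((h1.add continuousOn_snd).prodMk h1))
  have hKmem : ∀ y ∈ K, y.1 ∈ Θ ∧ ‖y.2.1 - lamS y.1‖ = ε ∧ y.2.2 = lamS y.1 := by
    rintro _ ⟨⟨θ, v⟩, ⟨hθ, hv⟩, rfl⟩
    exact ⟨hθ, by simpa using hv, rfl⟩
  have hint : ∀ θ ∈ Θ, ∀ l, ‖l - lamS θ‖ ≤ r → Integrable (fun a => tilt g a θ l) μ := by
    intro θ hθ l hl
    refine hD.mono' (hreg.measurable_tilt_left _ _).aestronglyMeasurable ?_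
    filter_upwards [hDle] with a ha
    rw [Real.norm_of_nonneg (tilt_pos _ _ _).le]
    exact ha θ hθ l hl
  have key : ∀ᶠ p in ℓ, ∀ y ∈ K,
      0 < avg (x p) (fun a => tilt g a y.1 y.2.1 - tilt g a y.1 y.2.2) := by
    refine hK.induction_on (p := fun s => ∀ᶠ p in ℓ, ∀ y ∈ s,
      0 < avg (x p) (fun a => tilt g a y.1 y.2.1 - tilt g a y.1 y.2.2)) ?_ ?_ ?_ ?_
    · exact Eventually.of_forall fun p y hy => hy.elim
    · exact fun s t hst ht => ht.mono fun p hp y hy => hp y (hst hy)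
    · intro s t h1 h2
      filter_upwards [h1, h2] with p hp1 hp2 y hy
      exact hy.elim (hp1 y) (hp2 y)
    · intro y₀ hy₀
      obtain ⟨hθ, hl, hl₀⟩ := hKmem y₀ hy₀
      have hi1 := hint _ hθ _ (hl.le.trans hεr)
      have hi2 := hint _ hθ y₀.2.2 (by rw [hl₀]; simpa using hε.le.trans hεr)
      have hi : Integrable (fun a => tilt g a y₀.1 y₀.2.1 - tilt g a y₀.1 y₀.2.2) μ := hi1.sub hi2
      refine hs.eventually_lt_avg (Y := E Nt × E Ng × E Ng) (y₀ := y₀) (A := K)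
        (h := fun a y => tilt g a y.1 y.2.1 - tilt g a y.1 y.2.2) ?_ hK.measurableSet hD ?_ hy₀ ?_ hi ?_
      · exact (hreg.measurable_tilt.comp (measurable_fst.prodMk
          ((measurable_fst.comp measurable_snd).prodMk
            (measurable_fst.comp (measurable_snd.comp measurable_snd))))).sub
          (hreg.measurable_tilt.comp (measurable_fst.prodMk
          ((measurable_fst.comp measurable_snd).prodMk
            (measurable_snd.comp (measurable_snd.comp measurable_snd)))))
      · filter_upwards [hDle] with a ha y hy
        obtain ⟨h1, -, h3⟩ := hKmem y hy
        have h4 := ha _ h1 y.2.2 (by rw [h3]; simpa using hε.le.trans hεr)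
        linarith [tilt_pos (g := g) a y.1 y.2.1]
      · filter_upwards [hreg.continuous_g _ hθ] with a ha
        have hga : ContinuousWithinAt (fun y : E Nt × E Ng × E Ng => g a y.1) K y₀ :=
          ha.comp continuousWithinAt_fst fun y hy => (hKmem y hy).1
        exact (ContinuousWithinAt.inner
          (continuous_fst.comp continuous_snd).continuousWithinAt hga).rexp.sub
          (ContinuousWithinAt.inner
          (continuous_snd.comp continuous_snd).continuousWithinAt hga).rexp
      · rw [integral_sub hi1 hi2, sub_pos]
        by_contra! hcon
        rw [hl₀] at hcon hi2
        have := hreg.ae_eq_of_integral_tilt_le hθ hi1 hi2 hcon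
        rw [this] at hl
        simp at hl
        exact hε.ne hl
  filter_upwards [key] with p hp θ hθ l hl
  have := hp (θ, l, lamS θ) ⟨(θ, l - lamS θ), ⟨hθ, by simpa using hl⟩, by simp⟩
  rw [avg_sub] at this
  exact sub_pos.1 this

/-- By convexity a critical point outside the sphere would force a value on it no larger than at the
centre, and a minimizer over the closed ball lies in its interior. -/
theorem eventually_isCrit_near {ε : ℝ} (hε : 0 < ε) :
    ∀ᶠ p in ℓ, ∀ θ ∈ Θ, (∀ l, IsCrit g (x p) θ l → ‖l - lamS θ‖ < ε) ∧
      ∃ l, IsCrit g (x p) θ l ∧ ‖l - lamS θ‖ < ε := by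
  obtain ⟨r, hr, -, D, hD, hDle⟩ := hreg.exists_envelope
  filter_upwards [hreg.eventually_sampleM_lt hs hD hDle (lt_min hε hr) (min_le_right _ _)]
    with p hp θ hθ
  constructor
  · intro l hl
    by_contra! hcon
    obtain ⟨l', hl', hle⟩ := hl.exists_sphere (lt_min hε hr) ((min_le_left _ _).trans hcon)
    exact absurd (hp θ hθ l' hl') (not_lt.2 hle)
  · obtain ⟨l, hl, hc⟩ := exists_isCrit (lt_min hε hr) (hp θ hθ)
    exact ⟨l, hc, hl.trans_le (min_le_left _ _)⟩

omit hreg hs [StandardBorelSpace 𝒳] [IsFiniteMeasure μ] in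
theorem neg_logL_eq {θ : E Nt} (hpos : 0 < ∫ a, tilt g a θ (lamS θ) ∂μ) :
    -logL μ g lamS θ = Real.log (∫ a, tilt g a θ (lamS θ) ∂μ) -
      inner ℝ (lamS θ) (∫ a, g a θ ∂μ) := by
  have h : ∀ a, Real.exp (inner ℝ (lamS θ) (g a θ - ∫ y, g y θ ∂μ)) =
      Real.exp (-inner ℝ (lamS θ) (∫ y, g y θ ∂μ)) * tilt g a θ (lamS θ) := by
    intro a
    rw [tilt, ← Real.exp_add, inner_sub_right]
    ring_nf
  rw [logL, neg_neg]
  simp only [h]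
  rw [integral_const_mul, Real.log_mul (Real.exp_pos _).ne' hpos.ne', Real.log_exp]
  ring

/-- The upper bound is needed at the single parameter `θs`, where the ordinary law of large numbers
suffices. -/
theorem eventually_disc_lt (hμ : μ ≠ 0) {η : ℝ} (hη : 0 < η) :
    ∀ᶠ p in ℓ, ∃ l, IsCrit g (x p) θs l ∧ disc g (x p) θs l < -logL μ g lamS θs + η := by
  obtain ⟨r, hr, -, D, hD, hDle⟩ := hreg.exists_envelope
  have hθs : θs ∈ Θ := interior_subset hreg.interior
  have hint : Integrable (fun a => tilt g a θs (lamS θs)) μ := by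
    refine hD.mono' (hreg.measurable_tilt_left _ _).aestronglyMeasurable ?_
    filter_upwards [hDle] with a ha
    rw [Real.norm_of_nonneg (tilt_pos _ _ _).le]
    exact ha θs hθs _ (by simpa using hr.le)
  have : NeZero μ := ⟨hμ⟩
  have hpos : 0 < ∫ a, tilt g a θs (lamS θs) ∂μ := integral_exp_pos hint
  have hg := hs.lln_finiteDimensional (hreg.integrable_g θs hθs)
  have hM := hs.lln _ hint
  have hlim : Tendsto (fun p => disc g (x p) θs (lamS θs)) ℓ (𝓝 (-logL μ g lamS θs)) := by
    rw [neg_logL_eq hpos]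
    exact ((Real.continuousAt_log hpos.ne').tendsto.comp hM).sub
      (tendsto_const_nhds.inner hg)
  set c := ‖∫ a, g a θs ∂μ‖ with hc
  -- Eventually `‖avg g‖ < c + 1`, so moving from `lamS θs` to a critical point this close changes
  -- the linear term by at most `η / 2`. The logarithmic term can only decrease.
  have hε : 0 < η / 2 / (c + 1) := by positivity
  filter_upwards [hreg.eventually_isCrit_near hs hε, hs.size_pos,
    hlim.eventually (gt_mem_nhds (show -logL μ g lamS θs < -logL μ g lamS θs + η / 2 by linarith)),
    hg.norm.eventually (gt_mem_nhds (show c < c + 1 by linarith))] with p h1 hn h2 h3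
  obtain ⟨l, hl, hlε⟩ := (h1 θs hθs).2
  refine ⟨l, hl, ?_⟩
  have h4 : Real.log (sampleM g (x p) θs l) ≤ Real.log (sampleM g (x p) θs (lamS θs)) :=
    Real.log_le_log (sampleM_pos hn) (hl.sampleM_le _)
  have h5 : -inner ℝ (l - lamS θs) (avg (x p) fun a => g a θs) ≤ η / 2 := by
    refine (neg_le_abs _).trans ((abs_real_inner_le_norm _ _).trans ?_)
    calc ‖l - lamS θs‖ * ‖avg (x p) fun a => g a θs‖ ≤ (η / 2 / (c + 1)) * (c + 1) := by gcongr
      _ = η / 2 := div_mul_cancel₀ _ (by positivity)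
  rw [inner_sub_left] at h5
  unfold disc at h2 ⊢
  linarith

/-- Away from `θs` the objective exceeds its value at `θs` by a fixed margin, uniformly over a
compact set and over all `l` near `lamS θ`. -/
theorem eventually_isETEL_near (hμ : μ ≠ 0) {ε : ℝ} (hε : 0 < ε) :
    ∀ᶠ p in ℓ, ∀ θ, IsETEL g Θ (x p) θ → ‖θ - θs‖ < ε := by
  obtain ⟨r, hr, -, D, hD, hDle⟩ := hreg.exists_envelope
  have hint : ∀ θ ∈ Θ, Integrable (fun a => tilt g a θ (lamS θ)) μ := by
    intro θ hθ
    refine hD.mono' (hreg.measurable_tilt_left _ _).aestronglyMeasurable ?_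
    filter_upwards [hDle] with a ha
    rw [Real.norm_of_nonneg (tilt_pos _ _ _).le]
    exact ha θ hθ _ (by simpa using hr.le)
  have : NeZero μ := ⟨hμ⟩
  let A : Set (E Nt × E Ng) := {y | y.1 ∈ Θ ∧ ‖y.2 - lamS y.1‖ ≤ r}
  have hA : MeasurableSet A := (hreg.isCompact_tube r).measurableSet
  let K : Set (E Nt) := Θ \ Metric.ball θs ε
  have hK : IsCompact K := hreg.compact.diff Metric.isOpen_ball
  obtain ⟨ρ, hρ, η, hη, key⟩ : ∃ ρ > 0, ∃ η > 0, ∀ᶠ p in ℓ, ∀ θ ∈ K, θ ∈ Θ → ∀ l,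
      ‖l - lamS θ‖ < ρ → -logL μ g lamS θs + η < disc g (x p) θ l := by
    refine hK.induction_on (p := fun s => ∃ ρ > 0, ∃ η > 0, ∀ᶠ p in ℓ, ∀ θ ∈ s, θ ∈ Θ → ∀ l,
      ‖l - lamS θ‖ < ρ → -logL μ g lamS θs + η < disc g (x p) θ l) ?_ ?_ ?_ ?_
    · exact ⟨1, one_pos, 1, one_pos, Eventually.of_forall fun p θ hθ => hθ.elim⟩
    · rintro s t hst ⟨ρ, hρ, η, hη, h⟩
      exact ⟨ρ, hρ, η, hη, h.mono fun p hp θ hθ => hp θ (hst hθ)⟩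
    · rintro s t ⟨ρ, hρ, η, hη, h⟩ ⟨ρ', hρ', η', hη', h'⟩
      refine ⟨min ρ ρ', lt_min hρ hρ', min η η', lt_min hη hη', ?_⟩
      filter_upwards [h, h'] with p hp hp' θ hθ hθΘ l hl
      rcases hθ with hθ | hθ
      · have := hp θ hθ hθΘ l (hl.trans_le (min_le_left _ _))
        linarith [min_le_left η η']
      · have := hp' θ hθ hθΘ l (hl.trans_le (min_le_right _ _))
        linarith [min_le_right η η']
    · rintro θ₀ ⟨hθ₀, hfar⟩
      have hne : θ₀ ≠ θs := by
        rintro rfl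
        exact hfar (Metric.mem_ball_self hε)
      have hgap := hreg.maximizer θ₀ hθ₀ hne
      set M₀ := ∫ a, tilt g a θ₀ (lamS θ₀) ∂μ with hM₀
      have hpos : 0 < M₀ := integral_exp_pos (hint θ₀ hθ₀)
      have heq := neg_logL_eq hpos
      -- One third of the gap for each of the two terms of `disc`; the last third is the margin.
      set η := (logL μ g lamS θs - logL μ g lamS θ₀) / 3 with hη
      have hηpos : 0 < η := by simp only [hη]; linarith
      have hy₀ : (θ₀, lamS θ₀) ∈ A := ⟨hθ₀, by simpa using hr.le⟩
      have hgc : ∀ᵐ a ∂μ, ContinuousWithinAt (fun y : E Nt × E Ng => g a y.1) A (θ₀, lamS θ₀) := by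
        filter_upwards [hreg.continuous_g _ hθ₀] with a ha
        exact ha.comp continuousWithinAt_fst fun y hy => hy.1
      obtain ⟨V₁, hV₁, h₁⟩ := hs.eventually_lt_avg (Y := E Nt × E Ng) (A := A)
        (y₀ := (θ₀, lamS θ₀)) (h := fun a y => tilt g a y.1 y.2)
        (c := M₀ * Real.exp (-η)) (D := fun _ => 0) hreg.measurable_tilt hA (integrable_zero _ _ _)
        (ae_of_all _ fun a y _ => by simpa using (tilt_pos a y.1 y.2).le) hy₀
        (by
          filter_upwards [hgc] with a ha
          exact (ContinuousWithinAt.inner continuous_snd.continuousWithinAt ha).rexp)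
        (hint θ₀ hθ₀) (by
          refine mul_lt_of_lt_one_right hpos ?_
          rw [Real.exp_lt_one_iff]
          linarith)
      obtain ⟨V₂, hV₂, h₂⟩ := hs.eventually_lt_avg (Y := E Nt × E Ng) (A := A)
        (y₀ := (θ₀, lamS θ₀)) (h := fun a y => inner ℝ (-y.2) (g a y.1))
        (c := -inner ℝ (lamS θ₀) (∫ a, g a θ₀ ∂μ) - η) (D := D)
        (by
          have h1 : Measurable fun p : 𝒳 × E Nt × E Ng => g p.1 p.2.1 :=
            hreg.measurable_g.comp (measurable_fst.prodMk (measurable_fst.comp measurable_snd))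
          exact (measurable_snd.comp measurable_snd).neg.inner h1) hA hD
        (by
          -- The bound `t ≤ exp t` gives `-λ'g ≥ -exp(λ'g) ≥ -D`, so no envelope for `‖g‖` is
          -- required.
          filter_upwards [hDle] with a ha y hy
          have h1 := ha y.1 hy.1 y.2 hy.2
          have h2 := Real.add_one_le_exp (inner ℝ y.2 (g a y.1))
          rw [inner_neg_left]
          unfold tilt at h1
          linarith) hy₀
        (by
          filter_upwards [hgc] with a ha
          exact ContinuousWithinAt.inner continuous_snd.neg.continuousWithinAt ha)
        ((hreg.integrable_g θ₀ hθ₀).const_inner _) (by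
          rw [integral_inner (hreg.integrable_g θ₀ hθ₀), inner_neg_left]
          linarith)
      obtain ⟨δ, hδ, hV⟩ := Metric.mem_nhdsWithin_iff.1 (inter_mem hV₁ hV₂)
      have hcont := Metric.continuousWithinAt_iff.1 (hreg.continuousOn_lamS θ₀ hθ₀) (δ / 2)
        (by positivity)
      obtain ⟨δ', hδ', hcont⟩ := hcont
      refine ⟨Metric.ball θ₀ (min δ δ'), mem_nhdsWithin_of_mem_nhds
        (Metric.ball_mem_nhds _ (lt_min hδ hδ')), min (δ / 2) r, lt_min (by positivity) hr, η,
        hηpos, ?_⟩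
      filter_upwards [h₁, h₂] with p hp1 hp2 θ hθ hθΘ l hl
      have hd : dist θ θ₀ < min δ δ' := hθ
      have hmem : (θ, l) ∈ V₁ ∩ V₂ := by
        refine hV ⟨?_, hθΘ, (hl.trans_le (min_le_right _ _)).le⟩
        rw [Metric.mem_ball, Prod.dist_eq, max_lt_iff]
        refine ⟨hd.trans_le (min_le_left _ _), ?_⟩
        have h3 := hcont hθΘ (hd.trans_le (min_le_right _ _))
        have h4 : dist l (lamS θ) < δ / 2 := by
          rw [dist_eq_norm]; exact hl.trans_le (min_le_left _ _)
        calc dist l (lamS θ₀) ≤ dist l (lamS θ) + dist (lamS θ) (lamS θ₀) := dist_triangle _ _ _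
          _ < δ := by linarith
      have h5 := hp1 _ hmem.1
      have h6 := hp2 _ hmem.2
      simp only [inner_neg_left] at h6
      rw [avg_neg, avg_inner] at h6
      have h7 := Real.log_lt_log (mul_pos hpos (Real.exp_pos _)) h5
      rw [Real.log_mul hpos.ne' (Real.exp_pos _).ne', Real.log_exp] at h7
      change _ < Real.log (avg (x p) fun a => tilt g a θ l) - inner ℝ l (avg (x p) fun a => g a θ)
      linarith
  filter_upwards [key, hreg.eventually_isCrit_near hs hρ, hreg.eventually_disc_lt hs hμ hη,
    hs.size_pos] with p h1 h2 ⟨l₀, hl₀, h3⟩ hn θ hθ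
  by_contra! hcon
  obtain ⟨l, hl⟩ := hθ.exists_isCrit hn
  have h4 := h1 θ ⟨hθ.1, by simpa [dist_eq_norm] using hcon⟩ hθ.1 l ((h2 θ hθ.1).1 l hl)
  have h5 := hθ.disc_le hn hl (interior_subset hreg.interior) hl₀
  linarith

theorem eventually_augmented_near (hμ : μ ≠ 0) {ε : ℝ} (hε : 0 < ε) :
    ∀ᶠ p in ℓ, ∀ β, IsAugmentedETEL g Θ (x p) β →
      ‖thOf β - θs‖ < ε ∧ ‖lamOf β - lamS θs‖ < ε := by
  have hθs : θs ∈ Θ := interior_subset hreg.interior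
  obtain ⟨δ, hδ, hcont⟩ := Metric.continuousWithinAt_iff.1 (hreg.continuousOn_lamS θs hθs) (ε / 2)
    (by positivity)
  filter_upwards [hreg.eventually_isETEL_near hs hμ (lt_min hε hδ),
    hreg.eventually_isCrit_near hs (half_pos hε)] with p h1 h2 β hβ
  have h3 := h1 _ hβ.theta
  have hθ := hβ.theta.1
  refine ⟨h3.trans_le (min_le_left _ _), ?_⟩
  have h4 := (h2 _ hθ).1 _ hβ.isCrit
  have h5 := hcont hθ (by rw [dist_eq_norm]; exact h3.trans_le (min_le_right _ _))
  rw [dist_eq_norm] at h5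
  calc ‖lamOf β - lamS θs‖ = ‖(lamOf β - lamS (thOf β)) + (lamS (thOf β) - lamS θs)‖ := by
        congr 1; abel
    _ ≤ ‖lamOf β - lamS (thOf β)‖ + ‖lamS (thOf β) - lamS θs‖ := norm_add_le _ _
    _ < ε := by linarith

end Regularity

end Consistency

/-! ### Moment functions which are Lipschitz in the parameter -/

section Lipschitz

variable {𝒳 Y F G H : Type*} [NormedAddCommGroup Y] [NormedAddCommGroup F] [NormedSpace ℝ F]
  [NormedAddCommGroup G] [NormedSpace ℝ G] [NormedAddCommGroup H] [NormedSpace ℝ H]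

/-- For `a ∈ S` the function `f a` is bounded on `R` by a multiple of `W a` and Lipschitz on `R`
with a constant that is a multiple of `W a * c a`. -/
def LipGraded (S : Set 𝒳) (R : Set Y) (c W : 𝒳 → ℝ) (f : 𝒳 → Y → F) : Prop :=
  ∃ C, 0 ≤ C ∧ ∀ a ∈ S, (∀ y ∈ R, ‖f a y‖ ≤ C * W a) ∧
    ∀ y ∈ R, ∀ y' ∈ R, ‖f a y - f a y'‖ ≤ C * (W a * c a) * ‖y - y'‖

namespace LipGraded

variable {S : Set 𝒳} {R : Set Y} {c W W' : 𝒳 → ℝ}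

omit [NormedSpace ℝ F] in
theorem mono {f : 𝒳 → Y → F} (h : LipGraded S R c W f) (hc : ∀ a ∈ S, 0 ≤ c a)
    (hW : ∀ a ∈ S, W a ≤ W' a) : LipGraded S R c W' f := by
  obtain ⟨C, hC, h⟩ := h
  refine ⟨C, hC, fun a ha => ⟨fun y hy => ((h a ha).1 y hy).trans ?_, fun y hy y' hy' =>
    ((h a ha).2 y hy y' hy').trans ?_⟩⟩
  · have := hW a ha
    gcongr
  · have := hW a ha
    have := hc a ha
    gcongr

omit [NormedSpace ℝ F] in
theorem add {f f' : 𝒳 → Y → F} (h : LipGraded S R c W f) (h' : LipGraded S R c W f') :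
    LipGraded S R c W fun a y => f a y + f' a y := by
  obtain ⟨C, hC, h⟩ := h
  obtain ⟨C', hC', h'⟩ := h'
  refine ⟨C + C', by positivity, fun a ha => ⟨fun y hy => ?_, fun y hy y' hy' => ?_⟩⟩
  · have h1 := (h a ha).1 y hy
    have h2 := (h' a ha).1 y hy
    calc _ ≤ ‖f a y‖ + ‖f' a y‖ := norm_add_le _ _
      _ ≤ C * W a + C' * W a := add_le_add h1 h2
      _ = _ := by ring
  · have h1 := (h a ha).2 y hy y' hy'
    have h2 := (h' a ha).2 y hy y' hy'
    calc ‖f a y + f' a y - (f a y' + f' a y')‖ = ‖(f a y - f a y') + (f' a y - f' a y')‖ := by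
          congr 1; abel
      _ ≤ ‖f a y - f a y'‖ + ‖f' a y - f' a y'‖ := norm_add_le _ _
      _ ≤ C * (W a * c a) * ‖y - y'‖ + C' * (W a * c a) * ‖y - y'‖ := add_le_add h1 h2
      _ = _ := by ring

theorem clm {f : 𝒳 → Y → F} (h : LipGraded S R c W f) (L : F →L[ℝ] G) :
    LipGraded S R c W fun a y => L (f a y) := by
  obtain ⟨C, hC, h⟩ := h
  refine ⟨‖L‖ * C, by positivity, fun a ha => ⟨fun y hy => ?_, fun y hy y' hy' => ?_⟩⟩
  · rw [mul_assoc]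
    exact L.le_opNorm_of_le ((h a ha).1 y hy)
  · rw [← map_sub, mul_assoc, mul_assoc]
    refine L.le_opNorm_of_le (((h a ha).2 y hy y' hy').trans_eq (by ring))

theorem neg {f : 𝒳 → Y → F} (h : LipGraded S R c W f) :
    LipGraded S R c W fun a y => - f a y := by
  simpa using h.clm (-(ContinuousLinearMap.id ℝ F))

theorem sub {f f' : 𝒳 → Y → F} (h : LipGraded S R c W f) (h' : LipGraded S R c W f') :
    LipGraded S R c W fun a y => f a y - f' a y := by
  simpa [sub_eq_add_neg] using h.add h'.neg

/-- Weights multiply while the Lipschitz bound keeps a single factor `c`, as in the product rule.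
This keeps the moment order of `φ` low. -/
theorem bilin {f : 𝒳 → Y → F} {f' : 𝒳 → Y → G} (h : LipGraded S R c W f)
    (h' : LipGraded S R c W' f') (L : F →L[ℝ] G →L[ℝ] H) (hW : ∀ a ∈ S, 0 ≤ W a)
    (hW' : ∀ a ∈ S, 0 ≤ W' a) :
    LipGraded S R c (fun a => W a * W' a) fun a y => L (f a y) (f' a y) := by
  obtain ⟨C, hC, h⟩ := h
  obtain ⟨C', hC', h'⟩ := h'
  refine ⟨2 * (‖L‖ * C * C'), by positivity, fun a ha => ⟨fun y hy => ?_, fun y hy y' hy' => ?_⟩⟩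
  · have h1 := (h a ha).1 y hy
    have h2 := (h' a ha).1 y hy
    have h3 := hW a ha
    have h4 := hW' a ha
    calc _ ≤ ‖L‖ * ‖f a y‖ * ‖f' a y‖ := L.le_opNorm₂ _ _
      _ ≤ ‖L‖ * (C * W a) * (C' * W' a) := by gcongr
      _ = (‖L‖ * C * C') * (W a * W' a) := by ring
      _ ≤ _ := by
        have : 0 ≤ (‖L‖ * C * C') * (W a * W' a) := by positivity
        linarith
  · have h1 := (h a ha).1 y' hy'
    have h2 := (h' a ha).1 y hy
    have h3 := (h a ha).2 y hy y' hy'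
    have h4 := (h' a ha).2 y hy y' hy'
    have h5 := hW a ha
    have h6 := hW' a ha
    have e : L (f a y) (f' a y) - L (f a y') (f' a y') =
        L (f a y - f a y') (f' a y) + L (f a y') (f' a y - f' a y') := by
      simp
    rw [e]
    calc _ ≤ ‖L (f a y - f a y') (f' a y)‖ + ‖L (f a y') (f' a y - f' a y')‖ := norm_add_le _ _
      _ ≤ ‖L‖ * ‖f a y - f a y'‖ * ‖f' a y‖ + ‖L‖ * ‖f a y'‖ * ‖f' a y - f' a y'‖ :=
        add_le_add (L.le_opNorm₂ _ _) (L.le_opNorm₂ _ _)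
      _ ≤ ‖L‖ * (C * (W a * c a) * ‖y - y'‖) * (C' * W' a) +
          ‖L‖ * (C * W a) * (C' * (W' a * c a) * ‖y - y'‖) := by
        have h7 : 0 ≤ C * (W a * c a) * ‖y - y'‖ := (norm_nonneg _).trans h3
        gcongr
      _ = _ := by ring

theorem mul {f f' : 𝒳 → Y → ℝ} (h : LipGraded S R c W f)
    (h' : LipGraded S R c W' f') (hW : ∀ a ∈ S, 0 ≤ W a) (hW' : ∀ a ∈ S, 0 ≤ W' a) :
    LipGraded S R c (fun a => W a * W' a) fun a y => f a y * f' a y :=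
  h.bilin h' (ContinuousLinearMap.mul ℝ ℝ) hW hW'

theorem smul {f : 𝒳 → Y → ℝ} {f' : 𝒳 → Y → F} (h : LipGraded S R c W f)
    (h' : LipGraded S R c W' f') (hW : ∀ a ∈ S, 0 ≤ W a) (hW' : ∀ a ∈ S, 0 ≤ W' a) :
    LipGraded S R c (fun a => W a * W' a) fun a y => f a y • f' a y :=
  h.bilin h' (ContinuousLinearMap.lsmul ℝ ℝ) hW hW'

theorem inner {F : Type*} [NormedAddCommGroup F] [InnerProductSpace ℝ F] {f f' : 𝒳 → Y → F}
    (h : LipGraded S R c W f) (h' : LipGraded S R c W' f') (hW : ∀ a ∈ S, 0 ≤ W a)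
    (hW' : ∀ a ∈ S, 0 ≤ W' a) :
    LipGraded S R c (fun a => W a * W' a) fun a y => inner ℝ (f a y) (f' a y) :=
  h.bilin h' (innerSL ℝ) hW hW'

theorem euclidean {ι : Type*} [Fintype ι] {f : 𝒳 → Y → EuclideanSpace ℝ ι}
    (h : ∀ i, LipGraded S R c W fun a y => f a y i) : LipGraded S R c W f := by
  choose C hC h using h
  have hle : ∀ v : EuclideanSpace ℝ ι, ‖v‖ ≤ ∑ i, ‖v i‖ := by
    intro v
    rw [EuclideanSpace.norm_eq, Real.sqrt_le_left (by positivity)]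
    exact Finset.sum_sq_le_sq_sum_of_nonneg fun i _ => norm_nonneg _
  refine ⟨∑ i, C i, Finset.sum_nonneg fun i _ => hC i, fun a ha => ⟨fun y hy => ?_,
    fun y hy y' hy' => ?_⟩⟩
  · rw [Finset.sum_mul]
    exact (hle _).trans (Finset.sum_le_sum fun i _ => (h i a ha).1 y hy)
  · rw [Finset.sum_mul, Finset.sum_mul]
    exact (hle _).trans (Finset.sum_le_sum fun i _ => (h i a ha).2 y hy y' hy')

end LipGraded

variable [MeasurableSpace 𝒳] {μ : Measure 𝒳} {I : Type*} {ℓ : Filter I} {n : I → ℕ}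
  {x : ∀ p, Fin (n p) → 𝒳}

/-- Averages converge uniformly near `y₀`, if the summands have an integrable Lipschitz constant. -/
theorem SampleLLN.eventually_norm_avg_sub_lt [FiniteDimensional ℝ F] (hs : SampleLLN μ ℓ x)
    {f : 𝒳 → Y → F} {y₀ : Y} {δ₀ : ℝ} (hδ₀ : 0 < δ₀) {L : 𝒳 → ℝ} (hL : Integrable L μ)
    (hlip : ∀ᵐ a ∂μ, ∀ y ∈ Metric.ball y₀ δ₀, ‖f a y - f a y₀‖ ≤ L a * ‖y - y₀‖)
    (hint : Integrable (fun a => f a y₀) μ) {ε : ℝ} (hε : 0 < ε) :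
    ∃ δ > 0, ∀ᶠ p in ℓ, ∀ y ∈ Metric.ball y₀ δ,
      ‖avg (x p) (fun a => f a y) - ∫ a, f a y₀ ∂μ‖ < ε := by
  set m := max (∫ a, L a ∂μ) 0 with hm
  refine ⟨min δ₀ (ε / 2 / (m + 1)), lt_min hδ₀ (by positivity), ?_⟩
  have h1 := hs.lln _ hL
  have h2 := (tendsto_iff_norm_sub_tendsto_zero.1 (hs.lln_finiteDimensional hint))
  filter_upwards [h1.eventually (gt_mem_nhds (show _ < m + 1 by linarith [le_max_left (∫ a, L a ∂μ) 0])),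
    h2.eventually (gt_mem_nhds (half_pos hε)), hs.ae _ hlip] with p hp1 hp2 hp3 y hy
  have hy1 : ‖y - y₀‖ < ε / 2 / (m + 1) := by
    rw [← dist_eq_norm]; exact (Metric.mem_ball.1 hy).trans_le (min_le_right _ _)
  have hy2 : y ∈ Metric.ball y₀ δ₀ := (Metric.mem_ball.1 hy).trans_le (min_le_left _ _)
  have h3 : ‖avg (x p) (fun a => f a y) - avg (x p) (fun a => f a y₀)‖ ≤ ε / 2 := by
    rw [← avg_sub]
    calc _ ≤ avg (x p) (fun a => ‖f a y - f a y₀‖) := norm_avg_le _ _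
      _ ≤ avg (x p) (fun a => ‖y - y₀‖ * L a) :=
        avg_mono _ fun i => (hp3 i y hy2).trans_eq (mul_comm _ _)
      _ = ‖y - y₀‖ * avg (x p) L := avg_mul _ _ _
      _ ≤ ‖y - y₀‖ * (m + 1) := by gcongr
      _ ≤ (ε / 2 / (m + 1)) * (m + 1) := by gcongr
      _ = ε / 2 := div_mul_cancel₀ _ (by positivity)
  calc _ = ‖(avg (x p) (fun a => f a y) - avg (x p) (fun a => f a y₀)) +
        (avg (x p) (fun a => f a y₀) - ∫ a, f a y₀ ∂μ)‖ := by congr 1; abel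
    _ ≤ _ := norm_add_le _ _
    _ < ε := by linarith

section Linearization

variable {ι : Type*} [Fintype ι] [DecidableEq ι] {f : 𝒳 → EuclideanSpace ℝ ι → F}
  {y₀ : EuclideanSpace ℝ ι} {δ₀ : ℝ} {L : 𝒳 → ℝ}

theorem clm_eq_sum_smulRight (T : EuclideanSpace ℝ ι →L[ℝ] F) :
    T = ∑ j, (EuclideanSpace.proj (𝕜 := ℝ) j : EuclideanSpace ℝ ι →L[ℝ] ℝ).smulRight
      (T (EuclideanSpace.single j 1)) := by
  ext v
  simp only [sum_apply, ContinuousLinearMap.smulRight_apply]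
  conv_lhs => rw [← (EuclideanSpace.basisFun ι ℝ).sum_repr v, map_sum]
  simp

/-- The derivative at a point of a random function is measurable. -/
theorem aestronglyMeasurable_fderiv (hδ₀ : 0 < δ₀)
    (hmeas : ∀ y ∈ Metric.ball y₀ δ₀, AEStronglyMeasurable (fun a => f a y) μ)
    (hdiff : ∀ᵐ a ∂μ, DifferentiableAt ℝ (f a) y₀) :
    AEStronglyMeasurable (fun a => fderiv ℝ (f a) y₀) μ := by
  have hcol : ∀ v : EuclideanSpace ℝ ι, ‖v‖ ≤ 1 →
      AEStronglyMeasurable (fun a => fderiv ℝ (f a) y₀ v) μ := by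
    intro v hv
    let t : ℕ → ℝ := fun m => δ₀ / 2 * (1 / ((m : ℝ) + 1))
    have ht0 : ∀ m, 0 < t m := fun m => by positivity
    have htle : ∀ m, t m < δ₀ := fun m => by
      have : 1 / ((m : ℝ) + 1) ≤ 1 := by
        rw [div_le_one (by positivity)]
        linarith [(Nat.cast_nonneg m : (0 : ℝ) ≤ m)]
      calc t m ≤ δ₀ / 2 * 1 := by simp only [t]; gcongr
        _ < δ₀ := by linarith
    have htlim : Tendsto t atTop (𝓝[≠] 0) := by
      refine tendsto_nhdsWithin_iff.2 ⟨?_, Eventually.of_forall fun m => (ht0 m).ne'⟩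
      simpa [t] using tendsto_one_div_add_atTop_nhds_zero_nat.const_mul (δ₀ / 2)
    -- Directional derivatives are limits of measurable difference quotients, with steps short
    -- enough to stay in the ball where `f` is measurable.
    refine aestronglyMeasurable_of_tendsto_ae atTop
      (f := fun m a => (t m)⁻¹ • (f a (y₀ + t m • v) - f a y₀)) (fun m => ?_) ?_
    · refine ((hmeas _ ?_).sub (hmeas _ (Metric.mem_ball_self hδ₀))).const_smul _
      rw [mem_ball_iff_norm, add_sub_cancel_left, norm_smul, Real.norm_of_nonneg (ht0 m).le]
      have := htle m
      nlinarith [ht0 m, norm_nonneg v]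
    · filter_upwards [hdiff] with a ha
      have h1 : HasDerivAt (fun s : ℝ => f a (y₀ + s • v)) (fderiv ℝ (f a) y₀ v) 0 :=
        ha.hasFDerivAt.hasLineDerivAt v
      have h2 := (hasDerivAt_iff_tendsto_slope_zero.1 h1).comp htlim
      simpa [Function.comp_def] using h2
  have : (fun a => fderiv ℝ (f a) y₀) = fun a => ∑ j,
      (ContinuousLinearMap.smulRightL ℝ (EuclideanSpace ℝ ι) F (EuclideanSpace.proj j))
        (fderiv ℝ (f a) y₀ (EuclideanSpace.single j 1)) := by
    ext1 a
    exact clm_eq_sum_smulRight _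
  rw [this]
  refine Finset.aestronglyMeasurable_fun_sum _ fun j _ => ?_
  exact (ContinuousLinearMap.continuous _).comp_aestronglyMeasurable (hcol _ (by simp))

theorem integrable_fderiv (hδ₀ : 0 < δ₀) (hL : Integrable L μ)
    (hmeas : ∀ y ∈ Metric.ball y₀ δ₀, AEStronglyMeasurable (fun a => f a y) μ)
    (hdiff : ∀ᵐ a ∂μ, DifferentiableAt ℝ (f a) y₀)
    (hlip : ∀ᵐ a ∂μ, 0 ≤ L a ∧ ∀ y ∈ Metric.ball y₀ δ₀, ‖f a y - f a y₀‖ ≤ L a * ‖y - y₀‖) :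
    Integrable (fun a => fderiv ℝ (f a) y₀) μ ∧ ∀ᵐ a ∂μ, ‖fderiv ℝ (f a) y₀‖ ≤ L a := by
  have hle : ∀ᵐ a ∂μ, ‖fderiv ℝ (f a) y₀‖ ≤ L a := by
    filter_upwards [hdiff, hlip] with a h1 h2
    exact h1.hasFDerivAt.le_of_lip' h2.1
      (Filter.mem_of_superset (Metric.ball_mem_nhds y₀ hδ₀) h2.2)
  exact ⟨hL.mono' (aestronglyMeasurable_fderiv hδ₀ hmeas hdiff) hle, hle⟩

/-- Averages of differentiable random functions are uniformly close to their linearizations. -/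
theorem SampleLLN.eventually_linearization [FiniteDimensional ℝ F] (hs : SampleLLN μ ℓ x)
    (hδ₀ : 0 < δ₀) (hL : Integrable L μ)
    (hmeas : ∀ y ∈ Metric.ball y₀ δ₀, AEStronglyMeasurable (fun a => f a y) μ)
    (hdiff : ∀ᵐ a ∂μ, DifferentiableAt ℝ (f a) y₀)
    (hlip : ∀ᵐ a ∂μ, 0 ≤ L a ∧ ∀ y ∈ Metric.ball y₀ δ₀, ∀ y' ∈ Metric.ball y₀ δ₀,
      ‖f a y - f a y'‖ ≤ L a * ‖y - y'‖) {ε : ℝ} (hε : 0 < ε) :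
    ∃ δ > 0, ∀ᶠ p in ℓ, ∀ y ∈ Metric.ball y₀ δ,
      ‖avg (x p) (fun a => f a y) - avg (x p) (fun a => f a y₀) -
        (∫ a, fderiv ℝ (f a) y₀ ∂μ) (y - y₀)‖ ≤ ε * ‖y - y₀‖ := by
  obtain ⟨hTint, hTle⟩ := integrable_fderiv hδ₀ hL hmeas hdiff (by
    filter_upwards [hlip] with a ha
    exact ⟨ha.1, fun y hy => ha.2 y hy y₀ (Metric.mem_ball_self hδ₀)⟩)
  set T : 𝒳 → EuclideanSpace ℝ ι →L[ℝ] F := fun a => fderiv ℝ (f a) y₀ with hT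
  let rem : 𝒳 → EuclideanSpace ℝ ι → F := fun a y => f a y - f a y₀ - T a (y - y₀)
  let t : ℕ → ℝ := fun m => δ₀ * (1 / ((m : ℝ) + 1))
  have ht0 : ∀ m, 0 < t m := fun m => by positivity
  have htle : ∀ m, t m ≤ δ₀ := fun m => by
    have : 1 / ((m : ℝ) + 1) ≤ 1 := by
      rw [div_le_one (by positivity)]
      linarith [(Nat.cast_nonneg m : (0 : ℝ) ≤ m)]
    calc t m ≤ δ₀ * 1 := by simp only [t]; gcongr
      _ = δ₀ := mul_one _
  have htlim : Tendsto t atTop (𝓝 0) := by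
    simpa [t] using tendsto_one_div_add_atTop_nhds_zero_nat.const_mul δ₀
  let U : ℕ → Set (EuclideanSpace ℝ ι) := fun m => Metric.ball y₀ (t m) \ {y₀}
  have hUo : ∀ m, IsOpen (U m) := fun m => Metric.isOpen_ball.sdiff isClosed_singleton
  have hUball : ∀ m, U m ⊆ Metric.ball y₀ δ₀ := fun m y hy =>
    Metric.ball_subset_ball (htle m) hy.1
  let s := TopologicalSpace.denseSeq (EuclideanSpace ℝ ι)
  -- The worst relative remainder over a punctured ball. Restricting to a dense sequence keeps it
  -- measurable under measurability in `a` alone; continuity in `y` later recovers all points.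
  let ρ : ℕ → 𝒳 → ℝ≥0∞ := fun m a =>
    ⨆ k, ⨆ (_ : s k ∈ U m), ENNReal.ofReal (‖rem a (s k)‖ / ‖s k - y₀‖)
  have hρm : ∀ m, AEMeasurable (ρ m) μ := by
    intro m
    refine AEMeasurable.iSup fun k => AEMeasurable.iSup fun hk => ?_
    have h1 : AEStronglyMeasurable (fun a => rem a (s k)) μ :=
      ((hmeas _ (hUball m hk)).sub (hmeas _ (Metric.mem_ball_self hδ₀))).sub
        (hTint.1.apply_continuousLinearMap _)
    exact ((h1.norm.aemeasurable).div_const _).ennreal_ofReal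
  have hremle : ∀ᵐ a ∂μ, ∀ y ∈ Metric.ball y₀ δ₀, ‖rem a y‖ ≤ 2 * L a * ‖y - y₀‖ := by
    filter_upwards [hlip, hTle] with a h1 h2 y hy
    calc ‖rem a y‖ ≤ ‖f a y - f a y₀‖ + ‖T a (y - y₀)‖ := norm_sub_le _ _
      _ ≤ L a * ‖y - y₀‖ + L a * ‖y - y₀‖ :=
        add_le_add (h1.2 y hy y₀ (Metric.mem_ball_self hδ₀)) ((T a).le_of_opNorm_le h2 _)
      _ = _ := by ring
  have hρle : ∀ᵐ a ∂μ, ∀ m (C : ℝ), (∀ y ∈ U m, ‖rem a y‖ ≤ C * ‖y - y₀‖) →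
      ρ m a ≤ ENNReal.ofReal C := by
    refine ae_of_all _ fun a m C hC => iSup₂_le fun k hk => ENNReal.ofReal_le_ofReal ?_
    exact (div_le_iff₀ (norm_pos_iff.2 (sub_ne_zero.2 hk.2))).2 (hC _ hk)
  have hρL : ∀ᵐ a ∂μ, ∀ m, ρ m a ≤ ENNReal.ofReal (2 * L a) := by
    filter_upwards [hρle, hremle] with a h1 h2 m
    exact h1 m _ fun y hy => h2 y (hUball m hy)
  have hρtop : ∀ᵐ a ∂μ, ∀ m, ρ m a ≠ ∞ := by
    filter_upwards [hρL] with a h1 m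
    exact ne_top_of_le_ne_top ENNReal.ofReal_ne_top (h1 m)
  have hρnorm : ∀ m, ∀ᵐ a ∂μ, ‖(ρ m a).toReal‖ ≤ 2 * L a := by
    intro m
    filter_upwards [hρL, hlip] with a h1 h2
    rw [Real.norm_of_nonneg ENNReal.toReal_nonneg]
    exact ENNReal.toReal_le_of_le_ofReal (by linarith [h2.1]) (h1 m)
  have hρint : ∀ m, Integrable (fun a => (ρ m a).toReal) μ := fun m =>
    (hL.const_mul 2).mono' (hρm m).ennreal_toReal.aestronglyMeasurable (hρnorm m)
  -- Differentiability at `y₀` sends `ρ` to zero pointwise and `2L` dominates it. Continuity of the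
  -- derivative is not needed.
  have hρlim : Tendsto (fun m => ∫ a, (ρ m a).toReal ∂μ) atTop (𝓝 (∫ _, (0 : ℝ) ∂μ)) := by
    refine tendsto_integral_of_dominated_convergence (fun a => 2 * L a)
      (fun m => (hρm m).ennreal_toReal.aestronglyMeasurable) (hL.const_mul 2) hρnorm ?_
    filter_upwards [hρle, hdiff] with a h1 h2
    rw [Metric.tendsto_atTop]
    intro e he
    have h3 := h2.hasFDerivAt.isLittleO.def (half_pos he)
    obtain ⟨δ, hδ, h4⟩ := Metric.eventually_nhds_iff_ball.1 h3
    obtain ⟨m₀, hm₀⟩ := eventually_atTop.1 (htlim.eventually (gt_mem_nhds hδ))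
    refine ⟨m₀, fun m hm => ?_⟩
    have h5 : (ρ m a).toReal ≤ e / 2 := by
      refine ENNReal.toReal_le_of_le_ofReal (by positivity) (h1 m _ fun y hy => ?_)
      exact h4 y (Metric.ball_subset_ball (hm₀ m hm).le hy.1)
    rw [Real.dist_eq, sub_zero, abs_of_nonneg ENNReal.toReal_nonneg]
    linarith
  rw [integral_zero] at hρlim
  obtain ⟨m, hm⟩ := (hρlim.eventually (gt_mem_nhds (half_pos hε))).exists
  have hremρ : ∀ᵐ a ∂μ, ∀ y ∈ Metric.ball y₀ (t m), ‖rem a y‖ ≤ (ρ m a).toReal * ‖y - y₀‖ := by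
    filter_upwards [hρtop, hlip] with a h1 h2 y hy
    rcases eq_or_ne y y₀ with rfl | hne
    · simp [rem]
    have hyU : y ∈ U m := ⟨hy, hne⟩
    have hcl : y ∈ closure (U m ∩ Set.range s) :=
      (TopologicalSpace.denseRange_denseSeq _).open_subset_closure_inter (hUo m) hyU
    have hcf : ContinuousOn (f a) (Metric.ball y₀ δ₀) := by
      refine LipschitzOnWith.continuousOn (K := (L a).toNNReal)
        (LipschitzOnWith.of_dist_le_mul fun y hy y' hy' => ?_)
      rw [dist_eq_norm, dist_eq_norm, Real.coe_toNNReal _ h2.1]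
      exact h2.2 y hy y' hy'
    have hcr : ContinuousWithinAt (fun y => ‖rem a y‖) (U m ∩ Set.range s) y := by
      have : ContinuousWithinAt (f a) (U m ∩ Set.range s) y :=
        (hcf y (hUball m hyU)).mono (Set.inter_subset_left.trans (hUball m))
      exact ((this.sub continuousWithinAt_const).sub
        ((T a).continuous.comp (continuous_id.sub continuous_const)).continuousWithinAt).norm
    refine ContinuousWithinAt.closure_le hcl hcr (g := fun y => (ρ m a).toReal * ‖y - y₀‖)
      (by fun_prop) ?_
    rintro _ ⟨hk, k, rfl⟩
    rw [← div_le_iff₀ (norm_pos_iff.2 (sub_ne_zero.2 hk.2)),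
      ← ENNReal.ofReal_le_iff_le_toReal (h1 m)]
    exact le_iSup₂ (f := fun k (_ : s k ∈ U m) =>
      ENNReal.ofReal (‖rem a (s k)‖ / ‖s k - y₀‖)) k hk
  refine ⟨t m, ht0 m, ?_⟩
  have hT1 := tendsto_iff_norm_sub_tendsto_zero.1 (hs.lln_finiteDimensional hTint)
  filter_upwards [hs.ae _ hremρ, (hs.lln _ (hρint m)).eventually (gt_mem_nhds hm),
    hT1.eventually (gt_mem_nhds (half_pos hε))] with p hp1 hp2 hp3 y hy
  have e1 : avg (x p) (fun a => f a y) - avg (x p) (fun a => f a y₀) -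
      (∫ a, T a ∂μ) (y - y₀) =
      avg (x p) (fun a => rem a y) + (avg (x p) T - ∫ a, T a ∂μ) (y - y₀) := by
    have h1 : avg (x p) (fun a => T a (y - y₀)) = (avg (x p) T) (y - y₀) :=
      avg_clm (x p) (ContinuousLinearMap.apply ℝ F (y - y₀)) T
    simp only [rem]
    rw [avg_sub, avg_sub, h1, sub_apply]
    abel
  rw [e1]
  have h2 : ‖avg (x p) (fun a => rem a y)‖ ≤ ε / 2 * ‖y - y₀‖ := by
    calc _ ≤ avg (x p) (fun a => ‖rem a y‖) := norm_avg_le _ _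
      _ ≤ avg (x p) (fun a => ‖y - y₀‖ * (ρ m a).toReal) :=
        avg_mono _ fun i => (hp1 i y hy).trans_eq (mul_comm _ _)
      _ = ‖y - y₀‖ * avg (x p) (fun a => (ρ m a).toReal) := avg_mul _ _ _
      _ ≤ ‖y - y₀‖ * (ε / 2) := by gcongr
      _ = _ := mul_comm _ _
  have h3 : ‖(avg (x p) T - ∫ a, T a ∂μ) (y - y₀)‖ ≤ ε / 2 * ‖y - y₀‖ :=
    ContinuousLinearMap.le_of_opNorm_le _ hp3.le _
  calc _ ≤ _ := norm_add_le _ _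
    _ ≤ ε / 2 * ‖y - y₀‖ + ε / 2 * ‖y - y₀‖ := add_le_add h2 h3
    _ = _ := by ring

end Linearization

end Lipschitz

/-! ### The moment function near the pseudo-true parameter -/

section Blocks

variable {Ng Nt : ℕ}

/-- The block `τ` as a continuous linear map. -/
noncomputable def tauL : B Ng Nt →L[ℝ] ℝ := EuclideanSpace.proj (Sum.inl ())

/-- The block `κ` as a continuous linear map. -/
noncomputable def kapL : B Ng Nt →L[ℝ] E Ng := LinearMap.toContinuousLinearMap
  { toFun := kapOf, map_add' := fun _ _ => rfl, map_smul' := fun _ _ => rfl }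

/-- The block `λ` as a continuous linear map. -/
noncomputable def lamL : B Ng Nt →L[ℝ] E Ng := LinearMap.toContinuousLinearMap
  { toFun := lamOf, map_add' := fun _ _ => rfl, map_smul' := fun _ _ => rfl }

/-- The block `θ` as a continuous linear map. -/
noncomputable def thL : B Ng Nt →L[ℝ] E Nt := LinearMap.toContinuousLinearMap
  { toFun := thOf, map_add' := fun _ _ => rfl, map_smul' := fun _ _ => rfl }

@[simp] theorem tauOf_mkB (t : ℝ) (k l : E Ng) (θ : E Nt) : tauOf (mkB t k l θ) = t := rfl
@[simp] theorem kapOf_mkB (t : ℝ) (k l : E Ng) (θ : E Nt) : kapOf (mkB t k l θ) = k := rfl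
@[simp] theorem lamOf_mkB (t : ℝ) (k l : E Ng) (θ : E Nt) : lamOf (mkB t k l θ) = l := rfl
@[simp] theorem thOf_mkB (t : ℝ) (k l : E Ng) (θ : E Nt) : thOf (mkB t k l θ) = θ := rfl

theorem norm_sq_eq_blocks (β : B Ng Nt) :
    ‖β‖ ^ 2 = tauOf β ^ 2 + ‖kapOf β‖ ^ 2 + ‖lamOf β‖ ^ 2 + ‖thOf β‖ ^ 2 := by
  simp only [EuclideanSpace.norm_sq_eq, Fintype.sum_sum_type, Real.norm_eq_abs, sq_abs, kapOf,
    lamOf, thOf, tauOf, Finset.univ_unique, Finset.sum_singleton]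
  simp [add_assoc]

theorem norm_lamOf_sub_le (β β' : B Ng Nt) : ‖lamOf β - lamOf β'‖ ≤ ‖β - β'‖ := by
  have h := norm_sq_eq_blocks (β - β')
  have h' : lamOf (β - β') = lamOf β - lamOf β' := rfl
  rw [← h']
  refine le_of_sq_le_sq ?_ (norm_nonneg _)
  nlinarith [sq_nonneg (tauOf (β - β')), sq_nonneg ‖kapOf (β - β')‖, sq_nonneg ‖thOf (β - β')‖]

theorem norm_thOf_sub_le (β β' : B Ng Nt) : ‖thOf β - thOf β'‖ ≤ ‖β - β'‖ := by
  have h := norm_sq_eq_blocks (β - β')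
  have h' : thOf (β - β') = thOf β - thOf β' := rfl
  rw [← h']
  refine le_of_sq_le_sq ?_ (norm_nonneg _)
  nlinarith [sq_nonneg (tauOf (β - β')), sq_nonneg ‖kapOf (β - β')‖, sq_nonneg ‖lamOf (β - β')‖]

theorem norm_sub_le_blocks (β β' : B Ng Nt) : ‖β - β'‖ ≤ |tauOf β - tauOf β'| +
    ‖kapOf β - kapOf β'‖ + ‖lamOf β - lamOf β'‖ + ‖thOf β - thOf β'‖ := by
  have h := norm_sq_eq_blocks (β - β')
  refine le_of_sq_le_sq ?_ (by positivity)
  rw [h]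
  change (tauOf β - tauOf β') ^ 2 + ‖kapOf β - kapOf β'‖ ^ 2 + ‖lamOf β - lamOf β'‖ ^ 2 +
    ‖thOf β - thOf β'‖ ^ 2 ≤ _
  rw [← sq_abs (tauOf β - tauOf β')]
  have h1 := abs_nonneg (tauOf β - tauOf β')
  have h2 := norm_nonneg (kapOf β - kapOf β')
  have h3 := norm_nonneg (lamOf β - lamOf β')
  have h4 := norm_nonneg (thOf β - thOf β')
  nlinarith [mul_nonneg h1 h2, mul_nonneg h1 h3, mul_nonneg h1 h4, mul_nonneg h2 h3,
    mul_nonneg h2 h4, mul_nonneg h3 h4]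

end Blocks

theorem LipGraded.of_clm {𝒳 Y F : Type*} [NormedAddCommGroup Y] [NormedSpace ℝ Y]
    [NormedAddCommGroup F] [NormedSpace ℝ F] {S : Set 𝒳} {c : 𝒳 → ℝ} (hc : ∀ a ∈ S, 1 ≤ c a)
    (y₀ : Y) {δ : ℝ} (hδ : 0 < δ) (L : Y →L[ℝ] F) :
    LipGraded S (Metric.ball y₀ δ) c (fun _ => 1) fun _ y => L y := by
  refine ⟨‖L‖ * (‖y₀‖ + δ + 1), by positivity, fun a ha => ⟨fun y hy => ?_, fun y hy y' hy' => ?_⟩⟩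
  · rw [mul_one]
    refine L.le_opNorm_of_le ?_
    have h1 : ‖y - y₀‖ < δ := mem_ball_iff_norm.1 hy
    have h2 : ‖y‖ ≤ ‖y₀‖ + ‖y - y₀‖ := by
      simpa using norm_add_le y₀ (y - y₀)
    linarith
  · rw [← map_sub]
    have h1 := hc a ha
    have h2 : 0 ≤ ‖y₀‖ := norm_nonneg _
    calc ‖L (y - y')‖ ≤ ‖L‖ * 1 * (1 * 1) * ‖y - y'‖ := by
          simpa using L.le_opNorm (y - y')
      _ ≤ ‖L‖ * (‖y₀‖ + δ + 1) * (1 * c a) * ‖y - y'‖ := by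
          gcongr
          linarith

/-! ### Bounds and Lipschitz constants of the moment function at regular observations. -/

section Local

variable {𝒳 : Type*} {Ng Nt : ℕ} {g : 𝒳 → E Nt → E Ng}

/-- The observation `a` is regular near `(l₀, θ₀)`, with bounds `v a` of the tilting factor and
`b a` of `g` and its derivatives. -/
structure RegularPoint (g : 𝒳 → E Nt → E Ng) (v b : 𝒳 → ℝ) (l₀ : E Ng) (θ₀ : E Nt) (δ : ℝ)
    (a : 𝒳) : Prop where
  v_nonneg : 0 ≤ v a
  b_nonneg : 0 ≤ b a
  tilt_le : ∀ θ ∈ Metric.ball θ₀ δ, ∀ l ∈ Metric.ball l₀ δ, tilt g a θ l ≤ v a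
  contDiff : ContDiffOn ℝ 2 (g a) (Metric.ball θ₀ δ)
  bound_g : ∀ θ ∈ Metric.ball θ₀ δ, ‖g a θ‖ ≤ b a
  bound_G : ∀ θ ∈ Metric.ball θ₀ δ, ‖fderiv ℝ (g a) θ‖ ≤ b a
  bound_S : ∀ θ ∈ Metric.ball θ₀ δ, ∀ j l : Fin Nt, ‖Spart g a θ j l‖ ≤ b a

variable {v b : 𝒳 → ℝ} {β₀ : B Ng Nt} {δ : ℝ}

theorem th_mem_ball {β : B Ng Nt} (h : β ∈ Metric.ball β₀ δ) :
    thOf β ∈ Metric.ball (thOf β₀) δ := by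
  rw [mem_ball_iff_norm] at h ⊢
  exact (norm_thOf_sub_le _ _).trans_lt h

theorem lam_mem_ball {β : B Ng Nt} (h : β ∈ Metric.ball β₀ δ) :
    lamOf β ∈ Metric.ball (lamOf β₀) δ := by
  rw [mem_ball_iff_norm] at h ⊢
  exact (norm_lamOf_sub_le _ _).trans_lt h

namespace RegularPoint

variable {l₀ : E Ng} {θ₀ : E Nt} {a : 𝒳}

theorem contDiffAt (h : RegularPoint g v b l₀ θ₀ δ a) {θ : E Nt} (hθ : θ ∈ Metric.ball θ₀ δ) :
    ContDiffAt ℝ 2 (g a) θ :=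
  h.contDiff.contDiffAt (Metric.isOpen_ball.mem_nhds hθ)

theorem differentiableAt_g (h : RegularPoint g v b l₀ θ₀ δ a) {θ : E Nt}
    (hθ : θ ∈ Metric.ball θ₀ δ) : DifferentiableAt ℝ (g a) θ :=
  (h.contDiffAt hθ).differentiableAt (by norm_num)

theorem differentiableAt_Gcol (h : RegularPoint g v b l₀ θ₀ δ a) {θ : E Nt}
    (hθ : θ ∈ Metric.ball θ₀ δ) (j : Fin Nt) : DifferentiableAt ℝ (fun θ => Gcol g a θ j) θ := by
  have h1 : ContDiffAt ℝ 1 (fderiv ℝ (g a)) θ := (h.contDiffAt hθ).fderiv_right (by norm_num)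
  exact (h1.differentiableAt (by norm_num)).clm_apply (differentiableAt_const _)

theorem norm_g_sub_le (h : RegularPoint g v b l₀ θ₀ δ a) {θ θ' : E Nt}
    (hθ : θ ∈ Metric.ball θ₀ δ) (hθ' : θ' ∈ Metric.ball θ₀ δ) :
    ‖g a θ - g a θ'‖ ≤ b a * ‖θ - θ'‖ :=
  (convex_ball θ₀ δ).norm_image_sub_le_of_norm_fderiv_le
    (fun _ hz => h.differentiableAt_g hz) h.bound_G hθ' hθ

theorem norm_Gcol_le (h : RegularPoint g v b l₀ θ₀ δ a) {θ : E Nt}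
    (hθ : θ ∈ Metric.ball θ₀ δ) (j : Fin Nt) : ‖Gcol g a θ j‖ ≤ b a := by
  simpa [Gcol] using (fderiv ℝ (g a) θ).le_of_opNorm_le (h.bound_G θ hθ) (EuclideanSpace.single j 1)

/-- The factor `Nt` arises from bounding the norm of the derivative of a column by the sum of its
`Nt` partial derivatives. -/
theorem norm_Gcol_sub_le (h : RegularPoint g v b l₀ θ₀ δ a) {θ θ' : E Nt}
    (hθ : θ ∈ Metric.ball θ₀ δ) (hθ' : θ' ∈ Metric.ball θ₀ δ) (j : Fin Nt) :
    ‖Gcol g a θ j - Gcol g a θ' j‖ ≤ Nt * b a * ‖θ - θ'‖ := by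
  refine (convex_ball θ₀ δ).norm_image_sub_le_of_norm_fderiv_le (f := fun θ => Gcol g a θ j)
    (fun _ hz => h.differentiableAt_Gcol hz j) (fun z hz => ?_) hθ' hθ
  refine ContinuousLinearMap.opNorm_le_bound _ (mul_nonneg (Nat.cast_nonneg _) h.b_nonneg)
    fun w => ?_
  conv_lhs => rw [clm_eq_sum_smulRight (fderiv ℝ (fun θ => Gcol g a θ j) z)]
  simp only [sum_apply, ContinuousLinearMap.smulRight_apply]
  calc _ ≤ ∑ i : Fin Nt, ‖(EuclideanSpace.proj (𝕜 := ℝ) i : E Nt →L[ℝ] ℝ) w •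
        (fderiv ℝ (fun θ => Gcol g a θ j) z) (EuclideanSpace.single i 1)‖ := norm_sum_le _ _
    _ ≤ ∑ i : Fin Nt, ‖w‖ * b a := by
        refine Finset.sum_le_sum fun i _ => ?_
        rw [norm_smul]
        have h1 : ‖(EuclideanSpace.proj (𝕜 := ℝ) i : E Nt →L[ℝ] ℝ) w‖ ≤ ‖w‖ :=
          PiLp.norm_apply_le w i
        have h2 := h.bound_S z hz i j
        unfold Spart at h2
        gcongr
    _ = Nt * b a * ‖w‖ := by simp; ring

theorem abs_tilt_sub_le (h : RegularPoint g v b l₀ θ₀ δ a) {θ θ' : E Nt} {l l' : E Ng}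
    (hθ : θ ∈ Metric.ball θ₀ δ) (hθ' : θ' ∈ Metric.ball θ₀ δ) (hl : l ∈ Metric.ball l₀ δ)
    (hl' : l' ∈ Metric.ball l₀ δ) : |tilt g a θ l - tilt g a θ' l'| ≤
      v a * (b a * ‖l - l'‖ + (‖l₀‖ + δ) * (b a * ‖θ - θ'‖)) := by
  set p := inner ℝ l (g a θ) with hp
  set q := inner ℝ l' (g a θ') with hq
  -- The tangents at both ends bound the difference in either direction, with slopes at most `v a`.
  have h1 : |Real.exp p - Real.exp q| ≤ v a * |p - q| := by
    have hep : Real.exp p ≤ v a := h.tilt_le θ hθ l hl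
    have heq : Real.exp q ≤ v a := h.tilt_le θ' hθ' l' hl'
    have h2 : Real.exp p * (q - p + 1) ≤ Real.exp q := by
      have := Real.add_one_le_exp (q - p)
      calc _ ≤ Real.exp p * Real.exp (q - p) := by gcongr
        _ = Real.exp q := by rw [← Real.exp_add]; ring_nf
    have h3 : Real.exp q * (p - q + 1) ≤ Real.exp p := by
      have := Real.add_one_le_exp (p - q)
      calc _ ≤ Real.exp q * Real.exp (p - q) := by gcongr
        _ = Real.exp p := by rw [← Real.exp_add]; ring_nf
    have h4 : Real.exp p * (p - q) ≤ v a * |p - q| :=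
      (mul_le_mul_of_nonneg_left (le_abs_self _) (Real.exp_pos _).le).trans
        (mul_le_mul_of_nonneg_right hep (abs_nonneg _))
    have h5 : Real.exp q * (q - p) ≤ v a * |p - q| := by
      rw [abs_sub_comm]
      exact (mul_le_mul_of_nonneg_left (le_abs_self _) (Real.exp_pos _).le).trans
        (mul_le_mul_of_nonneg_right heq (abs_nonneg _))
    rw [abs_le]
    constructor <;> nlinarith
  refine h1.trans (mul_le_mul_of_nonneg_left ?_ h.v_nonneg)
  have e : p - q = inner ℝ (l - l') (g a θ) + inner ℝ l' (g a θ - g a θ') := by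
    rw [hp, hq, inner_sub_left, inner_sub_right]; ring
  have hl'n : ‖l'‖ ≤ ‖l₀‖ + δ := by
    have h2 : ‖l' - l₀‖ < δ := mem_ball_iff_norm.1 hl'
    have h3 : ‖l'‖ ≤ ‖l₀‖ + ‖l' - l₀‖ := by simpa using norm_add_le l₀ (l' - l₀)
    linarith
  rw [e]
  refine (abs_add_le _ _).trans (add_le_add ?_ ?_)
  · refine (abs_real_inner_le_norm _ _).trans ?_
    rw [mul_comm]
    exact mul_le_mul_of_nonneg_right (h.bound_g θ hθ) (norm_nonneg _)
  · refine (abs_real_inner_le_norm _ _).trans ?_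
    have h2 := h.norm_g_sub_le hθ hθ'
    exact mul_le_mul hl'n h2 (norm_nonneg _) ((norm_nonneg _).trans hl'n)

end RegularPoint

variable (g v b β₀ δ) in
/-- The regular observations near `β₀`. -/
def regularPoints : Set 𝒳 := {a | RegularPoint g v b (lamOf β₀) (thOf β₀) δ a}

theorem lipGraded_tilt (hδ : 0 < δ) :
    LipGraded (regularPoints g v b β₀ δ) (Metric.ball β₀ δ) (fun a => 1 + b a) (fun a => 1 + v a)
      fun a β => tilt g a (thOf β) (lamOf β) := by
  refine ⟨1 + (‖lamOf β₀‖ + δ), by positivity, fun a ha => ⟨fun β hβ => ?_, fun β hβ β' hβ' => ?_⟩⟩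
  · rw [Real.norm_of_nonneg (tilt_pos _ _ _).le]
    have h1 := ha.tilt_le _ (th_mem_ball hβ) _ (lam_mem_ball hβ)
    have h2 := ha.v_nonneg
    have h3 : 0 ≤ ‖lamOf β₀‖ + δ := by positivity
    nlinarith
  · have h1 := ha.abs_tilt_sub_le (th_mem_ball hβ) (th_mem_ball hβ') (lam_mem_ball hβ)
      (lam_mem_ball hβ')
    have hv := ha.v_nonneg
    have hb := ha.b_nonneg
    calc _ ≤ _ := h1
      _ ≤ (1 + v a) * ((1 + b a) * ‖β - β'‖ + (‖lamOf β₀‖ + δ) * ((1 + b a) * ‖β - β'‖)) := by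
        have h2 := norm_thOf_sub_le β β'
        have h3 := norm_lamOf_sub_le β β'
        gcongr <;> linarith
      _ = _ := by ring

theorem lipGraded_g :
    LipGraded (regularPoints g v b β₀ δ) (Metric.ball β₀ δ) (fun a => 1 + b a) (fun a => 1 + b a)
      fun a β => g a (thOf β) := by
  refine ⟨1, zero_le_one, fun a ha => ⟨fun β hβ => ?_, fun β hβ β' hβ' => ?_⟩⟩
  · linarith [ha.bound_g _ (th_mem_ball hβ)]
  · have hb := ha.b_nonneg
    calc _ ≤ _ := ha.norm_g_sub_le (th_mem_ball hβ) (th_mem_ball hβ')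
      _ ≤ 1 * ((1 + b a) * (1 + b a)) * ‖β - β'‖ := by
        have h2 := norm_thOf_sub_le β β'
        gcongr
        nlinarith

theorem lipGraded_Gcol (j : Fin Nt) :
    LipGraded (regularPoints g v b β₀ δ) (Metric.ball β₀ δ) (fun a => 1 + b a) (fun a => 1 + b a)
      fun a β => Gcol g a (thOf β) j := by
  refine ⟨1 + Nt, by positivity, fun a ha => ⟨fun β hβ => ?_, fun β hβ β' hβ' => ?_⟩⟩
  · have hb := ha.b_nonneg
    have h1 := ha.norm_Gcol_le (th_mem_ball hβ) j
    have h2 : (0 : ℝ) ≤ Nt := Nat.cast_nonneg _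
    nlinarith
  · have hb := ha.b_nonneg
    calc _ ≤ _ := ha.norm_Gcol_sub_le (th_mem_ball hβ) (th_mem_ball hβ') j
      _ ≤ (1 + Nt) * ((1 + b a) * (1 + b a)) * ‖β - β'‖ := by
        have h2 := norm_thOf_sub_le β β'
        gcongr
        · linarith
        · nlinarith

/-- The tilted second moment `exp(λ' g) g g'` as an operator. -/
noncomputable def tiltedGram (g : 𝒳 → E Nt → E Ng) (a : 𝒳) (θ : E Nt) (l : E Ng) :
    E Ng →L[ℝ] E Ng :=
  tilt g a θ l • (innerSL ℝ (g a θ)).smulRight (g a θ)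

theorem tiltedGram_apply (a : 𝒳) (θ : E Nt) (l k : E Ng) :
    tiltedGram g a θ l k = (tilt g a θ l * inner ℝ (g a θ) k) • g a θ := by
  simp [tiltedGram, smul_smul]

theorem lipGraded_tiltedGram (hδ : 0 < δ) :
    LipGraded (regularPoints g v b β₀ δ) (Metric.ball β₀ δ) (fun a => 1 + b a)
      (fun a => (1 + v a) * (1 + b a) ^ 2) fun a β => tiltedGram g a (thOf β) (lamOf β) := by
  have hv : ∀ a ∈ regularPoints g v b β₀ δ, 0 ≤ 1 + v a := fun a ha => by linarith [ha.v_nonneg]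
  have hb : ∀ a ∈ regularPoints g v b β₀ δ, 0 ≤ 1 + b a := fun a ha => by linarith [ha.b_nonneg]
  have h1 := lipGraded_g (g := g) (v := v) (b := b) (β₀ := β₀) (δ := δ)
  have h2 := (h1.clm (innerSL ℝ)).bilin h1 (ContinuousLinearMap.smulRightL ℝ (E Ng) (E Ng)) hb hb
  have h3 := (lipGraded_tilt (g := g) (v := v) (b := b) (β₀ := β₀) hδ).smul h2 hv
    fun a ha => mul_nonneg (hb a ha) (hb a ha)
  exact h3.mono hb fun a ha => by rw [pow_two]

/-- Each term of `φ` has at most one tilting factor and two factors among `g` and the columns of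
`G`; the parameter blocks are bounded on the ball and cost nothing. -/
theorem lipGraded_phi (hδ : 0 < δ) :
    LipGraded (regularPoints g v b β₀ δ) (Metric.ball β₀ δ) (fun a => 1 + b a)
      (fun a => (1 + v a) * (1 + b a) ^ 2) (phi g) := by
  have hv : ∀ a ∈ regularPoints g v b β₀ δ, 0 ≤ 1 + v a := fun a ha => by linarith [ha.v_nonneg]
  have hb : ∀ a ∈ regularPoints g v b β₀ δ, 0 ≤ 1 + b a := fun a ha => by linarith [ha.b_nonneg]
  have hv1 : ∀ a ∈ regularPoints g v b β₀ δ, 1 ≤ 1 + v a := fun a ha => by linarith [ha.v_nonneg]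
  have hb1 : ∀ a ∈ regularPoints g v b β₀ δ, 1 ≤ 1 + b a := fun a ha => by linarith [ha.b_nonneg]
  have h01 : ∀ a ∈ regularPoints g v b β₀ δ, (0 : ℝ) ≤ 1 := fun _ _ => zero_le_one
  have hb' : ∀ a ∈ regularPoints g v b β₀ δ, 0 ≤ (1 + b a) * 1 := fun a ha => by
    rw [mul_one]; exact hb a ha
  have ht := LipGraded.of_clm hb1 β₀ hδ tauL
  have hk := LipGraded.of_clm hb1 β₀ hδ kapL
  have hl := LipGraded.of_clm hb1 β₀ hδ lamL
  have hx := lipGraded_tilt (g := g) (v := v) (b := b) (β₀ := β₀) hδ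
  have hg := lipGraded_g (g := g) (v := v) (b := b) (β₀ := β₀) (δ := δ)
  have hG := fun j => lipGraded_Gcol (g := g) (v := v) (b := b) (β₀ := β₀) (δ := δ) j
  have htv := ht.mono (W' := fun a => 1 + v a) hb hv1
  have hgk := hg.inner hk hb h01
  refine LipGraded.euclidean fun i => ?_
  have e1 : ∀ a ∈ regularPoints g v b β₀ δ, 1 + v a ≤ (1 + v a) * (1 + b a) ^ 2 := fun a ha => by
    exact le_mul_of_one_le_right (hv a ha) (one_le_pow₀ (hb1 a ha))
  have e2 : ∀ a ∈ regularPoints g v b β₀ δ,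
      (1 + v a) * (1 + b a) ≤ (1 + v a) * (1 + b a) ^ 2 := fun a ha => by
    have := hb1 a ha
    have := hv a ha
    gcongr
    exact le_self_pow₀ (hb1 a ha) two_ne_zero
  have e3 : ∀ a ∈ regularPoints g v b β₀ δ,
      (1 + v a) * ((1 + b a) * 1) ≤ (1 + v a) * (1 + b a) ^ 2 := fun a ha => by
    rw [mul_one]; exact e2 a ha
  have e4 : ∀ a ∈ regularPoints g v b β₀ δ,
      (1 + v a) * ((1 + b a) * 1) * (1 + b a) ≤ (1 + v a) * (1 + b a) ^ 2 := fun a ha => by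
    apply le_of_eq; ring
  rcases i with u | i | i | j
  · exact (hx.sub htv).mono hb e1
  · exact ((hx.smul hg hv hb).clm (EuclideanSpace.proj i)).mono hb e2
  · have h1 := ((htv.sub hx).smul hg hv hb).mono hb e2
    have h2 := ((hx.mul hgk hv hb').smul hg
      (fun a ha => mul_nonneg (hv a ha) (hb' a ha)) hb).mono hb e4
    exact (h1.add h2).clm (EuclideanSpace.proj i)
  · have hGk := (hG j).inner hk hb h01
    have hGl := (hG j).inner hl hb h01
    have h1 := (hx.mul hGk hv hb').mono hb e3
    have h2 := ((hx.mul hGl hv hb').mul hgk (fun a ha => mul_nonneg (hv a ha) (hb' a ha))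
      hb').mono (W' := fun a => (1 + v a) * (1 + b a) ^ 2) hb
      (fun a ha => by apply le_of_eq; ring)
    have h3 := (hx.mul hGl hv hb').mono hb e3
    have h4 := (htv.mul hGl hv hb').mono hb e3
    exact ((h1.add h2).sub h3).add h4

theorem differentiableAt_phi {a : 𝒳} (ha : a ∈ regularPoints g v b β₀ δ) {β : B Ng Nt}
    (hβ : β ∈ Metric.ball β₀ δ) : DifferentiableAt ℝ (phi g a) β := by
  have ht : DifferentiableAt ℝ (fun β : B Ng Nt => tauOf β) β := tauL.differentiableAt
  have hk : DifferentiableAt ℝ (fun β : B Ng Nt => kapOf β) β := kapL.differentiableAt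
  have hl : DifferentiableAt ℝ (fun β : B Ng Nt => lamOf β) β := lamL.differentiableAt
  have hth : DifferentiableAt ℝ (fun β : B Ng Nt => thOf β) β := thL.differentiableAt
  have hg : DifferentiableAt ℝ (fun β : B Ng Nt => g a (thOf β)) β :=
    (ha.differentiableAt_g (th_mem_ball hβ)).comp β hth
  have hG : ∀ j, DifferentiableAt ℝ (fun β : B Ng Nt => Gcol g a (thOf β) j) β := fun j =>
    DifferentiableAt.comp (g := fun θ => Gcol g a θ j) β
      (ha.differentiableAt_Gcol (th_mem_ball hβ) j) hth
  have hx : DifferentiableAt ℝ (fun β : B Ng Nt => tilt g a (thOf β) (lamOf β)) β :=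
    (hl.inner ℝ hg).exp
  rw [differentiableAt_euclidean]
  have hgi : ∀ i, DifferentiableAt ℝ (fun β : B Ng Nt => g a (thOf β) i) β :=
    fun i => differentiableAt_euclidean.1 hg i
  rintro (u | i | i | j)
  · exact hx.sub ht
  · exact hx.mul (hgi i)
  · exact ((ht.sub hx).mul (hgi i)).add ((hx.mul (hg.inner ℝ hk)).mul (hgi i))
  · exact (((hx.mul ((hG j).inner ℝ hk)).add ((hx.mul ((hG j).inner ℝ hl)).mul
      (hg.inner ℝ hk))).sub (hx.mul ((hG j).inner ℝ hl))).add (ht.mul ((hG j).inner ℝ hl))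

variable [MeasurableSpace 𝒳] {μ : Measure 𝒳}

theorem aestronglyMeasurable_phi (hδ : 0 < δ) (hgm : Measurable (Function.uncurry g))
    (hreg : ∀ᵐ a ∂μ, a ∈ regularPoints g v b β₀ δ) {β : B Ng Nt} (hβ : β ∈ Metric.ball β₀ δ) :
    AEStronglyMeasurable (fun a => phi g a β) μ := by
  have hg : ∀ θ, Measurable fun a => g a θ := fun θ =>
    hgm.comp (measurable_id.prodMk measurable_const)
  have hx : AEMeasurable (fun a => tilt g a (thOf β) (lamOf β)) μ :=
    (Real.measurable_exp.comp (measurable_const.inner (hg _))).aemeasurable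
  have hG : ∀ j, AEMeasurable (fun a => Gcol g a (thOf β) j) μ := by
    intro j
    have h1 : AEStronglyMeasurable (fun a => fderiv ℝ (g a) (thOf β)) μ := by
      refine aestronglyMeasurable_fderiv hδ (fun y _ => (hg y).aestronglyMeasurable) ?_
      filter_upwards [hreg] with a ha
      exact ha.differentiableAt_g (th_mem_ball hβ)
    exact (h1.apply_continuousLinearMap _).aemeasurable
  have hgi : ∀ i, AEMeasurable (fun a => g a (thOf β) i) μ := fun i =>
    ((EuclideanSpace.proj (𝕜 := ℝ) i).continuous.measurable.comp (hg _)).aemeasurable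
  have hgk : AEMeasurable (fun a => inner ℝ (g a (thOf β)) (kapOf β)) μ :=
    ((hg _).inner measurable_const).aemeasurable
  have hGk : ∀ j, AEMeasurable (fun a => inner ℝ (Gcol g a (thOf β) j) (kapOf β)) μ := fun j =>
    (hG j).inner aemeasurable_const
  have hGl : ∀ j, AEMeasurable (fun a => inner ℝ (Gcol g a (thOf β) j) (lamOf β)) μ := fun j =>
    (hG j).inner aemeasurable_const
  refine AEMeasurable.aestronglyMeasurable ?_
  refine (WithLp.measurable_toLp 2 _).comp_aemeasurable (aemeasurable_pi_iff.2 ?_)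
  rintro (u | i | i | j)
  · exact hx.sub aemeasurable_const
  · exact hx.mul (hgi i)
  · exact ((aemeasurable_const.sub hx).mul (hgi i)).add ((hx.mul hgk).mul (hgi i))
  · exact (((hx.mul (hGk j)).add ((hx.mul (hGl j)).mul hgk)).sub (hx.mul (hGl j))).add
      (aemeasurable_const.mul (hGl j))

end Local

/-! ### Integrable bounds near the pseudo-true parameter. -/

section Envelope

variable {𝒳 : Type*} [MeasurableSpace 𝒳] {Ng Nt : ℕ} {g : 𝒳 → E Nt → E Ng} {μ : Measure 𝒳}
  {Θ : Set (E Nt)} {lamS : E Nt → E Ng} {θs : E Nt} {Λ : E Nt → Set (E Ng)} {N : Set (E Nt)}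
  {b v : 𝒳 → ℝ} {β₀ : B Ng Nt} {δ : ℝ}

/-- The map `t ↦ tᵏc` is monotone and continuous, so it commutes with the supremum. The index set
must be nonempty because of the case `k = 0`. -/
theorem iSup_pow_mul_le {ι : Type*} [Nonempty ι] {f : ι → ℝ≥0∞} {k : ℕ} {c S : ℝ≥0∞} (hc : c ≠ ∞)
    (h : ∀ i, f i ^ k * c ≤ S) : (⨆ i, f i) ^ k * c ≤ S := by
  have hmono : Monotone fun t : ℝ≥0∞ => t ^ k * c := fun s t hst => by
    change s ^ k * c ≤ t ^ k * c
    gcongr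
  have hcont : Continuous fun t : ℝ≥0∞ => t ^ k * c :=
    (ENNReal.continuous_mul_const hc).comp (ENNReal.continuous_pow k)
  have := Monotone.map_ciSup_of_continuousAt (f := fun t : ℝ≥0∞ => t ^ k * c) (g := f)
    hcont.continuousAt hmono
  rw [this]
  exact iSup_le h

/-- Almost all observations are regular near the pseudo-true parameter, with integrable bounds. -/
theorem Regularity.exists_regularPoints [StandardBorelSpace 𝒳] [IsFiniteMeasure μ]
    (hreg : Regularity μ g Θ lamS θs Λ N b) (hl : lamOf β₀ = lamS θs) (hθ : thOf β₀ = θs) :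
    ∃ δ > 0, Metric.ball θs δ ⊆ N ∧ ∃ v : 𝒳 → ℝ, AEMeasurable v μ ∧
      (∀ᵐ a ∂μ, a ∈ regularPoints g v b β₀ δ) ∧
      Integrable (fun a => (1 + v a) ^ 2 * (1 + b a) ^ 4) μ := by
  obtain ⟨r, hr, hball⟩ := hreg.interior_lam
  have hθs : θs ∈ Θ := interior_subset hreg.interior
  obtain ⟨δ₁, hδ₁, hcont⟩ := Metric.continuousWithinAt_iff.1 (hreg.continuousOn_lamS θs hθs) (r / 2)
    (by positivity)
  obtain ⟨δ₂, hδ₂, hN⟩ := Metric.isOpen_iff.1 hreg.isOpen_N θs hreg.mem_N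
  set δ := min (min δ₁ δ₂) (r / 2) with hδdef
  have hδ : 0 < δ := lt_min (lt_min hδ₁ hδ₂) (by positivity)
  have hδN : Metric.ball θs δ ⊆ N :=
    (Metric.ball_subset_ball ((min_le_left _ _).trans (min_le_right _ _))).trans hN
  -- `lamS θ` moves by less than `r / 2` and `l` by at most `δ ≤ r / 2`, so the ball about the fixed
  -- centre `lamS θs` stays in every `Λ θ`.
  have hΛ : ∀ θ ∈ Metric.ball θs δ, ∀ l ∈ Metric.closedBall (lamS θs) δ, l ∈ Λ θ := by
    intro θ hθ l hl
    refine hball θ (hreg.N_subset (hδN hθ)) ?_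
    rw [Metric.mem_closedBall] at hl ⊢
    have h1 := hcont (hreg.N_subset (hδN hθ))
      ((Metric.mem_ball.1 hθ).trans_le ((min_le_left _ _).trans (min_le_left _ _)))
    have h2 : δ ≤ r / 2 := min_le_right _ _
    rw [dist_comm] at h1
    linarith [dist_triangle l (lamS θs) (lamS θ)]
  -- The maximum of the tilting factor over the ball of radius `δ` in `λ`, in closed form; only the
  -- supremum over `θ` is left to take.
  let q : 𝒳 → E Nt → ℝ := fun a θ => Real.exp (inner ℝ (lamS θs) (g a θ) + δ * ‖g a θ‖)
  have hqm : Measurable (Function.uncurry q) := Real.measurable_exp.comp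
    ((measurable_const.inner hreg.measurable_g).add (hreg.measurable_g.norm.const_mul δ))
  let V : 𝒳 → ℝ≥0∞ := fun a => ⨆ θ ∈ Metric.ball θs δ, ENNReal.ofReal (q a θ)
  have hVm : AEMeasurable V μ := aemeasurable_biSup_param μ
    (h := fun a θ => ENNReal.ofReal (q a θ)) (ENNReal.measurable_ofReal.comp hqm) measurableSet_ball
  have hb0 : ∀ᵐ a ∂μ, 0 ≤ b a := by
    filter_upwards [hreg.bound_g] with a ha
    exact (norm_nonneg _).trans (ha θs hreg.mem_N)
  have hVle : ∀ᵐ a ∂μ, ∀ k₁ k₂ : ℕ, V a ^ k₁ * ENNReal.ofReal (b a ^ k₂) ≤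
      ⨆ θ ∈ N, ⨆ l ∈ Λ θ, ENNReal.ofReal (Real.exp (k₁ * inner ℝ l (g a θ)) * b a ^ k₂) := by
    filter_upwards [hb0] with a ha k₁ k₂
    have : Nonempty (Metric.ball θs δ) := ⟨⟨θs, Metric.mem_ball_self hδ⟩⟩
    simp only [V]
    rw [iSup_subtype']
    refine iSup_pow_mul_le ENNReal.ofReal_ne_top fun θ => ?_
    obtain ⟨l, hl, heq⟩ := exists_tilt_eq (g := g) a θ (lamS θs) hδ.le
    refine le_iSup₂_of_le θ.1 (hδN θ.2) (le_iSup₂_of_le l (hΛ _ θ.2 _ hl) ?_)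
    rw [← ENNReal.ofReal_pow (Real.exp_pos _).le, ← ENNReal.ofReal_mul (by positivity)]
    rw [← heq, tilt, ← Real.exp_nat_mul]
  have hVint : ∀ k₁ ≤ 2, ∀ k₂ ≤ 4, ∫⁻ a, V a ^ k₁ * ENNReal.ofReal (b a ^ k₂) ∂μ ≠ ∞ := by
    intro k₁ hk₁ k₂ hk₂
    refine ((lintegral_mono_ae ?_).trans_lt (hreg.bound_moment k₁ hk₁ k₂ hk₂)).ne
    filter_upwards [hVle] with a ha using ha k₁ k₂
  have hVtop : ∀ᵐ a ∂μ, V a < ∞ := by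
    have := hVint 1 (by norm_num) 0 (by norm_num)
    simp only [pow_one, pow_zero, ENNReal.ofReal_one, mul_one] at this
    exact ae_lt_top' hVm this
  have hint : ∀ k₁ ≤ 2, ∀ k₂ ≤ 4, Integrable (fun a => (V a).toReal ^ k₁ * b a ^ k₂) μ := by
    intro k₁ hk₁ k₂ hk₂
    have hm : AEMeasurable (fun a => V a ^ k₁ * ENNReal.ofReal (b a ^ k₂)) μ :=
      (hVm.pow_const _).mul (hreg.measurable_b.pow_const _).ennreal_ofReal.aemeasurable
    refine (integrable_toReal_of_lintegral_ne_top hm (hVint k₁ hk₁ k₂ hk₂)).congr ?_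
    filter_upwards [hb0] with a ha
    rw [ENNReal.toReal_mul, ENNReal.toReal_pow, ENNReal.toReal_ofReal (by positivity)]
  refine ⟨δ, hδ, hδN, fun a => (V a).toReal, hVm.ennreal_toReal, ?_, ?_⟩
  · filter_upwards [hVtop, hb0, hreg.contDiff_g, hreg.bound_g, hreg.bound_G, hreg.bound_S]
      with a h1 h2 h3 h4 h5 h6
    refine ⟨ENNReal.toReal_nonneg, h2, ?_, ?_, ?_, ?_, ?_⟩
    · rw [hl, hθ]
      intro θ hθ l hl
      rw [← ENNReal.ofReal_le_iff_le_toReal h1.ne]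
      refine le_iSup₂_of_le (f := fun θ (_ : θ ∈ Metric.ball θs δ) => ENNReal.ofReal (q a θ)) θ hθ
        (ENNReal.ofReal_le_ofReal (tilt_le_of_norm_sub_le ?_))
      exact (mem_ball_iff_norm.1 hl).le
    · rw [hθ]; exact h3.mono hδN
    · rw [hθ]; exact fun θ hθ => h4 θ (hδN hθ)
    · rw [hθ]; exact fun θ hθ => h5 θ (hδN hθ)
    · rw [hθ]; exact fun θ hθ => h6 θ (hδN hθ)
  -- The constant is `16 = 2 · 8`, from `(1+w)² ≤ 2(1+w²)` and `(1+b)⁴ ≤ 8(1+b⁴)`.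
  · have h1 := (((hint 0 (by norm_num) 0 (by norm_num)).add (hint 2 le_rfl 0 (by norm_num))).add
      ((hint 0 (by norm_num) 4 le_rfl).add (hint 2 le_rfl 4 le_rfl))).const_mul 16
    refine h1.mono' ?_ ?_
    · exact (((hVm.ennreal_toReal.const_add 1).pow_const 2).mul
        ((hreg.measurable_b.const_add 1).pow_const 4).aemeasurable).aestronglyMeasurable
    · filter_upwards [hb0] with a ha
      have hv : 0 ≤ (V a).toReal := ENNReal.toReal_nonneg
      set w := (V a).toReal
      have e1 : (1 + w) ^ 2 ≤ 2 * (1 + w ^ 2) := by nlinarith [sq_nonneg (1 - w)]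
      have e2 : (1 + b a) ^ 4 ≤ 8 * (1 + b a ^ 4) := by
        have h3 : (1 + b a) ^ 2 ≤ 2 * (1 + b a ^ 2) := by nlinarith [sq_nonneg (1 - b a)]
        have h4 : (1 + b a ^ 2) ^ 2 ≤ 2 * (1 + b a ^ 4) := by nlinarith [sq_nonneg (1 - b a ^ 2)]
        calc (1 + b a) ^ 4 = ((1 + b a) ^ 2) ^ 2 := by ring
          _ ≤ (2 * (1 + b a ^ 2)) ^ 2 := by gcongr
          _ = 4 * (1 + b a ^ 2) ^ 2 := by ring
          _ ≤ _ := by linarith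
      rw [Real.norm_of_nonneg (by positivity)]
      calc _ ≤ 2 * (1 + w ^ 2) * (8 * (1 + b a ^ 4)) := by gcongr
        _ = 16 * (w ^ 0 * b a ^ 0 + w ^ 2 * b a ^ 0 + (w ^ 0 * b a ^ 4 + w ^ 2 * b a ^ 4)) := by
          ring

/-- Both `(1+v)(1+b)²` and the Lipschitz weight `(1+v)(1+b)³` lie below `(1+v)²(1+b)⁴`, so one
integrable function serves for both. -/
theorem LipGraded.exists_integrable {F : Type*} [NormedAddCommGroup F] {f : 𝒳 → B Ng Nt → F}
    (h : LipGraded (regularPoints g v b β₀ δ) (Metric.ball β₀ δ) (fun a => 1 + b a)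
      (fun a => (1 + v a) * (1 + b a) ^ 2) f)
    (hae : ∀ᵐ a ∂μ, a ∈ regularPoints g v b β₀ δ)
    (hint : Integrable (fun a => (1 + v a) ^ 2 * (1 + b a) ^ 4) μ) :
    ∃ L : 𝒳 → ℝ, Integrable L μ ∧ ∀ᵐ a ∂μ, 0 ≤ L a ∧
      (∀ β ∈ Metric.ball β₀ δ, ‖f a β‖ ≤ L a) ∧
      ∀ β ∈ Metric.ball β₀ δ, ∀ β' ∈ Metric.ball β₀ δ, ‖f a β - f a β'‖ ≤ L a * ‖β - β'‖ := by
  obtain ⟨C, hC, h⟩ := h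
  refine ⟨fun a => C * ((1 + v a) ^ 2 * (1 + b a) ^ 4), hint.const_mul C, ?_⟩
  filter_upwards [hae] with a ha
  have hv : 1 ≤ 1 + v a := by linarith [ha.v_nonneg]
  have hb : 1 ≤ 1 + b a := by linarith [ha.b_nonneg]
  have e1 : (1 + v a) * (1 + b a) ^ 2 ≤ (1 + v a) ^ 2 * (1 + b a) ^ 4 := by
    gcongr
    · exact le_self_pow₀ hv two_ne_zero
    · norm_num
  have e2 : (1 + v a) * (1 + b a) ^ 2 * (1 + b a) ≤ (1 + v a) ^ 2 * (1 + b a) ^ 4 := by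
    calc _ = (1 + v a) * (1 + b a) ^ 3 := by ring
      _ ≤ _ := by
        gcongr
        · exact le_self_pow₀ hv two_ne_zero
        · norm_num
  refine ⟨by positivity, fun β hβ => ((h a ha).1 β hβ).trans ?_, fun β hβ β' hβ' =>
    ((h a ha).2 β hβ β' hβ').trans ?_⟩
  · gcongr
  · gcongr

/-- Averages along a convergent sequence of parameters. -/
theorem LipGraded.tendsto_avg {F : Type*} [NormedAddCommGroup F] [NormedSpace ℝ F]
    [FiniteDimensional ℝ F] {f : 𝒳 → B Ng Nt → F}
    (h : LipGraded (regularPoints g v b β₀ δ) (Metric.ball β₀ δ) (fun a => 1 + b a)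
      (fun a => (1 + v a) * (1 + b a) ^ 2) f) (hδ : 0 < δ)
    (hae : ∀ᵐ a ∂μ, a ∈ regularPoints g v b β₀ δ)
    (hint : Integrable (fun a => (1 + v a) ^ 2 * (1 + b a) ^ 4) μ)
    (hfm : AEStronglyMeasurable (fun a => f a β₀) μ)
    {I : Type*} {ℓ : Filter I} {n : I → ℕ} {x : ∀ p, Fin (n p) → 𝒳} (hs : SampleLLN μ ℓ x)
    {β : I → B Ng Nt} (hβ : Tendsto β ℓ (𝓝 β₀)) :
    Integrable (fun a => f a β₀) μ ∧
      Tendsto (fun p => avg (x p) fun a => f a (β p)) ℓ (𝓝 (∫ a, f a β₀ ∂μ)) := by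
  obtain ⟨L, hL, hle⟩ := h.exists_integrable hae hint
  have hfi : Integrable (fun a => f a β₀) μ := hL.mono' hfm (by
    filter_upwards [hle] with a ha using ha.2.1 β₀ (Metric.mem_ball_self hδ))
  refine ⟨hfi, Metric.tendsto_nhds.2 fun ε hε => ?_⟩
  obtain ⟨δ', hδ', hev⟩ := hs.eventually_norm_avg_sub_lt hδ hL (by
    filter_upwards [hle] with a ha y hy
    exact ha.2.2 y hy β₀ (Metric.mem_ball_self hδ)) hfi hε
  filter_upwards [hev, hβ.eventually (Metric.ball_mem_nhds β₀ hδ')] with p hp hpβ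
  rw [dist_eq_norm]
  exact hp _ hpβ

end Envelope

/-! ### Consistency of the augmented estimate -/

/-- Units form an open set on which inversion is continuous, so solutions of linear systems converge
with their data. -/
theorem tendsto_of_apply_eq {I V : Type*} {ℓ : Filter I} [NormedAddCommGroup V] [NormedSpace ℝ V]
    [CompleteSpace V] {T : V →L[ℝ] V} (hT : IsUnit T) {A : I → V →L[ℝ] V} {w u : I → V} {u₀ : V}
    (hA : Tendsto A ℓ (𝓝 T)) (hw : Tendsto w ℓ (𝓝 (T u₀))) (h : ∀ᶠ p in ℓ, A p (u p) = w p) :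
    Tendsto u ℓ (𝓝 u₀) := by
  obtain ⟨U, rfl⟩ := hT
  have hinv : Tendsto (fun p => Ring.inverse (A p)) ℓ (𝓝 (Ring.inverse (U : V →L[ℝ] V))) :=
    (NormedRing.inverse_continuousAt U).tendsto.comp hA
  have hlim : Tendsto (fun p => Ring.inverse (A p) (w p)) ℓ _ :=
    (isBoundedBilinearMap_apply.continuous.tendsto
      (Ring.inverse (U : V →L[ℝ] V), (U : V →L[ℝ] V) u₀)).comp (hinv.prodMk_nhds hw)
  have hU : Ring.inverse (U : V →L[ℝ] V) ((U : V →L[ℝ] V) u₀) = u₀ := by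
    rw [← mul_apply_eq_comp, Ring.inverse_mul_cancel _ U.isUnit]
    rfl
  simp only [hU] at hlim
  refine hlim.congr' ?_
  filter_upwards [h, hA.eventually (Units.nhds U)] with p hp hAp
  rw [← hp, ← mul_apply_eq_comp, Ring.inverse_mul_cancel _ hAp]
  rfl

theorem avg_tiltedGram_apply {𝒳 : Type*} {Ng Nt n : ℕ} {g : 𝒳 → E Nt → E Ng}
    {x : Fin n → 𝒳} (θ : E Nt) (l k : E Ng) :
    avg x (fun a => tiltedGram g a θ l) k =
      avg x fun a => (tilt g a θ l * inner ℝ (g a θ) k) • g a θ := by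
  have h := avg_clm x (ContinuousLinearMap.apply ℝ (E Ng) k) fun a => tiltedGram g a θ l
  simp only [ContinuousLinearMap.apply_apply, tiltedGram_apply] at h
  exact h.symm

section Consistency

variable {𝒳 : Type*} [MeasurableSpace 𝒳] {Ng Nt : ℕ} {g : 𝒳 → E Nt → E Ng} {μ : Measure 𝒳}
  {Θ : Set (E Nt)} {lamS : E Nt → E Ng} {θs : E Nt} {Λ : E Nt → Set (E Ng)} {N : Set (E Nt)}
  {b v : 𝒳 → ℝ} {δ : ℝ}

/-- The operator of the matrix `E[exp(λ*' g) g g']`. -/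
noncomputable def gramStar (μ : Measure 𝒳) (g : 𝒳 → E Nt → E Ng) (lamS : E Nt → E Ng)
    (θs : E Nt) : E Ng →L[ℝ] E Ng := ∫ a, tiltedGram g a θs (lamS θs) ∂μ

theorem gramStar_apply (hint : Integrable (fun a => tiltedGram g a θs (lamS θs)) μ) (k : E Ng) :
    gramStar μ g lamS θs k =
      ∫ a, (tilt g a θs (lamS θs) * inner ℝ (g a θs) k) • g a θs ∂μ := by
  rw [gramStar, ContinuousLinearMap.integral_apply hint]
  simp_rw [tiltedGram_apply]

theorem integrable_gramStar_apply
    (hint : Integrable (fun a => tiltedGram g a θs (lamS θs)) μ) (k : E Ng) :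
    Integrable (fun a => (tilt g a θs (lamS θs) * inner ℝ (g a θs) k) • g a θs) μ := by
  refine (hint.apply_continuousLinearMap k).congr (ae_of_all _ fun a => ?_)
  exact tiltedGram_apply a θs (lamS θs) k

/-- Invertibility is a consequence of uniqueness of `λ*`: if `k` is in the kernel, then `g'k = 0`
almost surely, so `λ* + k` solves the same tilting equation. -/
theorem Regularity.isUnit_gramStar (hreg : Regularity μ g Θ lamS θs Λ N b)
    (hint : Integrable (fun a => tiltedGram g a θs (lamS θs)) μ) :
    IsUnit (gramStar μ g lamS θs) := by
  have hinj : Function.Injective (gramStar μ g lamS θs) := by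
    rw [injective_iff_map_eq_zero]
    intro k hk
    have hθs : θs ∈ Θ := interior_subset hreg.interior
    have h1 : ∫ a, tilt g a θs (lamS θs) * inner ℝ (g a θs) k ^ 2 ∂μ = 0 := by
      rw [gramStar_apply hint] at hk
      have h2 := integral_inner (𝕜 := ℝ) (integrable_gramStar_apply hint k) k
      rw [hk, inner_zero_right] at h2
      rw [← h2]
      refine integral_congr_ae (ae_of_all _ fun a => ?_)
      simp only [inner_smul_right, real_inner_comm]
      ring
    have h3 : Integrable (fun a => tilt g a θs (lamS θs) * inner ℝ (g a θs) k ^ 2) μ := by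
      refine ((integrable_gramStar_apply hint k).const_inner k).congr (ae_of_all _ fun a => ?_)
      simp only [inner_smul_right, real_inner_comm]
      ring
    have h4 := (integral_eq_zero_iff_of_nonneg (fun a =>
      mul_nonneg (tilt_pos _ _ _).le (sq_nonneg _)) h3).1 h1
    have h5 : ∀ᵐ a ∂μ, tilt g a θs (lamS θs + k) = tilt g a θs (lamS θs) := by
      filter_upwards [h4] with a ha
      have h6 : inner ℝ (g a θs) k = 0 := by
        rcases mul_eq_zero.1 ha with h | h
        · exact absurd h (tilt_pos _ _ _).ne'
        · exact pow_eq_zero_iff two_ne_zero |>.1 h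
      simp only [tilt]
      rw [inner_add_left, real_inner_comm, real_inner_comm (g a θs) k, h6, add_zero]
    obtain ⟨h7, h8⟩ := hreg.lamS_solution θs hθs
    have h9 : lamS θs + k = lamS θs := by
      refine hreg.lamS_unique θs hθs _ ⟨h7.congr ?_, ?_⟩
      · filter_upwards [h5] with a ha
        rw [ha]
      · rw [← h8]
        refine integral_congr_ae ?_
        filter_upwards [h5] with a ha
        rw [ha]
    simpa using h9
  rw [ContinuousLinearMap.isUnit_iff_bijective]
  exact ⟨hinj, (LinearMap.injective_iff_surjective (f := (gramStar μ g lamS θs).toLinearMap)).1 hinj⟩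

theorem omegaStar_mulVec (hint : Integrable (fun a => tiltedGram g a θs (lamS θs)) μ) (k : E Ng) :
    WithLp.toLp 2 ((omegaStar μ g lamS θs).mulVec k) = gramStar μ g lamS θs k := by
  ext i
  have h : ∀ j, (gramStar μ g lamS θs (EuclideanSpace.single j 1)) i = omegaStar μ g lamS θs i j := by
    intro j
    rw [gramStar_apply hint]
    refine ((EuclideanSpace.proj (𝕜 := ℝ) i : E Ng →L[ℝ] ℝ).integral_comp_comm
      (integrable_gramStar_apply hint (EuclideanSpace.single j 1))).symm.trans ?_
    rw [omegaStar, Matrix.of_apply]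
    refine integral_congr_ae (ae_of_all _ fun a => ?_)
    simp [EuclideanSpace.inner_single_right]
    ring
  conv_rhs => rw [clm_eq_sum_smulRight (gramStar μ g lamS θs)]
  simp [Matrix.mulVec, dotProduct, h, mul_comm]

/-- The inverse of a singular matrix is zero by convention, so invertibility of `omegaStar` is
established before the inverse in `kapStar` can be cancelled. -/
theorem Regularity.gramStar_kapStar (hreg : Regularity μ g Θ lamS θs Λ N b)
    (hint : Integrable (fun a => tiltedGram g a θs (lamS θs)) μ) :
    gramStar μ g lamS θs (kapStar μ g lamS θs) = -(tauStar μ g lamS θs • ∫ a, g a θs ∂μ) := by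
  have hU : IsUnit (omegaStar μ g lamS θs) := by
    rw [← Matrix.mulVec_injective_iff_isUnit]
    have h1 := ((ContinuousLinearMap.isUnit_iff_bijective).1 (hreg.isUnit_gramStar hint)).1
    intro k k' hk
    have h2 : gramStar μ g lamS θs (WithLp.toLp 2 k) = gramStar μ g lamS θs (WithLp.toLp 2 k') := by
      rw [← omegaStar_mulVec hint, ← omegaStar_mulVec hint]
      exact congrArg (WithLp.toLp 2) hk
    exact (WithLp.toLp_injective 2) (h1 h2)
  rw [← omegaStar_mulVec hint, kapStar]
  ext i
  simp only [Matrix.mulVec_neg, Matrix.mulVec_mulVec]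
  rw [Matrix.mul_nonsing_inv _ ((Matrix.isUnit_iff_isUnit_det _).1 hU)]
  simp

variable {I : Type*} {ℓ : Filter I} {n : I → ℕ} {x : ∀ p, Fin (n p) → 𝒳}

theorem aestronglyMeasurable_tiltedGram (hgm : Measurable (Function.uncurry g)) (θ : E Nt)
    (l : E Ng) : AEStronglyMeasurable (fun a => tiltedGram g a θ l) μ := by
  have hg : StronglyMeasurable fun a => g a θ :=
    (hgm.comp (measurable_id.prodMk measurable_const)).stronglyMeasurable
  have hx : StronglyMeasurable (fun a => tilt g a θ l) :=
    (Real.measurable_exp.comp (measurable_const.inner hg.measurable)).stronglyMeasurable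
  have h1 : StronglyMeasurable fun a => (innerSL ℝ (g a θ)).smulRight (g a θ) := by
    have hc : Continuous fun u : E Ng => (innerSL ℝ u).smulRight u := by fun_prop
    exact hc.comp_stronglyMeasurable hg
  exact (hx.smul h1).aestronglyMeasurable

/-- Consistency of the augmented estimate, and of the tilted second moments. -/
theorem Regularity.tendsto_augmented [StandardBorelSpace 𝒳] [IsFiniteMeasure μ]
    (hreg : Regularity μ g Θ lamS θs Λ N b) (hs : SampleLLN μ ℓ x) (hμ : μ ≠ 0) (hδ : 0 < δ)
    (hae : ∀ᵐ a ∂μ, a ∈ regularPoints g v b (betaStar μ g lamS θs) δ)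
    (hint : Integrable (fun a => (1 + v a) ^ 2 * (1 + b a) ^ 4) μ) {β : I → B Ng Nt}
    (hβ : ∀ᶠ p in ℓ, IsAugmentedETEL g Θ (x p) (β p)) :
    Tendsto β ℓ (𝓝 (betaStar μ g lamS θs)) ∧
      ∀ᶠ p in ℓ, IsUnit (avg (x p) fun a => tiltedGram g a (thOf (β p)) (lamOf (β p))) := by
  set β₀ := betaStar μ g lamS θs with hβ₀
  have hth : Tendsto (fun p => thOf (β p)) ℓ (𝓝 θs) := Metric.tendsto_nhds.2 fun ε hε => by
    filter_upwards [hreg.eventually_augmented_near hs hμ hε, hβ] with p hp hpβ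
    rw [dist_eq_norm]
    exact (hp _ hpβ).1
  have hlam : Tendsto (fun p => lamOf (β p)) ℓ (𝓝 (lamS θs)) := Metric.tendsto_nhds.2 fun ε hε => by
    filter_upwards [hreg.eventually_augmented_near hs hμ hε, hβ] with p hp hpβ
    rw [dist_eq_norm]
    exact (hp _ hpβ).2
  have hblocks : ∀ {γ : I → B Ng Nt}, Tendsto (fun p => tauOf (γ p)) ℓ (𝓝 (tauStar μ g lamS θs)) →
      Tendsto (fun p => kapOf (γ p)) ℓ (𝓝 (kapStar μ g lamS θs)) →
      Tendsto (fun p => lamOf (γ p)) ℓ (𝓝 (lamS θs)) → Tendsto (fun p => thOf (γ p)) ℓ (𝓝 θs) →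
      Tendsto γ ℓ (𝓝 β₀) := by
    intro γ h1 h2 h3 h4
    rw [tendsto_iff_norm_sub_tendsto_zero]
    refine squeeze_zero (fun _ => norm_nonneg _) (fun p => norm_sub_le_blocks _ _) ?_
    have e1 := (tendsto_iff_norm_sub_tendsto_zero.1 h1)
    have e2 := (tendsto_iff_norm_sub_tendsto_zero.1 h2)
    have e3 := (tendsto_iff_norm_sub_tendsto_zero.1 h3)
    have e4 := (tendsto_iff_norm_sub_tendsto_zero.1 h4)
    simpa [hβ₀, betaStar] using ((e1.add e2).add e3).add e4
  -- Tilts, `g` and the Gram operator depend on `λ` and `θ` only. Freezing the other two blocks at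
  -- their limits gives a sequence already known to converge; `τ` and `κ` follow from it.
  let γ : I → B Ng Nt := fun p =>
    mkB (tauStar μ g lamS θs) (kapStar μ g lamS θs) (lamOf (β p)) (thOf (β p))
  have hγ : Tendsto γ ℓ (𝓝 β₀) := hblocks tendsto_const_nhds tendsto_const_nhds hlam hth
  have hv1 : ∀ a ∈ regularPoints g v b β₀ δ, 1 ≤ 1 + v a := fun a ha => by linarith [ha.v_nonneg]
  have hb1 : ∀ a ∈ regularPoints g v b β₀ δ, 1 ≤ 1 + b a := fun a ha => by linarith [ha.b_nonneg]
  have hb : ∀ a ∈ regularPoints g v b β₀ δ, 0 ≤ 1 + b a := fun a ha => by linarith [ha.b_nonneg]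
  have hxl := (lipGraded_tilt (g := g) (v := v) (b := b) (β₀ := β₀) hδ).mono
    (W' := fun a => (1 + v a) * (1 + b a) ^ 2) hb fun a ha =>
      le_mul_of_one_le_right (by linarith [hv1 a ha]) (one_le_pow₀ (hb1 a ha))
  have hgl := (lipGraded_g (g := g) (v := v) (b := b) (β₀ := β₀) (δ := δ)).mono
    (W' := fun a => (1 + v a) * (1 + b a) ^ 2) hb fun a ha =>
      (le_self_pow₀ (hb1 a ha) two_ne_zero).trans
        (le_mul_of_one_le_left (by positivity) (hv1 a ha))
  have hx := (hxl.tendsto_avg hδ hae hint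
    (hreg.measurable_tilt_left θs (lamS θs)).aestronglyMeasurable hs hγ).2
  have hg := (hgl.tendsto_avg hδ hae hint
    (hreg.measurable_g_left θs).aestronglyMeasurable hs hγ).2
  obtain ⟨hGi, hG⟩ := (lipGraded_tiltedGram hδ).tendsto_avg hδ hae hint
    (aestronglyMeasurable_tiltedGram hreg.measurable_g θs (lamS θs)) hs hγ
  have htau : Tendsto (fun p => tauOf (β p)) ℓ (𝓝 (tauStar μ g lamS θs)) := by
    refine hx.congr' ?_
    filter_upwards [hβ] with p hp
    exact hp.tau.symm
  have hU : IsUnit (gramStar μ g lamS θs) := hreg.isUnit_gramStar hGi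
  have hkap : Tendsto (fun p => kapOf (β p)) ℓ (𝓝 (kapStar μ g lamS θs)) := by
    refine tendsto_of_apply_eq hU (A := fun p => avg (x p) fun a =>
      tiltedGram g a (thOf (β p)) (lamOf (β p)))
      (w := fun p => -(tauOf (β p) • avg (x p) fun a => g a (thOf (β p)))) hG ?_ ?_
    · rw [hreg.gramStar_kapStar hGi]
      exact (htau.smul hg).neg
    · filter_upwards [hβ] with p hp
      rw [avg_tiltedGram_apply]
      exact eq_neg_of_add_eq_zero_left hp.kap
  refine ⟨hblocks htau hkap hlam hth, ?_⟩
  obtain ⟨U, hU⟩ := hU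
  have := Units.nhds U
  rw [hU] at this
  exact hG.eventually this

end Consistency

/-! ### The first order conditions -/

section FirstOrder

variable {𝒳 : Type*} {Ng Nt n : ℕ} {g : 𝒳 → E Nt → E Ng} {x : Fin n → 𝒳}

theorem hasFDerivAt_avg {Y F : Type*} [NormedAddCommGroup Y] [NormedSpace ℝ Y]
    [NormedAddCommGroup F] [NormedSpace ℝ F] {f : 𝒳 → Y → F} {f' : 𝒳 → Y →L[ℝ] F} {y : Y}
    (h : ∀ i, HasFDerivAt (f (x i)) (f' (x i)) y) :
    HasFDerivAt (fun y => avg x fun a => f a y) (avg x f') y :=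
  (HasFDerivAt.fun_sum fun i _ => h i).const_smul _

theorem contDiffAt_avg {Y F : Type*} [NormedAddCommGroup Y] [NormedSpace ℝ Y]
    [NormedAddCommGroup F] [NormedSpace ℝ F] {f : 𝒳 → Y → F} {y : Y} {m : WithTop ℕ∞}
    (h : ∀ i, ContDiffAt ℝ m (f (x i)) y) : ContDiffAt ℝ m (fun y => avg x fun a => f a y) y :=
  (ContDiffAt.sum fun i _ => h i).const_smul _

theorem avg_clm_apply {Y F : Type*} [NormedAddCommGroup Y] [NormedSpace ℝ Y]
    [NormedAddCommGroup F] [NormedSpace ℝ F] (f : 𝒳 → Y →L[ℝ] F) (y : Y) :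
    avg x f y = avg x fun a => f a y :=
  (avg_clm x (ContinuousLinearMap.apply ℝ F y) f).symm

/-- The derivative of `(λ, θ) ↦ g(x, θ)`. -/
noncomputable def gDeriv (g : 𝒳 → E Nt → E Ng) (θ : E Nt) (a : 𝒳) : E Ng × E Nt →L[ℝ] E Ng :=
  (fderiv ℝ (g a) θ).comp (ContinuousLinearMap.snd ℝ (E Ng) (E Nt))

/-- The derivative of `(λ, θ) ↦ exp(λ' g(x, θ))`. -/
noncomputable def tiltDeriv (g : 𝒳 → E Nt → E Ng) (θ : E Nt) (l : E Ng) (a : 𝒳) :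
    E Ng × E Nt →L[ℝ] ℝ :=
  tilt g a θ l • ((innerSL ℝ l).comp (gDeriv g θ a) +
    (innerSL ℝ (g a θ)).comp (ContinuousLinearMap.fst ℝ (E Ng) (E Nt)))

theorem gDeriv_apply (θ : E Nt) (a : 𝒳) (q : E Ng × E Nt) :
    gDeriv g θ a q = fderiv ℝ (g a) θ q.2 := rfl

theorem tiltDeriv_apply (θ : E Nt) (l : E Ng) (a : 𝒳) (q : E Ng × E Nt) :
    tiltDeriv g θ l a q =
      tilt g a θ l * (inner ℝ l (fderiv ℝ (g a) θ q.2) + inner ℝ (g a θ) q.1) := rfl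

theorem hasFDerivAt_gDeriv {θ : E Nt} {l : E Ng} {a : 𝒳} (h : DifferentiableAt ℝ (g a) θ) :
    HasFDerivAt (fun q : E Ng × E Nt => g a q.2) (gDeriv g θ a) (l, θ) :=
  HasFDerivAt.comp (g := g a) (l, θ) h.hasFDerivAt hasFDerivAt_snd

theorem hasFDerivAt_tiltDeriv {θ : E Nt} {l : E Ng} {a : 𝒳} (h : DifferentiableAt ℝ (g a) θ) :
    HasFDerivAt (fun q : E Ng × E Nt => tilt g a q.2 q.1) (tiltDeriv g θ l a) (l, θ) := by
  have h1 := (HasFDerivAt.inner ℝ (hasFDerivAt_fst (𝕜 := ℝ) (p := (l, θ)))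
    (hasFDerivAt_gDeriv h (l := l))).exp
  refine h1.congr_fderiv ?_
  refine ContinuousLinearMap.ext fun q => ?_
  rw [tiltDeriv_apply]
  simp [tilt, fderivInnerCLM_apply, gDeriv_apply, real_inner_comm]

theorem hasStrictFDerivAt_avg_tilt_smul {θ : E Nt} {l : E Ng}
    (hg : ∀ i, ContDiffAt ℝ 1 (g (x i)) θ) :
    HasStrictFDerivAt (fun q : E Ng × E Nt => avg x fun a => tilt g a q.2 q.1 • g a q.2)
      (avg x fun a => tilt g a θ l • gDeriv g θ a + (tiltDeriv g θ l a).smulRight (g a θ))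
      (l, θ) := by
  have hgd : ∀ i, DifferentiableAt ℝ (g (x i)) θ := fun i => (hg i).differentiableAt one_ne_zero
  refine ContDiffAt.hasStrictFDerivAt' (n := 1) (contDiffAt_avg fun i => ?_)
    (hasFDerivAt_avg (f := fun a (q : E Ng × E Nt) => tilt g a q.2 q.1 • g a q.2) fun i =>
      (hasFDerivAt_tiltDeriv (hgd i)).smul (hasFDerivAt_gDeriv (hgd i))) one_ne_zero
  have h1 : ContDiffAt ℝ 1 (fun q : E Ng × E Nt => g (x i) q.2) (l, θ) :=
    ContDiffAt.comp (g := g (x i)) (l, θ) (hg i) contDiffAt_snd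
  exact ((contDiffAt_fst.inner ℝ h1).exp).smul h1

/-- The derivative of `disc` in `(λ, θ)`. -/
noncomputable def discDeriv (g : 𝒳 → E Nt → E Ng) (x : Fin n → 𝒳) (θ : E Nt) (l : E Ng) :
    E Ng × E Nt →L[ℝ] ℝ :=
  (sampleM g x θ l)⁻¹ • avg x (tiltDeriv g θ l) -
    (fderivInnerCLM ℝ (l, avg x fun a => g a θ)).comp
      ((ContinuousLinearMap.fst ℝ (E Ng) (E Nt)).prod (avg x (gDeriv g θ)))

theorem discDeriv_apply (θ : E Nt) (l : E Ng) (q : E Ng × E Nt) :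
    discDeriv g x θ l q = (sampleM g x θ l)⁻¹ * avg x (fun a => tiltDeriv g θ l a q) -
      (inner ℝ l (avg x fun a => gDeriv g θ a q) + inner ℝ q.1 (avg x fun a => g a θ)) := by
  rw [← avg_clm_apply, ← avg_clm_apply]
  rfl

theorem hasStrictFDerivAt_disc (hn : 0 < n) {θ : E Nt} {l : E Ng}
    (hg : ∀ i, ContDiffAt ℝ 1 (g (x i)) θ) :
    HasStrictFDerivAt (fun q : E Ng × E Nt => disc g x q.2 q.1) (discDeriv g x θ l) (l, θ) := by
  have hgd : ∀ i, DifferentiableAt ℝ (g (x i)) θ := fun i => (hg i).differentiableAt one_ne_zero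
  have hM : sampleM g x θ l ≠ 0 := (sampleM_pos hn).ne'
  refine ContDiffAt.hasStrictFDerivAt' (n := 1) ?_ ?_ one_ne_zero
  · have h1 : ∀ i, ContDiffAt ℝ 1 (fun q : E Ng × E Nt => g (x i) q.2) (l, θ) := fun i =>
      ContDiffAt.comp (g := g (x i)) (l, θ) (hg i) contDiffAt_snd
    have h2 : ContDiffAt ℝ 1 (fun q : E Ng × E Nt => sampleM g x q.2 q.1) (l, θ) :=
      contDiffAt_avg fun i => (contDiffAt_fst.inner ℝ (h1 i)).exp
    have h3 : ContDiffAt ℝ 1 (fun q : E Ng × E Nt => avg x fun a => g a q.2) (l, θ) :=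
      contDiffAt_avg (f := fun a (q : E Ng × E Nt) => g a q.2) h1
    exact (h2.log hM).sub (contDiffAt_fst.inner ℝ h3)
  · have h2 : HasFDerivAt (fun q : E Ng × E Nt => sampleM g x q.2 q.1)
        (avg x (tiltDeriv g θ l)) (l, θ) :=
      hasFDerivAt_avg (f := fun a (q : E Ng × E Nt) => tilt g a q.2 q.1)
        fun i => hasFDerivAt_tiltDeriv (hgd i)
    have h3 : HasFDerivAt (fun q : E Ng × E Nt => avg x fun a => g a q.2)
        (avg x (gDeriv g θ)) (l, θ) :=
      hasFDerivAt_avg (f := fun a (q : E Ng × E Nt) => g a q.2)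
        fun i => hasFDerivAt_gDeriv (hgd i)
    have h4 := HasFDerivAt.inner ℝ (hasFDerivAt_fst (𝕜 := ℝ) (p := (l, θ))) h3
    exact (h2.log hM).sub h4

variable {Θ : Set (E Nt)} {β : B Ng Nt}

/-- The augmented estimate solves the sample moment equations. -/
theorem IsAugmentedETEL.avg_phi_eq_zero (h : IsAugmentedETEL g Θ x β) (hn : 0 < n)
    (hΘ : Θ ∈ 𝓝 (thOf β)) (hg : ∀ i, ContDiffAt ℝ 1 (g (x i)) (thOf β))
    (hU : IsUnit (avg x fun a => tiltedGram g a (thOf β) (lamOf β))) :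
    avg x (fun a => phi g a β) = 0 := by
  set θ := thOf β with hθ
  set l := lamOf β with hl
  set k := kapOf β with hk
  have hcrit : IsCrit g x θ l := h.isCrit
  set M := sampleM g x θ l with hM
  have hMpos : 0 < M := sampleM_pos hn
  have htau : tauOf β = M := h.tau
  set A := avg x fun a => tiltedGram g a θ l with hA
  set gb := avg x fun a => g a θ with hgb
  have hkap : A k + M • gb = 0 := by
    rw [hA, avg_tiltedGram_apply, ← htau]
    exact h.kap
  have hAinj : Function.Injective A := ((ContinuousLinearMap.isUnit_iff_bijective).1 hU).1
  -- Lagrange multipliers for the minimization of `disc` under the constraint `IsCrit`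
  have hmin : IsLocalExtrOn (fun q : E Ng × E Nt => disc g x q.2 q.1)
      {q | (avg x fun a => tilt g a q.2 q.1 • g a q.2) =
        avg x fun a => tilt g a (l, θ).2 (l, θ).1 • g a (l, θ).2} (l, θ) := by
    left
    have h1 : ∀ᶠ q in 𝓝 ((l, θ) : E Ng × E Nt), q.2 ∈ Θ :=
      (continuous_snd.tendsto ((l, θ) : E Ng × E Nt)).eventually hΘ
    filter_upwards [nhdsWithin_le_nhds h1, self_mem_nhdsWithin] with q hq hq'
    exact h.theta.disc_le hn hcrit hq (hq'.trans hcrit)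
  obtain ⟨Λ, Λ₀, hne, hΛ⟩ := hmin.exists_linear_map_of_hasStrictFDerivAt
    (hasStrictFDerivAt_avg_tilt_smul hg) (hasStrictFDerivAt_disc hn hg)
  obtain ⟨m, hm⟩ : ∃ m : E Ng, ∀ u, Λ u = inner ℝ m u := by
    refine ⟨(InnerProductSpace.toDual ℝ (E Ng)).symm (LinearMap.toContinuousLinearMap Λ),
      fun u => ?_⟩
    rw [InnerProductSpace.toDual_symm_apply]
    rfl
  -- Stationarity in `λ`. By the tilting equation `sampleM` contributes nothing.
  have hAm : A m = Λ₀ • gb := by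
    refine ext_inner_right ℝ fun u => ?_
    have h1 := hΛ (u, 0)
    rw [hm, avg_clm_apply, ← avg_inner, discDeriv_apply] at h1
    simp only [add_apply, smul_apply, ContinuousLinearMap.smulRight_apply, tiltDeriv_apply,
      gDeriv_apply, map_zero, inner_zero_right, smul_zero, zero_add] at h1
    have e1 : (avg x fun a => tilt g a θ l * inner ℝ (g a θ) u) = 0 := by
      have h2 := avg_inner x u fun a => tilt g a θ l • g a θ
      rw [hcrit, inner_zero_right] at h2
      rw [← h2]
      exact avg_congr x fun i => by rw [inner_smul_right, real_inner_comm]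
    have e2 : (avg x fun a => inner ℝ m ((tilt g a θ l * inner ℝ (g a θ) u) • g a θ)) =
        inner ℝ u (A m) := by
      rw [hA, avg_tiltedGram_apply, ← avg_inner]
      refine avg_congr x fun i => ?_
      rw [inner_smul_right, inner_smul_right, real_inner_comm m, real_inner_comm u]
      ring
    rw [e1, e2, avg_const x hn, inner_zero_right, mul_zero, zero_add, zero_sub, smul_eq_mul] at h1
    rw [inner_smul_left, real_inner_comm, real_inner_comm u gb]
    simp only [conj_trivial]
    linarith
  -- An abnormal multiplier would lie in the kernel of the injective operator `A`, making both
  -- multipliers zero.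
  have hΛ₀ : Λ₀ ≠ 0 := by
    rintro rfl
    rw [zero_smul] at hAm
    have hm0 : m = 0 := hAinj (by rw [hAm, map_zero])
    refine hne (Prod.ext (LinearMap.ext fun u => ?_) rfl)
    rw [hm, hm0, inner_zero_left]
    rfl
  -- `κ` and the multiplier solve the same linear system up to scaling, so they are proportional.
  have hmk : Λ₀ • k = -(M • m) := by
    refine hAinj ?_
    rw [map_neg, map_smul, map_smul, hAm, eq_neg_of_add_eq_zero_left hkap]
    module
  -- Stationarity in `θ`, multiplied by `-(M / Λ₀)`, is the last block of the moment equations.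
  have hθeq : ∀ w : E Nt, avg x (fun a => tilt g a θ l * inner ℝ (fderiv ℝ (g a) θ w) k
      + tilt g a θ l * inner ℝ (fderiv ℝ (g a) θ w) l * inner ℝ (g a θ) k
      - tilt g a θ l * inner ℝ (fderiv ℝ (g a) θ w) l
      + M * inner ℝ (fderiv ℝ (g a) θ w) l) = 0 := by
    intro w
    have h1 := hΛ (0, w)
    rw [hm, avg_clm_apply, ← avg_inner, discDeriv_apply] at h1
    simp only [add_apply, smul_apply, ContinuousLinearMap.smulRight_apply, tiltDeriv_apply,
      gDeriv_apply, inner_zero_right, inner_zero_left, add_zero] at h1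
    have e1 : (avg x fun a => inner ℝ m (tilt g a θ l • (fderiv ℝ (g a) θ) w +
        (tilt g a θ l * inner ℝ l ((fderiv ℝ (g a) θ) w)) • g a θ)) =
        avg x fun a => tilt g a θ l * inner ℝ (fderiv ℝ (g a) θ w) m
          + tilt g a θ l * inner ℝ (fderiv ℝ (g a) θ w) l * inner ℝ (g a θ) m := by
      refine avg_congr x fun i => ?_
      rw [inner_add_right, inner_smul_right, inner_smul_right, real_inner_comm m,
        real_inner_comm m (g (x i) θ), real_inner_comm l]
    have hk' : k = (-(M / Λ₀)) • m := by
      rw [← smul_right_injective _ hΛ₀ |>.eq_iff, hmk, smul_smul, ← neg_smul]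
      congr 1
      field_simp
    have e2 : (avg x fun a => tilt g a θ l * inner ℝ (fderiv ℝ (g a) θ w) k
        + tilt g a θ l * inner ℝ (fderiv ℝ (g a) θ w) l * inner ℝ (g a θ) k
        - tilt g a θ l * inner ℝ (fderiv ℝ (g a) θ w) l
        + M * inner ℝ (fderiv ℝ (g a) θ w) l) =
        avg x fun a => -(M / Λ₀) * (tilt g a θ l * inner ℝ (fderiv ℝ (g a) θ w) m
          + tilt g a θ l * inner ℝ (fderiv ℝ (g a) θ w) l * inner ℝ (g a θ) m)
        - tilt g a θ l * inner ℝ l (fderiv ℝ (g a) θ w)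
        + M * inner ℝ l (fderiv ℝ (g a) θ w) := by
      refine avg_congr x fun i => ?_
      rw [hk', inner_smul_right, inner_smul_right, real_inner_comm l]
      ring
    rw [e2, avg_add, avg_sub, avg_mul, avg_mul, avg_inner]
    rw [e1, ← hM, smul_eq_mul] at h1
    have h2 := eq_neg_of_add_eq_zero_left h1
    rw [h2]
    field_simp
    ring
  ext i
  refine (avg_clm x (EuclideanSpace.proj (𝕜 := ℝ) i) fun a => phi g a β).symm.trans ?_
  rcases i with u | i | i | j
  · change avg x (fun a => tilt g a θ l - tauOf β) = 0
    rw [avg_sub, avg_const x hn, htau]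
    exact sub_self _
  · change avg x (fun a => EuclideanSpace.proj (𝕜 := ℝ) i (tilt g a θ l • g a θ)) = 0
    rw [avg_clm, hcrit, map_zero]
  · change avg x (fun a => EuclideanSpace.proj (𝕜 := ℝ) i ((tauOf β - tilt g a θ l) • g a θ +
      (tilt g a θ l * inner ℝ (g a θ) k) • g a θ)) = 0
    rw [avg_clm, avg_add, ← avg_tiltedGram_apply]
    simp_rw [sub_smul]
    rw [avg_sub, avg_smul, hcrit, sub_zero, add_comm, htau, hkap, map_zero]
  · rw [← htau] at hθeq
    exact hθeq (EuclideanSpace.single j 1)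

end FirstOrder

/-! ### Asymptotic normality -/

section Normality

variable {Ω 𝒳 ι : Type*} [MeasurableSpace Ω] [MeasurableSpace 𝒳] [Fintype ι] [DecidableEq ι]
  {P : Measure Ω} [IsProbabilityMeasure P] {μ : Measure 𝒳} {X : ℕ → Ω → 𝒳}
  {f : 𝒳 → EuclideanSpace ℝ ι}

/-- The central limit theorem for i.i.d. centred random vectors. -/
theorem tendstoInDistribution_inv_sqrt_smul_sum (hlaw : ∀ i, HasLaw (X i) μ P)
    (hindep : iIndepFun X P) (hf : MemLp f 2 μ) (hf0 : ∫ a, f a ∂μ = 0) {S : Matrix ι ι ℝ}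
    (hS : S.PosSemidef)
    (hquad : ∀ t : EuclideanSpace ℝ ι, t.ofLp ⬝ᵥ S.mulVec t.ofLp = ∫ a, inner ℝ t (f a) ^ 2 ∂μ) :
    TendstoInDistribution (fun (n : ℕ) ω => (√n)⁻¹ • ∑ i ∈ Finset.range n, f (X i ω)) atTop
      (id : EuclideanSpace ℝ ι → EuclideanSpace ℝ ι) (fun _ => P) (multivariateGaussian 0 S) := by
  have hprob : IsProbabilityMeasure μ := by
    rw [← (hlaw 0).map_eq]
    exact Measure.isProbabilityMeasure_map (hlaw 0).aemeasurable
  have hfX : ∀ i, AEMeasurable (fun ω => f (X i ω)) P := fun i => by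
    refine AEMeasurable.comp_aemeasurable ?_ (hlaw i).aemeasurable
    rw [(hlaw i).map_eq]
    exact hf.1.aemeasurable
  have hZm : ∀ n : ℕ, AEMeasurable (fun ω => (√n)⁻¹ • ∑ i ∈ Finset.range n, f (X i ω)) P := fun n =>
    (measurable_const_smul _).comp_aemeasurable (Finset.aemeasurable_fun_sum _ fun i _ => hfX i)
  refine ⟨hZm, aemeasurable_id, ?_⟩
  refine ProbabilityMeasure.tendsto_iff_tendsto_charFun.2 fun t => ?_
  change Tendsto (fun n : ℕ => charFun (P.map fun ω => (√n)⁻¹ • ∑ i ∈ Finset.range n, f (X i ω)) t)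
    atTop (𝓝 (charFun ((multivariateGaussian 0 S).map id) t))
  rw [Measure.map_id, charFun_multivariateGaussian hS, hquad]
  let h : 𝒳 → ℝ := fun a => inner ℝ t (f a)
  have hh : MemLp h 2 μ := hf.const_inner t
  have hhm : ∀ i, AEMeasurable h (P.map (X i)) := fun i => by
    rw [(hlaw i).map_eq]
    exact hh.1.aemeasurable
  have hh0 : ∫ ω, h (X 0 ω) ∂P = 0 := by
    rw [← Function.comp_def h, (hlaw 0).integral_comp hh.1]
    simp only [h]
    rw [integral_inner (𝕜 := ℝ) (hf.integrable one_le_two), hf0, inner_zero_right]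
  have hvar : variance (fun ω => h (X 0 ω)) P = ∫ a, h a ^ 2 ∂μ := by
    rw [variance_of_integral_eq_zero (X := fun ω => h (X 0 ω)) ((hhm 0).comp_aemeasurable (hlaw 0).aemeasurable) hh0]
    exact (hlaw 0).integral_comp (f := fun a => h a ^ 2) (hh.1.pow 2)
  have hclt := tendstoInDistribution_inv_sqrt_mul_sum_sub (P := P) (X := fun i ω => h (X i ω))
    (Y := id) (P' := gaussianReal 0 (variance (fun ω => h (X 0 ω)) P).toNNReal)
    ⟨aemeasurable_id, Measure.map_id⟩
    (by
      rw [← (hlaw 0).map_eq] at hh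
      exact hh.comp_of_map (hlaw 0).aemeasurable)
    (hindep.comp₀ (fun _ => h) (fun i => (hlaw i).aemeasurable) hhm)
    (fun i => IdentDistrib.comp_of_aemeasurable (u := h)
      ⟨(hlaw i).aemeasurable, (hlaw 0).aemeasurable, by rw [(hlaw i).map_eq, (hlaw 0).map_eq]⟩
      (hhm i))
  -- Cramér–Wold: the characteristic function of the vector at `t` is that of its projection on `t`
  -- at `1`, so the real central limit theorem for `h` is enough.
  have h1 : Tendsto (fun n : ℕ => charFun (P.map fun ω => (√n)⁻¹ *
      (∑ k ∈ Finset.range n, h (X k ω) - n * ∫ ω, h (X 0 ω) ∂P)) 1) atTop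
      (𝓝 (charFun ((gaussianReal 0 (variance (fun ω => h (X 0 ω)) P).toNNReal).map id) 1)) :=
    ProbabilityMeasure.tendsto_iff_tendsto_charFun.1 hclt.tendsto 1
  simp only [Measure.map_id, charFun_gaussianReal, hvar, hh0] at h1
  have h2 : ∀ n : ℕ, charFun (P.map fun ω => (√n)⁻¹ • ∑ i ∈ Finset.range n, f (X i ω)) t =
      charFun (P.map fun ω => (√n)⁻¹ * (∑ k ∈ Finset.range n, h (X k ω) - n * 0)) 1 := by
    intro n
    have hm : AEMeasurable (fun ω => (√n)⁻¹ * (∑ k ∈ Finset.range n, h (X k ω) - n * 0)) P := by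
      have := hclt.forall_aemeasurable n
      rwa [hh0] at this
    rw [charFun_apply, charFun_apply, integral_map (hZm n) (by fun_prop),
      integral_map hm (by fun_prop)]
    refine integral_congr_ae (ae_of_all _ fun ω => ?_)
    have e : inner ℝ ((√n)⁻¹ • ∑ i ∈ Finset.range n, f (X i ω)) t =
        inner ℝ ((√n)⁻¹ * (∑ k ∈ Finset.range n, h (X k ω) - n * 0)) 1 := by
      rw [real_inner_comm, inner_smul_right, inner_sum]
      simp [h]
    simp only [e]
  simp_rw [h2]
  convert h1 using 2
  rw [Real.coe_toNNReal _ (integral_nonneg fun a => sq_nonneg _)]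
  simp [h]

omit [IsProbabilityMeasure P] in
/-- A remainder which is negligible relative to a tight sequence vanishes in probability. -/
theorem tendstoInMeasure_sub_of_isTightMeasureSet {F : Type*} [NormedAddCommGroup F]
    [MeasurableSpace F] [BorelSpace F] {D Z : ℕ → Ω → F} (hZm : ∀ n, AEMeasurable (Z n) P)
    (hZ : IsTightMeasureSet (Set.range fun n => P.map (Z n)))
    (h : ∀ η > 0, ∀ᶠ p in prFilter P, ‖D p.1 p.2 - Z p.1 p.2‖ ≤ η * ‖Z p.1 p.2‖) :
    TendstoInMeasure P (D - Z) atTop 0 := by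
  rw [tendstoInMeasure_iff_norm]
  intro e he
  rw [ENNReal.tendsto_atTop_zero]
  intro c hc
  have hc2 : 0 < c / 2 := ENNReal.half_pos hc.ne'
  obtain ⟨K, hK, hK0⟩ := (((tendsto_measure_norm_gt_of_isTightMeasureSet hZ).eventually
    (ge_mem_nhds hc2)).and (eventually_gt_atTop 0)).exists
  -- With relative error `e / (2K)` and `‖Z‖ ≤ K` the difference is at most `e / 2`, hence below
  -- `e`.
  have hev := (eventually_prFilter.1 (h (e / (2 * K)) (by positivity))).eventually (ge_mem_nhds hc2)
  obtain ⟨n₀, hn₀⟩ := eventually_atTop.1 hev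
  refine ⟨n₀, fun n hn => ?_⟩
  have h1 : P {ω | K < ‖Z n ω‖} ≤ c / 2 := by
    refine le_trans ?_ hK
    refine le_trans ?_ (le_iSup₂ (f := fun (ν : Measure F) (_ : ν ∈ Set.range fun n => P.map (Z n))
      => ν {x | K < ‖x‖}) (P.map (Z n)) ⟨n, rfl⟩)
    rw [Measure.map_apply_of_aemeasurable (hZm n) (measurableSet_lt measurable_const measurable_norm)]
    rfl
  calc P {ω | e ≤ ‖(D - Z) n ω - (0 : ℕ → Ω → F) n ω‖}
      ≤ P ({ω | ¬ ‖D n ω - Z n ω‖ ≤ e / (2 * K) * ‖Z n ω‖} ∪ {ω | K < ‖Z n ω‖}) := by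
        refine measure_mono fun ω hω => ?_
        by_contra hcon
        simp only [Set.mem_union, Set.mem_ofPred_eq, not_or, not_not, not_lt] at hcon hω
        have h2 : e ≤ ‖D n ω - Z n ω‖ := by simpa using hω
        have h3 : e / (2 * K) * ‖Z n ω‖ ≤ e / (2 * K) * K := by gcongr; exact hcon.2
        have h4 : e / (2 * K) * K = e / 2 := by field_simp
        linarith [hcon.1]
    _ ≤ c / 2 + c / 2 := (measure_union_le _ _).trans (add_le_add (hn₀ n hn) h1)
    _ = c := ENNReal.add_halves c

omit [DecidableEq ι] in
theorem dotProduct_secondMoment_mulVec (hf : MemLp f 2 μ) (u : ι → ℝ) :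
    u ⬝ᵥ (Matrix.of fun i j => ∫ a, f a i * f a j ∂μ).mulVec u = ∫ a, (u ⬝ᵥ (f a).ofLp) ^ 2 ∂μ := by
  have hfi : ∀ i, MemLp (fun a => f a i) 2 μ := fun i =>
    (EuclideanSpace.proj (𝕜 := ℝ) i).comp_memLp' hf
  have hint : ∀ i j, Integrable (fun a => f a i * f a j) μ := fun i j =>
    (hfi i).integrable_mul (hfi j)
  have h1 : ∀ a, (u ⬝ᵥ (f a).ofLp) ^ 2 = ∑ i, ∑ j, u i * u j * (f a i * f a j) := by
    intro a
    rw [pow_two, dotProduct, Finset.sum_mul_sum]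
    refine Finset.sum_congr rfl fun i _ => Finset.sum_congr rfl fun j _ => ?_
    ring
  simp_rw [h1]
  rw [integral_finsetSum _ fun i _ => integrable_finsetSum _ fun j _ => (hint i j).const_mul _]
  simp only [dotProduct, Matrix.mulVec, Matrix.of_apply, Finset.mul_sum]
  refine Finset.sum_congr rfl fun i _ => ?_
  rw [integral_finsetSum _ fun j _ => (hint i j).const_mul _]
  refine Finset.sum_congr rfl fun j _ => ?_
  rw [integral_const_mul]
  ring

omit [DecidableEq ι] in
theorem posSemidef_secondMoment (hf : MemLp f 2 μ) :
    (Matrix.of fun i j => ∫ a, f a i * f a j ∂μ).PosSemidef := by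
  refine Matrix.PosSemidef.of_dotProduct_mulVec_nonneg ?_ fun u => ?_
  · ext i j
    simp [Matrix.conjTranspose_apply, mul_comm]
  · rw [star_trivial, dotProduct_secondMoment_mulVec hf]
    exact integral_nonneg fun a => sq_nonneg _

end Normality

/-! ### From linearized moment equations to asymptotic normality. -/

section Estimation

variable {Ω 𝒳 ι : Type*} [MeasurableSpace Ω] [MeasurableSpace 𝒳] [Fintype ι] [DecidableEq ι]
  {P : Measure Ω} [IsProbabilityMeasure P] {μ : Measure 𝒳} {X : ℕ → Ω → 𝒳}
  {f : 𝒳 → EuclideanSpace ℝ ι}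

omit [DecidableEq ι] in
-- Tightness is read off the characteristic functions: they converge pointwise to a function
-- continuous at zero.
theorem isTightMeasureSet_range_map {Z : ℕ → Ω → EuclideanSpace ℝ ι}
    {ν : Measure (EuclideanSpace ℝ ι)} [IsProbabilityMeasure ν]
    (h : TendstoInDistribution Z atTop (id : EuclideanSpace ℝ ι → EuclideanSpace ℝ ι)
      (fun _ => P) ν) :
    IsTightMeasureSet (Set.range fun n => P.map (Z n)) := by
  have hp : ∀ n, IsProbabilityMeasure (P.map (Z n)) := fun n =>
    Measure.isProbabilityMeasure_map (h.forall_aemeasurable n)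
  refine isTightMeasureSet_of_tendsto_charFun (f := charFun (ν.map id)) ?_
    (ProbabilityMeasure.tendsto_iff_tendsto_charFun.1 h.tendsto)
  have : IsFiniteMeasure (ν.map id) := by rw [Measure.map_id]; infer_instance
  exact (continuous_charFun (μ := ν.map id)).continuousAt

/-- Asymptotic normality of an approximate zero of linearized moment equations. -/
theorem tendstoInDistribution_sqrt_smul (hlaw : ∀ i, HasLaw (X i) μ P) (hindep : iIndepFun X P)
    (hf : MemLp f 2 μ) (hf0 : ∫ a, f a ∂μ = 0) {A : Matrix ι ι ℝ} (hA : IsUnit A.det)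
    {d : ℕ → Ω → EuclideanSpace ℝ ι} (hd : ∀ n, AEMeasurable (d n) P)
    (hlin : ∀ ε > 0, ∀ᶠ p in prFilter P, ‖avg (fun i : Fin p.1 => X i p.2) f +
      Matrix.toEuclideanCLM (𝕜 := ℝ) A (d p.1 p.2)‖ ≤ ε * ‖d p.1 p.2‖) :
    TendstoInDistribution (fun (n : ℕ) ω => √n • d n ω) atTop
      (id : EuclideanSpace ℝ ι → EuclideanSpace ℝ ι) (fun _ => P)
      (multivariateGaussian 0
        (A⁻¹ * (Matrix.of fun i j => ∫ a, f a i * f a j ∂μ) * A.transpose⁻¹)) := by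
  have hprob : IsProbabilityMeasure μ := by
    rw [← (hlaw 0).map_eq]
    exact Measure.isProbabilityMeasure_map (hlaw 0).aemeasurable
  set R : EuclideanSpace ℝ ι →L[ℝ] EuclideanSpace ℝ ι := Matrix.toEuclideanCLM (𝕜 := ℝ) A⁻¹ with hR
  have hRA : ∀ v, R (Matrix.toEuclideanCLM (𝕜 := ℝ) A v) = v := by
    intro v
    rw [← mul_apply_eq_comp, hR, ← map_mul, Matrix.nonsing_inv_mul _ hA, map_one]
    rfl
  have hRf : MemLp (fun a => -R (f a)) 2 μ := (R.comp_memLp' hf).neg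
  have hRf0 : ∫ a, -R (f a) ∂μ = 0 := by
    rw [integral_neg, R.integral_comp_comm (hf.integrable one_le_two), hf0, map_zero, neg_zero]
  have hS : (A⁻¹ * (Matrix.of fun i j => ∫ a, f a i * f a j ∂μ) * A.transpose⁻¹).PosSemidef := by
    rw [← Matrix.transpose_nonsing_inv]
    simpa using (posSemidef_secondMoment hf).mul_mul_conjTranspose_same A⁻¹
  have hquad : ∀ t : EuclideanSpace ℝ ι, t.ofLp ⬝ᵥ
      (A⁻¹ * (Matrix.of fun i j => ∫ a, f a i * f a j ∂μ) * A.transpose⁻¹).mulVec t.ofLp =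
      ∫ a, inner ℝ t (-R (f a)) ^ 2 ∂μ := by
    intro t
    rw [← Matrix.mulVec_mulVec, ← Matrix.mulVec_mulVec, Matrix.dotProduct_mulVec,
      ← Matrix.transpose_nonsing_inv, ← Matrix.mulVec_transpose, dotProduct_secondMoment_mulVec hf]
    refine integral_congr_ae (ae_of_all _ fun a => ?_)
    simp only
    rw [inner_neg_right, neg_sq, hR, Matrix.inner_toEuclideanCLM, Matrix.dotProduct_mulVec,
      ← Matrix.mulVec_transpose]
  have hclt := tendstoInDistribution_inv_sqrt_smul_sum hlaw hindep hRf hRf0 hS hquad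
  refine tendstoInDistribution_of_tendstoInMeasure_sub _ _ hclt ?_ fun n =>
    (measurable_const_smul (√(n : ℝ))).comp_aemeasurable (hd n)
  refine tendstoInMeasure_sub_of_isTightMeasureSet hclt.forall_aemeasurable
    (isTightMeasureSet_range_map hclt) fun η hη => ?_
  have hpos : ∀ᶠ p : ℕ × Ω in prFilter P, 0 < p.1 := (sampleLLN_prFilter hlaw hindep).size_pos
  -- choose `ε` with `‖R‖ ε ≤ min (1/2) (η/2)`
  set c := min (1 / 2) (η / 2) with hc
  have hc0 : 0 < c := by positivity
  have hc1 : c ≤ 1 / 2 := min_le_left _ _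
  have hc2 : c ≤ η / 2 := min_le_right _ _
  filter_upwards [hlin (c / (‖R‖ + 1)) (by positivity), hpos] with p hp hp0
  have hn : (0 : ℝ) < p.1 := by exact_mod_cast hp0
  have hsq : √(p.1 : ℝ) ≠ 0 := (Real.sqrt_pos.2 hn).ne'
  set D := √(p.1 : ℝ) • d p.1 p.2 with hD
  set Z := (√(p.1 : ℝ))⁻¹ • ∑ i ∈ Finset.range p.1, -R (f (X i p.2)) with hZ
  have e1 : D - Z = √(p.1 : ℝ) • R (avg (fun i : Fin p.1 => X i p.2) f +
      Matrix.toEuclideanCLM (𝕜 := ℝ) A (d p.1 p.2)) := by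
    rw [map_add, hRA, smul_add, add_comm, hD, hZ, sub_eq_add_neg, avg,
      Fin.sum_univ_eq_sum_range (fun i => f (X i p.2)), Finset.sum_neg_distrib, smul_neg, neg_neg,
      map_smul, map_sum, smul_smul]
    congr 2
    rw [eq_mul_inv_iff_mul_eq₀ hn.ne', inv_mul_eq_iff_eq_mul₀ hsq, Real.mul_self_sqrt hn.le]
  -- The remainder is first small relative to `D`. As `c ≤ 1/2`, the triangle inequality absorbs it
  -- and makes it small relative to the tight sequence `Z`.
  have e2 : ‖D - Z‖ ≤ c * ‖D‖ := by
    rw [e1, hD, norm_smul, norm_smul]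
    have h1 : ‖R (avg (fun i : Fin p.1 => X i p.2) f +
        Matrix.toEuclideanCLM (𝕜 := ℝ) A (d p.1 p.2))‖ ≤ ‖R‖ * (c / (‖R‖ + 1) * ‖d p.1 p.2‖) :=
      R.le_opNorm_of_le hp
    have h2 : ‖R‖ * (c / (‖R‖ + 1)) ≤ c := by
      rw [mul_div_assoc', div_le_iff₀ (by positivity)]
      nlinarith [norm_nonneg R]
    calc _ ≤ ‖√(p.1 : ℝ)‖ * (‖R‖ * (c / (‖R‖ + 1) * ‖d p.1 p.2‖)) := by gcongr
      _ = ‖√(p.1 : ℝ)‖ * ‖d p.1 p.2‖ * (‖R‖ * (c / (‖R‖ + 1))) := by ring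
      _ ≤ ‖√(p.1 : ℝ)‖ * ‖d p.1 p.2‖ * c := by gcongr
      _ = _ := by ring
  have e3 : ‖D‖ ≤ ‖D - Z‖ + ‖Z‖ := by simpa using norm_add_le (D - Z) Z
  have h4 : ‖D - Z‖ ≤ 2 * c * ‖Z‖ := by
    nlinarith [norm_nonneg (D - Z), norm_nonneg Z, norm_nonneg D]
  refine h4.trans ?_
  gcongr
  linarith

end Estimation

/-- Limits along the filter are unique because an empty event cannot have probability tending to
one. -/
theorem neBot_prFilter {Ω : Type*} [MeasurableSpace Ω] {P : Measure Ω} [IsProbabilityMeasure P] :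
    (prFilter P).NeBot := by
  refine ⟨fun h => ?_⟩
  have h1 : ∀ᶠ p in prFilter P, False := by rw [h]; exact eventually_bot
  have h2 := eventually_prFilter.1 h1
  simp at h2

/-! ### Derivative and second moments of the moment function. -/

section Moments

variable {𝒳 : Type*} [MeasurableSpace 𝒳] {Ng Nt : ℕ} {g : 𝒳 → E Nt → E Ng} {μ : Measure 𝒳}
  {v b : 𝒳 → ℝ} {β₀ : B Ng Nt} {δ : ℝ}

theorem toEuclideanCLM_Gam (hint : Integrable (fun a => fderiv ℝ (phi g a) β₀) μ) :
    Matrix.toEuclideanCLM (𝕜 := ℝ) (Gam μ g β₀) = ∫ a, fderiv ℝ (phi g a) β₀ ∂μ := by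
  refine ContinuousLinearMap.ext fun w => ?_
  ext i
  have h : ∀ j, ((∫ a, fderiv ℝ (phi g a) β₀ ∂μ) (EuclideanSpace.single j 1)) i = Gam μ g β₀ i j := by
    intro j
    rw [ContinuousLinearMap.integral_apply hint]
    exact ((EuclideanSpace.proj (𝕜 := ℝ) i : B Ng Nt →L[ℝ] ℝ).integral_comp_comm
      (hint.apply_continuousLinearMap (EuclideanSpace.single j 1))).symm
  rw [Matrix.ofLp_toEuclideanCLM]
  conv_rhs => rw [clm_eq_sum_smulRight (∫ a, fderiv ℝ (phi g a) β₀ ∂μ)]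
  simp only [Matrix.mulVec, dotProduct, sum_apply, ContinuousLinearMap.smulRight_apply,
    WithLp.ofLp_sum, WithLp.ofLp_smul, Finset.sum_apply, Pi.smul_apply, h, smul_eq_mul]
  exact Finset.sum_congr rfl fun j _ => mul_comm _ _

/-- Squaring the bound `(1+v)(1+b)²` uses exactly the highest moments assumed. -/
theorem memLp_phi (hδ : 0 < δ) (hgm : Measurable (Function.uncurry g))
    (hae : ∀ᵐ a ∂μ, a ∈ regularPoints g v b β₀ δ)
    (hint : Integrable (fun a => (1 + v a) ^ 2 * (1 + b a) ^ 4) μ) :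
    MemLp (fun a => phi g a β₀) 2 μ := by
  have hmem : β₀ ∈ Metric.ball β₀ δ := Metric.mem_ball_self hδ
  have hm := aestronglyMeasurable_phi hδ hgm hae hmem
  rw [memLp_two_iff_integrable_sq_norm hm]
  obtain ⟨C, hC, h⟩ := lipGraded_phi (g := g) (v := v) (b := b) (β₀ := β₀) hδ
  refine (hint.const_mul (C ^ 2)).mono' (hm.norm.pow 2) ?_
  filter_upwards [hae] with a ha
  rw [Real.norm_of_nonneg (by positivity)]
  calc ‖phi g a β₀‖ ^ 2 ≤ (C * ((1 + v a) * (1 + b a) ^ 2)) ^ 2 := by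
        gcongr
        exact (h a ha).1 β₀ hmem
    _ = _ := by ring

end Moments

end ETEL

theorem theorem10 {Ω 𝒳 : Type*} [MeasurableSpace Ω] [MeasurableSpace 𝒳] [StandardBorelSpace 𝒳]
    (P : Measure Ω) [IsProbabilityMeasure P] (μ : Measure 𝒳) {Ng Nt : ℕ}
    (X : ℕ → Ω → 𝒳) (hlaw : ∀ i, HasLaw (X i) μ P) (hindep : iIndepFun X P)
    (g : 𝒳 → ETEL.E Nt → ETEL.E Ng) (Θ : Set (ETEL.E Nt))
    (lamS : ETEL.E Nt → ETEL.E Ng) (θs : ETEL.E Nt)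
    (Λ : ETEL.E Nt → Set (ETEL.E Ng)) (N : Set (ETEL.E Nt)) (b : 𝒳 → ℝ)
    (hreg : ETEL.Regularity μ g Θ lamS θs Λ N b)
    (hΓ : IsUnit (ETEL.Gam μ g (ETEL.betaStar μ g lamS θs)).det)
    (βhat : ℕ → Ω → ETEL.B Ng Nt) (hmeas : ∀ n, AEMeasurable (βhat n) P)
    (hβ : Tendsto (fun n => P {ω | ¬ ETEL.IsAugmentedETEL g Θ (fun i : Fin n => X i ω) (βhat n ω)})
      atTop (𝓝 0)) :
    TendstoInDistribution
      (fun (n : ℕ) ω => Real.sqrt n • (βhat n ω - ETEL.betaStar μ g lamS θs)) atTop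
      (id : ETEL.B Ng Nt → ETEL.B Ng Nt) (fun _ => P)
      (multivariateGaussian 0
        ((ETEL.Gam μ g (ETEL.betaStar μ g lamS θs))⁻¹
          * ETEL.Phi μ g (ETEL.betaStar μ g lamS θs)
          * ((ETEL.Gam μ g (ETEL.betaStar μ g lamS θs)).transpose)⁻¹)) := by
  have hprob : IsProbabilityMeasure μ := by
    rw [← (hlaw 0).map_eq]
    exact Measure.isProbabilityMeasure_map (hlaw 0).aemeasurable
  have hs := ETEL.sampleLLN_prFilter hlaw hindep
  have haug : ∀ᶠ p in ETEL.prFilter P,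
      ETEL.IsAugmentedETEL g Θ (fun i : Fin p.1 => X i p.2) (βhat p.1 p.2) :=
    ETEL.eventually_prFilter.2 hβ
  set β₀ := ETEL.betaStar μ g lamS θs with hβ₀
  obtain ⟨δ, hδ, hδN, v, -, hae, hint⟩ := hreg.exists_regularPoints (β₀ := β₀) rfl rfl
  obtain ⟨hlim, hunit⟩ := hreg.tendsto_augmented hs hprob.ne_zero hδ hae hint haug
  have hth : ETEL.thOf β₀ = θs := rfl
  rw [← hβ₀] at hlim
  clear_value β₀
  have hmem : β₀ ∈ Metric.ball β₀ δ := Metric.mem_ball_self hδ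
  have hzero : ∀ᶠ p in ETEL.prFilter P,
      ETEL.avg (fun i : Fin p.1 => X i p.2) (fun a => ETEL.phi g a (βhat p.1 p.2)) = 0 := by
    filter_upwards [haug, hunit, hs.size_pos, hs.ae _ hae, hlim (Metric.ball_mem_nhds β₀ hδ)]
      with p h1 h2 h3 h4 h5
    have h6 : ETEL.thOf (βhat p.1 p.2) ∈ Metric.ball (ETEL.thOf β₀) δ := ETEL.th_mem_ball h5
    exact h1.avg_phi_eq_zero h3
      (mem_of_superset (Metric.isOpen_ball.mem_nhds (hth ▸ h6)) (hδN.trans hreg.N_subset))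
      (fun i => ((h4 i).contDiffAt h6).of_le one_le_two) h2
  -- The population moment equations need no derivation of their own: the averages of `φ` at the
  -- estimate converge to this mean and are eventually zero.
  have hmean : ∫ a, ETEL.phi g a β₀ ∂μ = 0 := by
    have : (ETEL.prFilter P).NeBot := ETEL.neBot_prFilter
    have h1 := ((ETEL.lipGraded_phi hδ).tendsto_avg hδ hae hint
      (ETEL.aestronglyMeasurable_phi hδ hreg.measurable_g hae hmem) hs hlim).2
    exact tendsto_nhds_unique h1 (tendsto_const_nhds.congr' (by
      filter_upwards [hzero] with p hp using hp.symm))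
  obtain ⟨L, hL, hle⟩ := (ETEL.lipGraded_phi hδ).exists_integrable hae hint
  have hphim := fun β (hβ : β ∈ Metric.ball β₀ δ) =>
    ETEL.aestronglyMeasurable_phi hδ hreg.measurable_g hae hβ
  have hdiff : ∀ᵐ a ∂μ, DifferentiableAt ℝ (ETEL.phi g a) β₀ := by
    filter_upwards [hae] with a ha using ETEL.differentiableAt_phi ha hmem
  have hderiv := (ETEL.integrable_fderiv hδ hL hphim hdiff (by
    filter_upwards [hle] with a ha
    exact ⟨ha.1, fun β hβ => ha.2.2 β hβ β₀ hmem⟩)).1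
  refine ETEL.tendstoInDistribution_sqrt_smul hlaw hindep
    (ETEL.memLp_phi hδ hreg.measurable_g hae hint) hmean hΓ
    (d := fun n ω => βhat n ω - β₀) (fun n => (hmeas n).sub_const β₀) fun ε hε => ?_
  rw [ETEL.toEuclideanCLM_Gam hderiv]
  obtain ⟨δ', hδ', hlin⟩ := hs.eventually_linearization hδ hL hphim hdiff (by
    filter_upwards [hle] with a ha using ⟨ha.1, ha.2.2⟩) hε
  -- The average at the estimate vanishes, so the linearization error is exactly the combination to
  -- be bounded, up to sign.
  filter_upwards [hlin, hzero, hlim (Metric.ball_mem_nhds β₀ hδ')] with p h1 h2 h3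
  have h4 := h1 _ h3
  rwa [h2, zero_sub, ← neg_add', norm_neg] at h4
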